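/- A *constraint* of arity $k$ is a Boolean function $\{0,1\}^k\to\{0,1\}$. It is *2-affine* if it is equivalent to a conjunction of XOR-clauses (exclusive ors of literals), each containing at most two literals; a finite set $\mathcal C$ of constraints is 2-affine if each of its members is. A *constraint application* of $\mathcal C$ over a finite set $X$ of variables is $C(x_1,\dots,x_k)$ with $C\in\mathcal C$ of arity $k$ and $x_1,\dots,x_k\in X$ not necessarily distinct; the constants $0$ and $1$ are not allowed as arguments. $\mathrm{ISO}(\mathcal C)$ is the following decision problem: given a finite set $X$ of variables and two finite sets $S$ and $U$ of constraint applications of $\mathcal C$ over $X$, is there a permutation $\pi$ of $X$ such that $\pi(S)$ (obtained by simultaneously replacing each variable $x$ by $\pi(x)$) is equivalent to $U$, i.e. exactly the same assignments $X\to\{0,1\}$ satisfy all applications in $\pi(S)$ as satisfy all applications in $U$? $\mathrm{GI}$ is the decision problem whether two given finite simple undirected graphs are isomorphic. **Theorem.** Let $\mathcal C$ be a finite set of constraints. If $\mathcal C$ is not 2-affine, then $\mathrm{GI}$ is polynomial-time many-one reducible to $\mathrm{ISO}(\mathcal C)$, that is, there is a function $f$, computable by a Turing machine in polynomial time, that maps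 pairs of graphs to instances of $\mathrm{ISO}(\mathcal C)$ such that $G$ and $H$ are isomorphic if and only if $f(G,H)$ is a yes-instance of $\mathrm{ISO}(\mathcal C)$. -/

import Mathlib

namespace BoolIso

/-! ### Decision problems and polynomial-time many-one reductions -/

/-- A decision problem: a type of instances, an (injective) encoding of the instances as words over
a finite alphabet, and the predicate saying which instances are to be accepted. -/
structure DecisionProblem where
  /-- the instances -/
  Inst : Type
  /-- the alphabet of the encoding -/
  Symb : Type
  finite_symb : Finite Symb
  /-- the encoding of instances by words -/
  encode : Inst → List Symb
  encode_injective : Function.Injective encode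
  /-- the accepted instances -/
  Yes : Inst → Prop

/-- `P ≤ₘᵖ Q`: some function `f` from the instances of `P` to those of `Q` is computed by a
(multi-tape) Turing machine in time polynomial in the length of the encoded input, and `x` is
accepted by `P` exactly when `f x` is accepted by `Q`. -/
def PolyTimeManyOneReducible (P Q : DecisionProblem) : Prop :=
  ∃ f : P.Inst → Q.Inst,
    Nonempty (Turing.TM2ComputableInPolyTime P.encode Q.encode f) ∧
      ∀ x : P.Inst, P.Yes x ↔ Q.Yes (f x)

/-! ### Graph isomorphism -/

/-- An instance of graph isomorphism: two finite simple graphs, with vertices numbered. -/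
structure GraphPair where
  /-- number of vertices of the first graph -/
  n : ℕ
  /-- number of vertices of the second graph -/
  m : ℕ
  /-- the first graph -/
  G : SimpleGraph (Fin n)
  /-- the second graph -/
  H : SimpleGraph (Fin m)

/-- Alphabet for writing down adjacency matrices. -/
inductive GraphSymb : Type
  | bit (b : Bool)
  | endRow
  | endGraph

open Classical in
/-- A graph on `{0, …, n-1}` is written as its adjacency matrix, row by row. -/
noncomputable def encodeGraph {n : ℕ} (G : SimpleGraph (Fin n)) : List GraphSymb :=
  (List.finRange n).flatMap
      (fun i => (List.finRange n).map (fun j => GraphSymb.bit (decide (G.Adj i j))) ++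
        [GraphSymb.endRow]) ++
    [GraphSymb.endGraph]

/-- The encoding of a pair of graphs. -/
noncomputable def GraphPair.encode (p : GraphPair) : List GraphSymb :=
  encodeGraph p.G ++ encodeGraph p.H

/-! ### Boolean constraints -/

/-- A constraint of arity `k` is a Boolean function from `{0,1}^k` to `{0,1}`. -/
structure Constraint : Type where
  /-- the arity -/
  arity : ℕ
  /-- the Boolean function -/
  eval : (Fin arity → Bool) → Bool

/-- A literal over `k` variables: `(i, true)` is the variable `i`, `(i, false)` its negation. -/
abbrev Literal (k : ℕ) : Type := Fin k × Bool

/-- The truth value of a literal. -/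
def Literal.eval {k : ℕ} (l : Literal k) (a : Fin k → Bool) : Bool :=
  if l.2 then a l.1 else !(a l.1)

/-- The truth value of an XOR-clause (a list of literals): the exclusive or of its literals.
The empty clause is false. -/
def xorClauseEval {k : ℕ} (c : List (Literal k)) (a : Fin k → Bool) : Bool :=
  c.foldr (fun l b => xor (Literal.eval l a) b) false

/-- `C` is 2-affine: equivalent to a conjunction of XOR-clauses with at most two literals each. -/
def Constraint.IsTwoAffine (C : Constraint) : Prop :=
  ∃ φ : List (List (Literal C.arity)),
    (∀ c ∈ φ, c.length ≤ 2) ∧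
      ∀ a : Fin C.arity → Bool, C.eval a = true ↔ ∀ c ∈ φ, xorClauseEval c a = true

/-- A finite set of constraints is 2-affine if each of its members is. -/
def IsTwoAffine (𝒞 : Finset Constraint) : Prop :=
  ∀ C ∈ 𝒞, C.IsTwoAffine

/-- A constraint application `C(x₁, …, x_k)` (without constants) of a constraint `C ∈ 𝒞`
to variables from `X`, which need not be distinct. -/
structure Application (𝒞 : Finset Constraint) (X : Type) where
  /-- the constraint that is applied -/
  con : {C : Constraint // C ∈ 𝒞}
  /-- the variables to which it is applied -/
  arg : Fin con.1.arity → X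

variable {𝒞 : Finset Constraint} {X : Type}

/-- The value of a constraint application under an assignment. -/
def Application.eval (A : Application 𝒞 X) (a : X → Bool) : Bool :=
  A.con.1.eval (fun i => a (A.arg i))

/-- Replace simultaneously every variable `x` by `π x`. -/
def Application.rename (π : Equiv.Perm X) (A : Application 𝒞 X) : Application 𝒞 X where
  con := A.con
  arg := fun i => π (A.arg i)

/-- An assignment satisfies a set (given as a list) of constraint applications if it satisfies every
one of them. -/
def Satisfies (a : X → Bool) (S : List (Application 𝒞 X)) : Prop :=
  ∀ A ∈ S, A.eval a = true

/-- Two sets of constraint applications over `X` are equivalent if the same assignments to `X`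
satisfy them. -/
def Equivalent (S U : List (Application 𝒞 X)) : Prop :=
  ∀ a : X → Bool, Satisfies a S ↔ Satisfies a U

/-- `S` and `U` are isomorphic: `π(S)` is equivalent to `U` for some permutation `π` of `X`. -/
def Isomorphic (S U : List (Application 𝒞 X)) : Prop :=
  ∃ π : Equiv.Perm X, Equivalent (S.map (Application.rename π)) U

/-- An instance of the isomorphism problem for constraints from `𝒞`: a finite set
`X = {0, …, n-1}` of variables and two finite sets `S`, `U`, given as lists, of constraint
applications of `𝒞` over `X`. -/
structure IsoInstance (𝒞 : Finset Constraint) where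
  /-- the number of variables -/
  n : ℕ
  /-- the first set of constraint applications -/
  S : List (Application 𝒞 (Fin n))
  /-- the second set of constraint applications -/
  U : List (Application 𝒞 (Fin n))

/-- Alphabet for writing down sets of constraint applications. As `𝒞` is finite and not part of the
input, there is one symbol for each of its members. -/
inductive IsoSymb (𝒞 : Finset Constraint) : Type
  | tick
  | endNum
  | con (C : {C : Constraint // C ∈ 𝒞})
  | endSet

/-- Numbers are written in unary. (The set of variables is listed in the input, so unary and binary
names of variables lead to input lengths that are polynomially related.) -/
def encodeNum (𝒞 : Finset Constraint) (k : ℕ) : List (IsoSymb 𝒞) :=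
  List.replicate k IsoSymb.tick ++ [IsoSymb.endNum]

/-- A constraint application is written as the constraint followed by the variables. -/
def encodeApplication {n : ℕ} (A : Application 𝒞 (Fin n)) : List (IsoSymb 𝒞) :=
  IsoSymb.con A.con ::
    (List.finRange A.con.1.arity).flatMap (fun i => encodeNum 𝒞 (A.arg i).val)

/-- A set of constraint applications is written as a list of them. -/
def encodeSet {n : ℕ} (S : List (Application 𝒞 (Fin n))) : List (IsoSymb 𝒞) :=
  S.flatMap encodeApplication ++ [IsoSymb.endSet]

/-- The encoding of an instance: the set of variables and the two sets of applications. -/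
def IsoInstance.encode (I : IsoInstance 𝒞) : List (IsoSymb 𝒞) :=
  encodeNum 𝒞 I.n ++ (encodeSet I.S ++ encodeSet I.U)

/-! ### The encodings are injective words over finite alphabets -/

theorem finite_graphSymb : Finite GraphSymb := by
  let f : Option (Option Bool) → GraphSymb := fun
    | none => .endRow
    | some none => .endGraph
    | some (some b) => .bit b
  refine Finite.of_surjective f ?_
  rintro (b | _ | _)
  exacts [⟨some (some b), rfl⟩, ⟨none, rfl⟩, ⟨some none, rfl⟩]

theorem finite_isoSymb (𝒞 : Finset Constraint) : Finite (IsoSymb 𝒞) := by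
  let f : Option (Option (Option {C : Constraint // C ∈ 𝒞})) → IsoSymb 𝒞 := fun
    | none => .tick
    | some none => .endNum
    | some (some none) => .endSet
    | some (some (some C)) => .con C
  refine Finite.of_surjective f ?_
  rintro (_ | _ | C | _)
  exacts [⟨none, rfl⟩, ⟨some none, rfl⟩, ⟨some (some (some C)), rfl⟩, ⟨some (some none), rfl⟩]

theorem flatMap_prefixFree {ι A B : Type} (e : A → List B)
    (he : ∀ x y s t, e x ++ s = e y ++ t → x = y ∧ s = t) (f g : ι → A) (l : List ι)
    (s t : List B)
    (h : l.flatMap (fun i => e (f i)) ++ s = l.flatMap (fun i => e (g i)) ++ t) :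
    (∀ i ∈ l, f i = g i) ∧ s = t := by
  induction l with
  | nil => simpa using h
  | cons i l ih =>
    simp only [List.flatMap_cons, List.append_assoc] at h
    obtain ⟨h1, h2⟩ := he _ _ _ _ h
    obtain ⟨h3, h4⟩ := ih h2
    exact ⟨by simpa using ⟨h1, h3⟩, h4⟩

theorem encodeNum_prefixFree (𝒞 : Finset Constraint) (k l : ℕ) (s t : List (IsoSymb 𝒞))
    (h : encodeNum 𝒞 k ++ s = encodeNum 𝒞 l ++ t) : k = l ∧ s = t := by
  induction k generalizing l with
  | zero =>
    cases l with
    | zero => simpa [encodeNum] using h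
    | succ l => simp [encodeNum, List.replicate_succ] at h
  | succ k ih =>
    cases l with
    | zero => simp [encodeNum, List.replicate_succ] at h
    | succ l =>
      have := ih l (by simpa [encodeNum, List.replicate_succ] using h)
      exact ⟨by rw [this.1], this.2⟩

theorem encodeApplication_prefixFree {n : ℕ} (A B : Application 𝒞 (Fin n))
    (s t : List (IsoSymb 𝒞)) (h : encodeApplication A ++ s = encodeApplication B ++ t) :
    A = B ∧ s = t := by
  obtain ⟨C, f⟩ := A
  obtain ⟨D, g⟩ := B
  simp only [encodeApplication, List.cons_append, List.cons.injEq, IsoSymb.con.injEq] at h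
  obtain ⟨rfl, h⟩ := h
  obtain ⟨h1, h2⟩ := flatMap_prefixFree (fun v : Fin n => encodeNum 𝒞 v.val)
    (fun x y s t h => by
      obtain ⟨h1, h2⟩ := encodeNum_prefixFree 𝒞 _ _ _ _ h
      exact ⟨Fin.ext h1, h2⟩) f g _ _ _ h
  have : f = g := funext fun i => h1 i (List.mem_finRange i)
  exact ⟨by rw [this], h2⟩

theorem encodeSet_prefixFree {n : ℕ} (S U : List (Application 𝒞 (Fin n)))
    (s t : List (IsoSymb 𝒞)) (h : encodeSet S ++ s = encodeSet U ++ t) : S = U ∧ s = t := by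
  induction S generalizing U with
  | nil =>
    cases U with
    | nil => simpa [encodeSet] using h
    | cons B U => simp [encodeSet, encodeApplication] at h
  | cons A S ih =>
    cases U with
    | nil => simp [encodeSet, encodeApplication] at h
    | cons B U =>
      simp only [encodeSet, List.flatMap_cons, List.append_assoc] at h
      obtain ⟨rfl, h2⟩ := encodeApplication_prefixFree _ _ _ _ h
      obtain ⟨rfl, h3⟩ := ih U (by simpa [encodeSet] using h2)
      exact ⟨rfl, h3⟩

theorem IsoInstance.encode_injective (𝒞 : Finset Constraint) :
    Function.Injective (IsoInstance.encode (𝒞 := 𝒞)) := by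
  rintro ⟨n, S, U⟩ ⟨m, T, V⟩ h
  obtain ⟨h1, h⟩ := encodeNum_prefixFree 𝒞 _ _ _ _ h
  dsimp only at h1 h
  subst h1
  obtain ⟨rfl, h⟩ := encodeSet_prefixFree _ _ _ _ h
  obtain ⟨rfl, -⟩ := encodeSet_prefixFree U V [] [] (by simpa using h)
  rfl

theorem row_prefixFree (r r' : List Bool) (s t : List GraphSymb)
    (h : (r.map GraphSymb.bit ++ [GraphSymb.endRow]) ++ s =
      (r'.map GraphSymb.bit ++ [GraphSymb.endRow]) ++ t) : r = r' ∧ s = t := by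
  induction r generalizing r' with
  | nil => cases r' <;> simp_all
  | cons b r ih =>
    cases r' with
    | nil => simp at h
    | cons b' r' =>
      simp only [List.map_cons, List.cons_append, List.cons.injEq, GraphSymb.bit.injEq] at h
      obtain ⟨rfl, h⟩ := h
      obtain ⟨h1, h2⟩ := ih r' h
      exact ⟨by rw [h1], h2⟩

theorem matrix_prefixFree (M M' : List (List Bool)) (s t : List GraphSymb)
    (h : (M.flatMap (fun r => r.map GraphSymb.bit ++ [GraphSymb.endRow]) ++
        [GraphSymb.endGraph]) ++ s =
      (M'.flatMap (fun r => r.map GraphSymb.bit ++ [GraphSymb.endRow]) ++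
        [GraphSymb.endGraph]) ++ t) : M = M' ∧ s = t := by
  induction M generalizing M' with
  | nil =>
    cases M' with
    | nil => simpa using h
    | cons r' M' => cases r' <;> simp at h
  | cons r M ih =>
    cases M' with
    | nil => cases r <;> simp at h
    | cons r' M' =>
      obtain ⟨h1, h2⟩ := row_prefixFree r r' _ _ (by simpa using h)
      obtain ⟨h3, h4⟩ := ih M' (by simpa using h2)
      exact ⟨by rw [h1, h3], h4⟩

open Classical in
theorem encodeGraph_eq {n : ℕ} (G : SimpleGraph (Fin n)) :
    encodeGraph G = ((List.finRange n).map
      (fun i => (List.finRange n).map (fun j => decide (G.Adj i j)))).flatMap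
        (fun r => r.map GraphSymb.bit ++ [GraphSymb.endRow]) ++ [GraphSymb.endGraph] := by
  simp [encodeGraph, List.flatMap_map, Function.comp_def]

theorem encodeGraph_prefixFree {n m : ℕ} (G : SimpleGraph (Fin n)) (H : SimpleGraph (Fin m))
    (s t : List GraphSymb) (h : encodeGraph G ++ s = encodeGraph H ++ t) :
    n = m ∧ HEq G H ∧ s = t := by
  rw [encodeGraph_eq, encodeGraph_eq] at h
  obtain ⟨h1, h2⟩ := matrix_prefixFree _ _ _ _ h
  have hn : n = m := by simpa using congrArg List.length h1
  subst hn
  refine ⟨rfl, heq_of_eq ?_, h2⟩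
  ext i j
  have h3 := List.map_inj_left.1 h1 i (List.mem_finRange i)
  have h4 := List.map_inj_left.1 h3 j (List.mem_finRange j)
  simpa using h4

theorem GraphPair.encode_injective : Function.Injective GraphPair.encode := by
  rintro ⟨n, m, G, H⟩ ⟨n', m', G', H'⟩ h
  obtain ⟨h1, h2, h⟩ := encodeGraph_prefixFree _ _ _ _ h
  obtain ⟨h3, h4, -⟩ := encodeGraph_prefixFree H H' [] [] (by simpa using h)
  dsimp only at h1 h2
  subst h1 h3
  obtain rfl := eq_of_heq h2
  obtain rfl := eq_of_heq h4
  rfl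

/-! ### The two problems -/

/-- GI: given two graphs, are they isomorphic? -/
noncomputable def GI : DecisionProblem where
  Inst := GraphPair
  Symb := GraphSymb
  finite_symb := finite_graphSymb
  encode := GraphPair.encode
  encode_injective := GraphPair.encode_injective
  Yes := fun p => Nonempty (p.G ≃g p.H)

/-- ISO(𝒞): given two sets of constraint applications of `𝒞` (without constants) over the same set
of variables, are they isomorphic? -/
def ISO (𝒞 : Finset Constraint) : DecisionProblem where
  Inst := IsoInstance 𝒞
  Symb := IsoSymb 𝒞
  finite_symb := finite_isoSymb 𝒞
  encode := IsoInstance.encode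
  encode_injective := IsoInstance.encode_injective 𝒞
  Yes := fun I => Isomorphic I.S I.U

end BoolIso

namespace BoolIso

/-! ### Boolean relations that are not 2-affine -/

/-! Translating a relation by one of its members `p` turns majority and minority with third argument
`p` into AND and XOR. A relation closed under both therefore becomes a ring of subsets of a finite
set, and such a ring is defined by equations `b i = false` and `b i = b j`, which are XOR-clauses
with at most two literals (`isTwoAffine_of_closedAt`). So a relation that is not 2-affine is
nonempty, and for each member `p` it has members `a`, `b` whose majority or minority with `p` is
missing. Identifying coordinates according to which of `a`, `b` differ from `p` there gives a
ternary relation that contains 111, 001, 010 but not both 011 and 100. Any such relation yields, by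
identifying arguments, inserting true and taking conjunctions, one of four gadgets that link the
unknown of an edge to those of its end points (`exists_encodes`).

Constants may not be used as arguments. They are simulated by two ordinary variables, one of which
serves as the reference. Systems are kept `Good`: a satisfying assignment in which the reference
variable is false can be complemented. Hence the set of satisfying assignments is controlled up to
complementation. How this is achieved, and whether negated copies of the unknowns are needed,
depends on whether the relation contains the constant tuples and is closed under complement;
`encodesGraphs_or_dual` treats all cases, passing to the dual relation where necessary.

A graph becomes a system with unknowns for the vertices and for the ordered pairs of vertices: edges
obey the gadget, and the unknowns of non-adjacent pairs are forced to be true. Graph isomorphisms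
clearly induce isomorphisms of systems. For the converse, the graph must be recovered from the
satisfying assignments in terms that do not depend on the names of the variables. Padding makes the
always-true unknowns account for more than half of the variables. Except for the `or` gadget, where
the unknowns of pairs are themselves always true, vertices are represented three times, so that
their classes of tied variables are larger than those of edges, which contain at most the two
orientations. Adjacency is then visible as a dependence between vertex variables, direct or through
an edge variable (`Represents.conn_iff`), and one set of assignments represents at most one graph
(`Represents.nonempty_iso`).

Polynomial-time computability is shown by an explicit program in a small while language, whose runs
are simulated by stack machines (`Cmd.Run.steps`, `Cmd.tm2ComputableInPolyTime`). Graphs with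
different numbers of vertices are sent to a fixed no-instance. -/

/-- Closure of a Boolean relation under majority and minority with a fixed third argument. -/
def ClosedAt {k : ℕ} (R : (Fin k → Bool) → Bool) (p : Fin k → Bool) : Prop :=
  ∀ a b, R a = true → R b = true →
    R (fun i => (a i && b i) || (a i && p i) || (b i && p i)) = true ∧
      R (fun i => xor (xor (a i) (b i)) (p i)) = true

theorem isTwoAffine_of_empty (C : Constraint) (h : ∀ a, C.eval a = false) : C.IsTwoAffine :=
  ⟨[[]], by simp, fun a => by simp [h a, xorClauseEval]⟩

/-- A ring of sets contains every set which is a union of classes of inseparable points. -/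
theorem mem_ring_of_sets {ι : Type} [Fintype ι] (S : (ι → Bool) → Prop) (h0 : S (fun _ => false))
    (hand : ∀ a b, S a → S b → S (fun i => a i && b i))
    (hxor : ∀ a b, S a → S b → S (fun i => xor (a i) (b i)))
    (b : ι → Bool) (hz : ∀ i, (∀ c, S c → c i = false) → b i = false)
    (he : ∀ i j, (∀ c, S c → c i = c j) → b i = b j) : S b := by
  classical
  -- The set chosen for `i` is a smallest member of the ring containing `i`. Each of its points `j`
  -- is inseparable from `i`: a member `d` separating them would make the intersection with `d`, or
  -- the difference, a smaller member containing `i`. Hence it lies inside `b`.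
  have key : ∀ i, b i = true → ∃ c, S c ∧ c i = true ∧ ∀ j, c j = true → b j = true := by
    intro i hi
    have hex : ∃ m : ℕ, ∃ c, S c ∧ c i = true ∧
        (Finset.univ.filter fun j => c j = true).card = m := by
      by_contra hcon
      have := hz i fun c hc => by
        by_contra hci
        exact hcon ⟨_, c, hc, by simpa using hci, rfl⟩
      simp [hi] at this
    obtain ⟨c, hc, hci, hcard⟩ := Nat.find_spec hex
    have hmin : ∀ d, S d → d i = true → (∀ j, d j = true → c j = true) →
        ∀ j, c j = true → d j = true := by
      intro d hd hdi hdc j hj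
      have hsub : (Finset.univ.filter fun j => d j = true) ⊆
          (Finset.univ.filter fun j => c j = true) := by
        intro x; simpa using hdc x
      have hle := Nat.find_min' hex ⟨d, hd, hdi, rfl⟩
      have heq := Finset.eq_of_subset_of_card_le hsub (by omega)
      have : j ∈ (Finset.univ.filter fun j => d j = true) := by rw [heq]; simpa using hj
      simpa using this
    refine ⟨c, hc, hci, fun j hj => ?_⟩
    rw [← hi]
    refine (he i j fun d hd => ?_).symm
    have h1 := hand c d hc hd
    have h2 := hxor c _ hc h1
    cases hdi : d i
    · have := hmin _ h2 (by simp [hci, hdi]) (fun x => by cases c x <;> simp) j hj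
      revert this; simp [hj]
    · have := hmin _ h1 (by simp [hci, hdi]) (fun x => by cases c x <;> simp) j hj
      revert this; simp [hj]
  have hor : ∀ a b, S a → S b → S (fun i => a i || b i) := by
    intro a b ha hb
    have := hxor _ _ (hxor a b ha hb) (hand a b ha hb)
    convert this using 2 with i
    cases a i <;> cases b i <;> rfl
  choose! f hf using key
  have : ∀ s : Finset ι, ∃ c, S c ∧ (∀ i ∈ s, b i = true → c i = true) ∧
      ∀ j, c j = true → b j = true := by
    intro s
    induction s using Finset.induction_on with
    | empty => exact ⟨_, h0, by simp, by simp⟩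
    | insert i s _ ih =>
      obtain ⟨c, hc, h1, h2⟩ := ih
      by_cases hi : b i = true
      · refine ⟨_, hor c (f i) hc (hf i hi).1, ?_, ?_⟩
        · intro j hj hbj
          rcases Finset.mem_insert.1 hj with rfl | hj
          · simp [(hf j hi).2.1]
          · simp [h1 j hj hbj]
        · intro j hj
          rcases Bool.or_eq_true_iff.1 hj with h | h
          exacts [h2 j h, (hf i hi).2.2 j h]
      · refine ⟨c, hc, ?_, h2⟩
        intro j hj hbj
        rcases Finset.mem_insert.1 hj with rfl | hj
        exacts [absurd hbj hi, h1 j hj hbj]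
  obtain ⟨c, hc, h1, h2⟩ := this Finset.univ
  have : b = c := by
    funext i
    have := h1 i (Finset.mem_univ i)
    have := h2 i
    cases hb : b i <;> cases hci : c i <;> simp_all
  rwa [this]

/-- The translate `S` of the relation by `p` is a ring of sets, so it is cut out by the equations
valid in it. Translated back, an equation `b i = false` becomes a one-literal clause of `φ₁`, and `b
i = b j` a two-literal clause of `φ₂`. -/
theorem isTwoAffine_of_closedAt (C : Constraint) (p : Fin C.arity → Bool) (hp : C.eval p = true)
    (h : ClosedAt C.eval p) : C.IsTwoAffine := by
  classical
  let S : (Fin C.arity → Bool) → Prop := fun b => C.eval (fun i => xor (b i) (p i)) = true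
  let φ₁ := (Finset.univ.filter fun i : Fin C.arity => ∀ b, S b → b i = false).toList.map
    fun i => [((i, p i) : Literal C.arity)]
  let φ₂ := (Finset.univ.filter fun ij : Fin C.arity × Fin C.arity =>
    ∀ b, S b → b ij.1 = b ij.2).toList.map
    fun ij => [((ij.1, true) : Literal C.arity), (ij.2, xor (p ij.1) (p ij.2))]
  have hS : ∀ a, C.eval a = true ↔ S (fun i => xor (a i) (p i)) := by
    intro a; simp [S]
  have e1 : ∀ (a : Fin C.arity → Bool) (i : Fin C.arity),
      xorClauseEval [((i, p i) : Literal C.arity)] a = true ↔ xor (a i) (p i) = false := by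
    intro a i
    simp only [xorClauseEval, Literal.eval, List.foldr]
    cases a i <;> cases p i <;> simp
  have e2 : ∀ (a : Fin C.arity → Bool) (i j : Fin C.arity),
      xorClauseEval [((i, true) : Literal C.arity), (j, xor (p i) (p j))] a = true ↔
        xor (a i) (p i) = xor (a j) (p j) := by
    intro a i j
    simp only [xorClauseEval, Literal.eval, List.foldr]
    cases a i <;> cases p i <;> cases a j <;> cases p j <;> simp
  refine ⟨φ₁ ++ φ₂, ?_, fun a => ?_⟩
  · intro c hc
    rcases List.mem_append.1 hc with hc | hc
    · obtain ⟨i, -, rfl⟩ := List.mem_map.1 hc; simp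
    · obtain ⟨i, -, rfl⟩ := List.mem_map.1 hc; simp
  · rw [hS]
    constructor
    · intro ha c hc
      rcases List.mem_append.1 hc with hc | hc
      · obtain ⟨i, hi, rfl⟩ := List.mem_map.1 hc
        simp only [Finset.mem_toList, Finset.mem_filter] at hi
        exact (e1 a i).2 (hi.2 _ ha)
      · obtain ⟨ij, hi, rfl⟩ := List.mem_map.1 hc
        simp only [Finset.mem_toList, Finset.mem_filter] at hi
        exact (e2 a ij.1 ij.2).2 (hi.2 _ ha)
    · intro hφ
      refine mem_ring_of_sets S ?_ ?_ ?_ _ ?_ ?_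
      · simpa [S] using hp
      · intro a b ha hb
        have := (h _ _ ha hb).1
        simp only [S]
        convert this using 3 with i
        cases a i <;> cases b i <;> cases p i <;> rfl
      · intro a b ha hb
        have := (h _ _ ha hb).2
        simp only [S]
        convert this using 3 with i
        cases a i <;> cases b i <;> cases p i <;> rfl
      · intro i hi
        refine (e1 a i).1 (hφ _ (List.mem_append_left _ (List.mem_map.2 ⟨i, ?_, rfl⟩)))
        simpa using hi
      · intro i j hij
        refine (e2 a i j).1 (hφ _ (List.mem_append_right _ (List.mem_map.2 ⟨(i, j), ?_, rfl⟩)))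
        simpa using hij

/-- Nonempty, and at no member closed under majority and minority. -/
def Unclosed {k : ℕ} (R : (Fin k → Bool) → Bool) : Prop :=
  (∃ a, R a = true) ∧ ∀ p, R p = true → ¬ ClosedAt R p

theorem unclosed_of_not_isTwoAffine (C : Constraint) (h : ¬ C.IsTwoAffine) : Unclosed C.eval := by
  constructor
  · by_contra hc
    exact h (isTwoAffine_of_empty C fun a => by simpa using fun ha => hc ⟨a, ha⟩)
  · exact fun p hp hc => h (isTwoAffine_of_closedAt C p hp hc)

/-- The dual relation. -/
def dual {k : ℕ} (R : (Fin k → Bool) → Bool) : (Fin k → Bool) → Bool := fun a => R fun i => !a i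

/-- Majority and minority are self-dual, so complementing all tuples preserves closure. -/
theorem Unclosed.dual {k : ℕ} {R : (Fin k → Bool) → Bool} (h : Unclosed R) :
    Unclosed (dual R) := by
  obtain ⟨⟨a, ha⟩, h⟩ := h
  refine ⟨⟨fun i => !a i, by simpa [BoolIso.dual] using ha⟩,
    fun p hp hc => h _ hp fun a b ha hb => ?_⟩
  have := hc (fun i => !a i) (fun i => !b i) (by simpa [BoolIso.dual] using ha)
    (by simpa [BoolIso.dual] using hb)
  simp only [BoolIso.dual] at this
  constructor
  · convert this.1 using 3 with i
    cases a i <;> cases b i <;> cases p i <;> rfl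
  · convert this.2 using 3 with i
    cases a i <;> cases b i <;> cases p i <;> rfl

end BoolIso
namespace BoolIso

/-! ### Relations expressible relative to a distinguished variable -/

/-- How the Boolean unknowns are represented by variables: every unknown comes with one variable
for each `d : D`, which carries the unknown if `s d` and its negation otherwise. There are two
further variables; one is the reference variable (true), the other one is false if `τ` holds and
true otherwise. -/
structure Mode where
  /-- the index set of the variables that belong to one unknown -/
  D : Type
  [fin : Fintype D]
  /-- the sign of a variable -/
  s : D → Bool
  /-- is there a variable for the constant false? -/
  τ : Bool
  /-- a variable, so that there is at least one -/
  pos : D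
  τ_of_neg : ∀ d, s d = false → τ = true

attribute [instance] Mode.fin

/-- The variables for unknowns indexed by `ι`. -/
abbrev Mode.Var (μ : Mode) (ι : Type) : Type := Bool ⊕ (ι × μ.D)

/-- The assignment to the variables given by values of the unknowns. -/
def Mode.val (μ : Mode) {ι : Type} (b : ι → Bool) : μ.Var ι → Bool
  | .inl true => true
  | .inl false => !μ.τ
  | .inr (i, d) => b i == μ.s d

section
variable {k : ℕ} (R : (Fin k → Bool) → Bool)

/-- `a` satisfies the applications of `R` to the argument lists in `Φ`. -/
def Sat {Y : Type} (a : Y → Bool) (Φ : List (Fin k → Y)) : Prop :=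
  ∀ A ∈ Φ, R (fun q => a (A q)) = true

variable {R} in
theorem sat_append {Y : Type} (a : Y → Bool) (Φ Ψ : List (Fin k → Y)) :
    Sat R a (Φ ++ Ψ) ↔ Sat R a Φ ∧ Sat R a Ψ := by
  simp [Sat, or_imp, forall_and]

variable {R} in
theorem sat_map {Y Z : Type} (a : Z → Bool) (g : Y → Z) (Φ : List (Fin k → Y)) :
    Sat R a (Φ.map fun A q => g (A q)) ↔ Sat R (a ∘ g) Φ := by
  simp [Sat]

/-- Satisfying assignments with reference variable false become satisfying assignments when
complemented. -/
def Good {μ : Mode} {ι : Type} (Φ : List (Fin k → μ.Var ι)) : Prop :=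
  ∀ a : μ.Var ι → Bool, a (.inl true) = false → Sat R a Φ → Sat R (fun y => !a y) Φ

variable {R} in
theorem Good.append {μ : Mode} {ι : Type} {Φ Ψ : List (Fin k → μ.Var ι)} (hΦ : Good R Φ)
    (hΨ : Good R Ψ) : Good R (Φ ++ Ψ) := fun a ha h => by
  rw [sat_append] at h ⊢
  exact ⟨hΦ a ha h.1, hΨ a ha h.2⟩

/-- `Q` is expressible by applications of `R`. -/
def Expr (μ : Mode) {ι : Type} (Q : (ι → Bool) → Prop) : Prop :=
  ∃ Φ : List (Fin k → μ.Var ι), (∀ b, Sat R (μ.val b) Φ ↔ Q b) ∧ Good R Φ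

/-- Substitution of unknowns, or of the constant true, for unknowns. -/
def Mode.substVar (μ : Mode) {ι κ : Type} (g : ι → Option κ) : μ.Var ι → μ.Var κ
  | .inl c => .inl c
  | .inr (i, d) => match g i with
    | none => .inl (μ.s d)
    | some j => .inr (j, d)

/-- When true replaces an unknown, its negated copies become `inl false`; `τ_of_neg` guarantees that
this variable then does carry the value false. -/
theorem Mode.val_substVar (μ : Mode) {ι κ : Type} (g : ι → Option κ) (b : κ → Bool) :
    μ.val b ∘ μ.substVar g = μ.val (fun i => (g i).elim true b) := by
  funext y
  rcases y with c | ⟨i, d⟩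
  · cases c <;> rfl
  · simp only [Function.comp, Mode.substVar]
    cases hg : g i with
    | none =>
      cases hd : μ.s d
      · simp [Mode.val, hd, hg, μ.τ_of_neg d hd]
      · simp [Mode.val, hd, hg]
    | some j => simp [Mode.val, hg]

variable {R} in
theorem Good.subst {μ ν : Mode} {ι κ : Type} {Φ : List (Fin k → μ.Var ι)} (h : Good R Φ)
    (g : μ.Var ι → ν.Var κ) (hg : g (.inl true) = .inl true) :
    Good R (Φ.map fun A q => g (A q)) := by
  intro a ha hs
  rw [sat_map] at hs ⊢
  exact h (a ∘ g) (by simpa [hg] using ha) hs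

variable {R} {μ : Mode} {ι κ : Type} {Q Q' : (ι → Bool) → Prop}

theorem Expr.subst (h : Expr R μ Q) (g : ι → Option κ) :
    Expr R μ fun b => Q fun i => (g i).elim true b := by
  obtain ⟨Φ, h1, h2⟩ := h
  refine ⟨Φ.map fun A q => μ.substVar g (A q), fun b => ?_, h2.subst (μ.substVar g) rfl⟩
  rw [sat_map, μ.val_substVar, h1]

theorem Expr.and (h : Expr R μ Q) (h' : Expr R μ Q') : Expr R μ fun b => Q b ∧ Q' b := by
  obtain ⟨Φ, h1, h2⟩ := h
  obtain ⟨Φ', h1', h2'⟩ := h'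
  exact ⟨Φ ++ Φ', fun b => by rw [sat_append, h1, h1'], h2.append h2'⟩

theorem Expr.congr (h : Expr R μ Q) (e : ∀ b, Q b ↔ Q' b) : Expr R μ Q' := by
  obtain ⟨Φ, h1, h2⟩ := h
  exact ⟨Φ, fun b => (h1 b).trans (e b), h2⟩

variable (R μ) in
/-- Expressibility of a binary relation. -/
def Expr₂ (Q : Bool → Bool → Prop) : Prop := Expr R μ fun b : Fin 2 → Bool => Q (b 0) (b 1)

variable (R μ) in
/-- Expressibility of a ternary relation. -/
def Expr₃ (Q : Bool → Bool → Bool → Prop) : Prop :=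
  Expr R μ fun b : Fin 3 → Bool => Q (b 0) (b 1) (b 2)

theorem Expr₂.to₂ {Q : Bool → Bool → Prop} (h : Expr₂ R μ Q) (i j : Option (Fin 2)) :
    Expr₂ R μ fun x y => Q (i.elim true ![x, y]) (j.elim true ![x, y]) :=
  (h.subst ![i, j]).congr fun b => by
    rw [show b = ![b 0, b 1] by funext i; fin_cases i <;> rfl]; simp

theorem Expr₂.to₃ {Q : Bool → Bool → Prop} (h : Expr₂ R μ Q) (i j : Option (Fin 3)) :
    Expr₃ R μ fun x y z => Q (i.elim true ![x, y, z]) (j.elim true ![x, y, z]) :=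
  (h.subst ![i, j]).congr fun b => by
    rw [show b = ![b 0, b 1, b 2] by funext i; fin_cases i <;> rfl]; simp

theorem Expr₃.to₂ {Q : Bool → Bool → Bool → Prop} (h : Expr₃ R μ Q) (i j l : Option (Fin 2)) :
    Expr₂ R μ fun x y =>
      Q (i.elim true ![x, y]) (j.elim true ![x, y]) (l.elim true ![x, y]) :=
  (h.subst ![i, j, l]).congr fun b => by
    rw [show b = ![b 0, b 1] by funext i; fin_cases i <;> rfl]; simp

theorem Expr₂.congr {Q Q' : Bool → Bool → Prop} (h : Expr₂ R μ Q) (e : ∀ x y, Q x y ↔ Q' x y) :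
    Expr₂ R μ Q' := Expr.congr h fun _ => e _ _

theorem Expr₃.congr {Q Q' : Bool → Bool → Bool → Prop} (h : Expr₃ R μ Q)
    (e : ∀ x y z, Q x y z ↔ Q' x y z) : Expr₃ R μ Q' := Expr.congr h fun _ => e _ _ _

theorem Expr₂.and {Q Q' : Bool → Bool → Prop} (h : Expr₂ R μ Q) (h' : Expr₂ R μ Q') :
    Expr₂ R μ fun x y => Q x y ∧ Q' x y := Expr.and h h'

theorem Expr₃.and {Q Q' : Bool → Bool → Bool → Prop} (h : Expr₃ R μ Q) (h' : Expr₃ R μ Q') :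
    Expr₃ R μ fun x y z => Q x y z ∧ Q' x y z := Expr.and h h'

/-! ### Edge gadgets from a ternary relation -/

/-- The four kinds of relations by which edges are encoded. -/
inductive Kind : Type
  | or | imp | xor | and
  deriving DecidableEq

/-- The relation between the unknown of an edge and those of its end points. -/
def Kind.Law : Kind → Bool → Bool → Bool → Prop
  | .or, e, u, v => e = true ∧ (u || v) = true
  | .imp, e, u, v => (u = true → e = true) ∧ (v = true → e = true)
  | .xor, e, u, v => e = !(Bool.xor u v)
  | .and, e, u, v => e = (u && v) ∧ (u || v) = true

instance (κ : Kind) (e u v : Bool) : Decidable (κ.Law e u v) := by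
  cases κ <;> unfold Kind.Law <;> infer_instance

variable (R μ) in
/-- The relations needed for encoding graphs are expressible, apart from consistency. -/
structure Encodes (κ : Kind) : Prop where
  law : Expr₃ R μ κ.Law
  top : Expr₂ R μ fun x _ => x = true
  eq : κ ≠ .or → Expr₂ R μ fun x y => x = y

variable (R μ) in
/-- It is expressible that the variables get values that come from values of the unknowns. -/
def Consistent : Prop :=
  ∃ Φ : List (Fin k → μ.Var Unit), Good R Φ ∧
    ∀ a : μ.Var Unit → Bool, a (.inl true) = true → (Sat R a Φ ↔ ∃ b, a = μ.val b)

theorem encodes_or (h : Expr₂ R μ fun x y => (x || y) = true) : Encodes R μ .or where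
  law := ((h.to₃ (some 0) (some 0)).and (h.to₃ (some 1) (some 2))).congr (by decide)
  top := (h.to₂ (some 0) (some 0)).congr (by decide)
  eq := fun h => absurd rfl h

theorem encodes_imp (h : Expr₂ R μ fun x y => x = true → y = true) : Encodes R μ .imp where
  law := ((h.to₃ (some 1) (some 0)).and (h.to₃ (some 2) (some 0))).congr (by decide)
  top := (h.to₂ none (some 0)).congr (by decide)
  eq := fun _ => ((h.to₂ (some 0) (some 1)).and (h.to₂ (some 1) (some 0))).congr
    (by decide)

theorem encodes_xor (h : Expr₃ R μ (Kind.Law .xor)) : Encodes R μ .xor where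
  law := h
  top := (h.to₂ (some 0) none none).congr (by decide)
  eq := fun _ => (h.to₂ (some 0) (some 1) none).congr (by decide)

theorem encodes_and (h : Expr₃ R μ (Kind.Law .and)) : Encodes R μ .and where
  law := h
  top := (h.to₂ (some 0) none none).congr (by decide)
  eq := fun _ => (h.to₂ (some 0) (some 1) none).congr (by decide)

/-- With both constant pairs and exactly one of the mixed pairs, the relation is an implication in
one of the two directions. -/
theorem encodes_imp_of {Q : Bool → Bool → Prop} (h : Expr₂ R μ Q) (h11 : Q true true)
    (h00 : Q false false) (hne : ¬ (Q false true ↔ Q true false)) : Encodes R μ .imp := by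
  apply encodes_imp
  by_cases h01 : Q false true
  · refine h.congr fun x y => ?_
    have : ¬ Q true false := fun h => hne ⟨fun _ => h, fun _ => h01⟩
    cases x <;> cases y <;> simp [*]
  · refine (h.to₂ (some 1) (some 0)).congr fun x y => ?_
    have : Q true false := by
      by_contra h; exact hne ⟨fun h' => absurd h' h01, fun h' => absurd h' h⟩
    cases x <;> cases y <;> simp [*]

/-- If neither `imp` nor `or` is available, every binary minor containing 00 and 11 is symmetric,
and every one containing 01, 10, 11 contains 00. If 011 were in `Q`, then so would be 110, hence
000, hence 100, against `hn`. So 011 is missing, and with it 101, 110 and 000. Only 100 remains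
undecided, and its two possibilities are the gadgets `xor` and `and`. -/
theorem exists_encodes {Q : Bool → Bool → Bool → Prop} (h : Expr₃ R μ Q)
    (h111 : Q true true true) (h001 : Q false false true) (h010 : Q false true false)
    (hn : ¬ Q false true true ∨ ¬ Q true false false) : ∃ κ, Encodes R μ κ := by
  by_contra hcon
  have nimp : ∀ Q', Expr₂ R μ Q' → Q' true true → Q' false false →
      (Q' false true ↔ Q' true false) := fun Q' h' h11 h00 => by
    by_contra hne
    exact hcon ⟨_, encodes_imp_of h' h11 h00 hne⟩
  have nor : ∀ Q', Expr₂ R μ Q' → Q' true true → Q' false true → Q' true false →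
      Q' false false := fun Q' h' h11 h01 h10 => by
    by_contra h00
    refine hcon ⟨_, encodes_or (h'.congr fun x y => ?_)⟩
    cases x <;> cases y <;> simp [*]
  have a1 := nimp _ (h.to₂ (some 0) (some 1) none) h111 h001
  have a2 := nimp _ (h.to₂ (some 0) none (some 1)) h111 h010
  have a3 := nimp _ (h.to₂ (some 0) (some 0) (some 1)) h111
  have a4 := nor _ (h.to₂ (some 0) (some 0) (some 1)) h111 h001
  have a5 := nimp _ (h.to₂ (some 0) (some 1) (some 1)) h111
  simp only [Option.elim, Matrix.cons_val_zero, Matrix.cons_val_one] at a1 a2 a3 a4 a5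
  by_cases h011 : Q false true true
  · have h100 : ¬ Q true false false := hn.resolve_left (not_not.2 h011)
    have h110 : Q true true false := a2.1 h011
    exact h100 ((a5 (a4 h110)).1 h011)
  · have h101 : ¬ Q true false true := fun h => h011 (a1.2 h)
    have h110 : ¬ Q true true false := fun h => h011 (a2.2 h)
    have h000 : ¬ Q false false false := fun h => h110 ((a3 h).1 h001)
    by_cases h100 : Q true false false
    · refine hcon ⟨_, encodes_xor (h.congr fun x y z => ?_)⟩
      cases x <;> cases y <;> cases z <;> simp [*, Kind.Law]
    · refine hcon ⟨_, encodes_and (h.congr fun x y z => ?_)⟩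
      cases x <;> cases y <;> cases z <;> simp [*, Kind.Law]

/-- Every list of applications can be extended so as to become good. -/
def Completable (R : (Fin k → Bool) → Bool) (μ : Mode) : Prop :=
  ∃ F : List (Fin k → Bool), Sat R (fun c => c || !μ.τ) F ∧
    ∀ (ι : Type) (Φ : List (Fin k → μ.Var ι)), Good R (Φ ++ F.map fun A q => .inl (A q))

/-- The completing applications hold under all intended assignments, so they leave the expressed
relation unchanged. -/
theorem Completable.expr (h : Completable R μ) (Φ : List (Fin k → μ.Var ι)) :
    Expr R μ fun b => Sat R (μ.val b) Φ := by
  obtain ⟨F, h1, h2⟩ := h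
  refine ⟨_, fun b => ?_, h2 ι Φ⟩
  rw [sat_append, sat_map]
  have : μ.val b ∘ Sum.inl = fun c => c || !μ.τ := by
    funext c; cases c <;> simp [Mode.val]
  rw [this]
  exact and_iff_left h1

/-- The unknowns tell where an assignment agrees with the given member of the relation. -/
theorem Completable.exists_encodes (h : Completable R μ) (hR : Unclosed R) (p : Fin k → Bool)
    (hp : R p = true) (hs : ∀ q, ∃ d, μ.s d = p q) : ∃ κ, Encodes R μ κ := by
  choose d hd using hs
  have hE : Expr R μ fun b : Fin k → Bool => R (fun q => b q == p q) = true :=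
    (h.expr [fun q => .inr (q, d q)]).congr fun b => by simp [Sat, Mode.val, hd]
  have := hR.2 p hp
  simp only [ClosedAt] at this
  push Not at this
  obtain ⟨a, b, ha, hb, hab⟩ := this
  -- The three unknowns stand for the coordinates where both `a` and `b`, only `a`, only `b` differ
  -- from `p`. Thus 111, 001, 010 are `p`, `a`, `b`, while 011 and 100 are their majority and
  -- minority.
  let g : Fin k → Option (Fin 3) := fun q =>
    if a q = p q then (if b q = p q then none else some 2)
      else (if b q = p q then some 1 else some 0)
  refine BoolIso.exists_encodes (Q := fun x y z =>
    R (fun q => (g q).elim true ![x, y, z] == p q) = true) ((hE.subst g).congr fun b => ?_)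
    ?_ ?_ ?_ ?_
  · rw [show b = ![b 0, b 1, b 2] by funext i; fin_cases i <;> rfl]; simp
  · convert hp with q
    simp only [g]
    cases a q <;> cases b q <;> cases p q <;> rfl
  · convert ha with q
    simp only [g]
    cases a q <;> cases b q <;> cases p q <;> rfl
  · convert hb with q
    simp only [g]
    cases a q <;> cases b q <;> cases p q <;> rfl
  · by_contra hcon
    push Not at hcon
    refine hab ?_ ?_
    · convert hcon.1 with q
      simp only [g]
      cases a q <;> cases b q <;> cases p q <;> rfl
    · convert hcon.2 with q
      simp only [g]
      cases a q <;> cases b q <;> cases p q <;> rfl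

end

end BoolIso
namespace BoolIso

/-! ### Relations that are not 2-affine encode graphs -/

/-- One variable for each unknown. -/
abbrev Mode.single (τ : Bool) : Mode where
  D := Unit
  s := fun _ => true
  τ := τ
  pos := ()
  τ_of_neg := by simp

/-- Two variables for each unknown, one for the unknown and one for its negation. -/
abbrev Mode.double : Mode where
  D := Bool
  s := id
  τ := true
  pos := true
  τ_of_neg := by simp

section
variable {k : ℕ} {R : (Fin k → Bool) → Bool}

/-- Consistent representation of unknowns together with an encoding of the edges. -/
def EncodesGraphs (R : (Fin k → Bool) → Bool) : Prop :=
  ∃ μ κ, Consistent R μ ∧ Encodes R μ κ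

/-- With one positive variable per unknown, the unknowns may take any values, so only the value of
`inl false` has to be enforced. -/
theorem consistent_single (τ : Bool) (Φ : List (Fin k → Bool))
    (hgood : ∀ c : Bool → Bool, c true = false → Sat R c Φ → Sat R (fun y => !c y) Φ)
    (h : ∀ c : Bool → Bool, c true = true → (Sat R c Φ ↔ c false = !τ)) :
    Consistent R (.single τ) := by
  refine ⟨Φ.map fun A q => .inl (A q), fun a ha hs => ?_, fun a ha => ?_⟩
  · rw [sat_map] at hs ⊢
    exact hgood (a ∘ Sum.inl) ha hs
  · rw [sat_map, h _ ha]
    constructor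
    · intro hf
      refine ⟨fun i => a (.inr (i, ())), ?_⟩
      funext y
      rcases y with (_ | _) | ⟨i, d⟩
      · exact hf
      · exact ha
      · cases d; simp [Mode.val, Mode.single]
    · rintro ⟨b, rfl⟩
      simp [Mode.val, Mode.single]

theorem completable_of_complementive (hc : ∀ a, R a = true → R (fun q => !a q) = true)
    (μ : Mode) : Completable R μ := by
  refine ⟨[], by simp [Sat], fun ι Φ a _ hs A hA => ?_⟩
  have := hc _ (hs A hA)
  simpa using this

/-- `R` applied to the reference variable in every position forces it to be true; adding this
application makes any list good vacuously. The member all of whose entries are true serves as `p`,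
so no negated variables are needed. -/
theorem encodesGraphs_of_oneValid (hR : Unclosed R) (h1 : R (fun _ => true) = true)
    (h0 : R (fun _ => false) = false) : EncodesGraphs R := by
  have hc : Completable R (.single false) := by
    refine ⟨[fun _ => true], by simp [Sat, h1], fun ι Φ a ha hs => ?_⟩
    have := hs _ (List.mem_append_right _ (List.mem_map.2 ⟨_, List.mem_singleton_self _, rfl⟩))
    simp [ha, h0] at this
  obtain ⟨κ, hκ⟩ := hc.exists_encodes hR _ h1 fun q => ⟨(), rfl⟩
  refine ⟨_, κ, consistent_single false [fun _ => true, fun _ => false] ?_ ?_, hκ⟩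
  · intro c hc; simp [Sat, hc, h0]
  · intro c hc
    cases h : c false <;> simp [Sat, hc, h, h0, h1]

/-- Goodness is automatic. A non-member `r` exists, since the full relation is closed at every
member; applied to the two reference variables along `r`, the relation forces them to be equal. -/
theorem encodesGraphs_of_valid_complementive (hR : Unclosed R) (h1 : R (fun _ => true) = true)
    (hc : ∀ a, R a = true → R (fun q => !a q) = true) : EncodesGraphs R := by
  obtain ⟨κ, hκ⟩ := (completable_of_complementive hc (.single false)).exists_encodes hR _ h1
    fun q => ⟨(), rfl⟩
  obtain ⟨r, hr⟩ : ∃ r, R r = false := by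
    by_contra hcon
    push Not at hcon
    simp only [ne_eq, Bool.not_eq_false] at hcon
    exact hR.2 _ h1 fun a b _ _ => ⟨hcon _, hcon _⟩
  refine ⟨_, κ, consistent_single false [r] ?_ ?_, hκ⟩
  · intro c _ hs A hA
    exact hc _ (hs A hA)
  · intro c hct
    cases h : c false
    · have : (fun q => c (r q)) = r := by funext q; cases hq : r q <;> simp [h, hct]
      simp [Sat, this, hr]
    · have : (fun q => c (r q)) = fun _ => true := by funext q; cases hq : r q <;> simp [h, hct]
      simp [Sat, this, h1]

/-- The values at a member of a pattern with two variables. -/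
theorem apply_ite_eq (r : Fin k → Bool) (x y : Bool) :
    (fun q => if r q = true then y else x) =
      if x = y then (fun _ => x) else if y = true then r else fun q => !r q := by
  funext q
  cases x <;> cases y <;> cases h : r q <;> simp [h]

/-- Placing `y` where `r` is true and `x` elsewhere accepts 00, 11 and `r` itself, but not the
complement of `r`: this is the implication from `x` to `y`. -/
theorem encodesGraphs_of_valid_not_complementive (h1 : R (fun _ => true) = true)
    (h0 : R (fun _ => false) = true) (r : Fin k → Bool) (hr : R r = true)
    (hr' : R (fun q => !r q) = false) : EncodesGraphs R := by
  have key : ∀ x y : Bool, R (fun q => if r q = true then y else x) = true ↔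
      (x = true → y = true) := by
    intro x y
    rw [apply_ite_eq]
    cases x <;> cases y <;> simp [*]
  have key' : ∀ {Y : Type} (a : Y → Bool) (u v : Y),
      R (fun q => a (if r q = true then v else u)) = true ↔ (a u = true → a v = true) := by
    intro Y a u v
    rw [← key]; simp only [apply_ite a]
  refine ⟨.single false, .imp, consistent_single false
    [fun q => if r q = true then true else false, fun q => if r q = true then false else true]
    ?_ ?_,
    encodes_imp ⟨[fun q => if r q = true then .inr (1, ()) else .inr (0, ()),
      -- These two implications into the reference variable are there for goodness: if it is false,
      -- both unknowns are false, and after complementing everything is true.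
      fun q => if r q = true then .inl true else .inr (0, ()),
      fun q => if r q = true then .inl true else .inr (1, ())], fun b => ?_, fun a ha => ?_⟩⟩
  · intro c hc
    simp only [Sat, List.forall_mem_cons, key', key' (fun y => !c y)]
    cases c false <;> simp [hc]
  · intro c hc
    simp only [Sat, List.forall_mem_cons, key']
    simp [hc]
  · simp only [Sat, List.forall_mem_cons, key']
    simp only [Mode.val]
    simp
  · simp only [Sat, List.forall_mem_cons, key', key' (fun y => !a y)]
    simp +contextual [ha]

theorem eq_double_val {ι : Type} (a : Mode.double.Var ι → Bool) (ht : a (.inl true) = true) :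
    (∃ b, a = Mode.double.val b) ↔
      a (.inl false) = false ∧ ∀ i, a (.inr (i, true)) ≠ a (.inr (i, false)) := by
  constructor
  · rintro ⟨b, rfl⟩
    refine ⟨by simp [Mode.val], fun i => ?_⟩
    simp [Mode.val]
  · rintro ⟨hf, h⟩
    refine ⟨fun i => a (.inr (i, true)), ?_⟩
    funext y
    rcases y with (_ | _) | ⟨i, d⟩
    · simpa [Mode.val, Mode.double] using hf
    · simpa [Mode.val] using ht
    · have := h i
      revert this
      cases d
      · simp only [Mode.val, Mode.double]
        cases a (.inr (i, true)) <;> cases a (.inr (i, false)) <;> simp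
      · simp [Mode.val, Mode.double]

/-- Two variables placed along `r` are forced to be different, which ties each negated copy to its
unknown. With both signs at hand, `r` can play the role of `p`. -/
theorem encodesGraphs_of_not_valid_complementive (hR : Unclosed R)
    (h1 : R (fun _ => true) = false) (h0 : R (fun _ => false) = false)
    (hc : ∀ a, R a = true → R (fun q => !a q) = true) : EncodesGraphs R := by
  obtain ⟨r, hr⟩ := hR.1
  obtain ⟨κ, hκ⟩ := (completable_of_complementive hc .double).exists_encodes hR r hr
    fun q => ⟨r q, rfl⟩
  have key : ∀ x y : Bool, R (fun q => if r q = true then y else x) = true ↔ x ≠ y := by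
    intro x y
    rw [apply_ite_eq]
    cases x <;> cases y <;> simp [*]
  have key' : ∀ {Y : Type} (a : Y → Bool) (u v : Y),
      R (fun q => a (if r q = true then v else u)) = true ↔ a u ≠ a v := by
    intro Y a u v
    rw [← key]; simp only [apply_ite a]
  refine ⟨_, κ, ⟨[fun q => if r q = true then .inl true else .inl false,
    fun q => if r q = true then .inr ((), false) else .inr ((), true)], fun a _ hs A hA =>
      hc _ (hs A hA), fun a ha => ?_⟩, hκ⟩
  rw [eq_double_val a ha]
  simp only [Sat, List.forall_mem_cons, key']
  simp only [ha, List.not_mem_nil, false_imp_iff, implies_true, and_true, ne_eq, Bool.not_eq_true]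
  exact ⟨fun h => ⟨h.1, fun _ => h.2⟩, fun h => ⟨h.1, h.2 ()⟩⟩

/-! ### Relations without constant tuples that are not closed under complement -/

section
variable (h1 : R (fun _ => true) = false) (h0 : R (fun _ => false) = false) (r : Fin k → Bool)
  (hr : R r = true) (hr' : R (fun q => !r q) = false)
include h1 h0 hr hr'

/-- Two variables placed along `r` produce `r`, its complement or a constant tuple, and only `r` is
a member. So a single application fixes both constants. -/
theorem sat_constants (c : Bool → Bool) : Sat R c [r] ↔ c true = true ∧ c false = false := by
  have : (fun q => c (r q)) = fun q => if r q = true then c true else c false := by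
    funext q; cases h : r q <;> simp
  simp only [Sat, List.forall_mem_singleton, this, apply_ite_eq]
  cases c true <;> cases c false <;> simp [*]

theorem completable_of_constants (μ : Mode) (hμ : μ.τ = true) : Completable R μ := by
  have hs := sat_constants h1 h0 r hr hr'
  refine ⟨[r], by simp [hs, hμ], fun ι Φ a ha h => ?_⟩
  rw [sat_append, sat_map, hs] at h
  simp [ha] at h

theorem consistent_single_of_constants : Consistent R (.single true) := by
  have hs := sat_constants h1 h0 r hr hr'
  refine consistent_single true [r] (fun c hc => ?_) fun c hc => ?_
  · simp [hs, hc]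
  · simp [hs, hc]

/-- Once inequality is expressible, negated copies can be enforced, and the member `r` serves as `p`
in the mode with two variables per unknown. -/
theorem encodesGraphs_of_ne (hR : Unclosed R) (hne : Expr₂ R (.single true) fun x y => x ≠ y) :
    EncodesGraphs R := by
  obtain ⟨κ, hκ⟩ := (completable_of_constants h1 h0 r hr hr' .double rfl).exists_encodes hR r hr
    fun q => ⟨r q, rfl⟩
  obtain ⟨Φ, hΦ, hg⟩ := hne
  let g : (Mode.single true).Var (Fin 2) → Mode.double.Var Unit
    | .inl c => .inl c
    | .inr (i, _) => .inr ((), ![true, false] i)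
  refine ⟨_, κ, ⟨(Φ.map fun A q => g (A q)) ++ [r].map fun A q => .inl (A q),
    Good.append (hg.subst g rfl) (fun a ha hs => ?_), fun a ha => ?_⟩, hκ⟩
  · rw [sat_map, sat_constants h1 h0 r hr hr'] at hs
    simp [ha] at hs
  · rw [eq_double_val a ha, sat_append, sat_map, sat_map, sat_constants h1 h0 r hr hr', and_comm]
    simp only [Function.comp, ha, true_and]
    refine and_congr_right fun hf => ?_
    have : (fun y => a (g y)) =
        (Mode.single true).val ![a (.inr ((), true)), a (.inr ((), false))] := by
      funext y
      rcases y with (_ | _) | ⟨i, d⟩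
      · simpa [Mode.val, Mode.single, g] using hf
      · simpa [Mode.val, g] using ha
      · fin_cases i <;> simp [Mode.val, Mode.single, g]
    have h2 := hΦ ![a (.inr ((), true)), a (.inr ((), false))]
    rw [← this] at h2
    exact h2.trans ⟨fun h _ => h, fun h => h ()⟩

/-- Constants go where `a` and `b` agree, `x` where only `a` is true, `y` where only `b` is. Then 10
and 01 are `a` and `b`, and 00 is the missing meet. According to whether 11 is accepted, this is a
disjunction, which is a gadget already, or inequality. -/
theorem encodesGraphs_of_not_and (hR : Unclosed R) (a b : Fin k → Bool) (ha : R a = true)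
    (hb : R b = true) (hab : R (a ⊓ b) = false) : EncodesGraphs R := by
  let A : Fin k → (Mode.single true).Var (Fin 2) := fun q =>
    if a q = b q then .inl (a q) else if a q = true then .inr (0, ()) else .inr (1, ())
  have hE := (completable_of_constants h1 h0 r hr hr' (.single true) rfl).expr [A]
  have hE₂ : Expr₂ R (.single true) fun x y =>
      R (fun q => if a q = b q then a q else if a q = true then x else y) = true :=
    hE.congr fun c => by
      simp only [Sat, List.forall_mem_singleton, A, apply_ite ((Mode.single true).val c)]
      have : ∀ q, (Mode.single true).val c (.inl (a q)) = a q := by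
        intro q; cases a q <;> simp [Mode.val]
      simp only [this]
      simp [Mode.val]
  have e10 : R (fun q => if a q = b q then a q else if a q = true then true else false) = true := by
    convert ha using 3 with q; cases a q <;> simp
  have e01 : R (fun q => if a q = b q then a q else if a q = true then false else true) = true := by
    convert hb using 3 with q; cases a q <;> cases b q <;> simp
  have e00 : R (fun q => if a q = b q then a q else
      if a q = true then false else false) = false := by
    convert hab using 3 with q; simp only [Pi.inf_apply]; cases a q <;> cases b q <;> simp
  by_cases e11 : R (fun q => if a q = b q then a q else if a q = true then true else true) = true
  · refine ⟨_, _, consistent_single_of_constants h1 h0 r hr hr',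
      encodes_or (hE₂.congr fun x y => ?_)⟩
    cases x <;> cases y <;> simp only [*] <;> simp
  · refine encodesGraphs_of_ne h1 h0 r hr hr' hR (hE₂.congr fun x y => ?_)
    cases x <;> cases y <;> simp only [*] <;> simp

/-- The relation is a lattice with bottom `m` and top `M`. If it were closed under complements
relative to these, it would be closed at `m`: majority with `m` is the meet, and minority with `m`
is the symmetric difference built from relative complements. So some relative complement is missing,
and this produces an implication. -/
theorem encodesGraphs_of_lattice (hR : Unclosed R)
    (hinf : ∀ a b, R a = true → R b = true → R (a ⊓ b) = true)
    (hsup : ∀ a b, R a = true → R b = true → R (a ⊔ b) = true) : EncodesGraphs R := by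
  classical
  have hne : (Finset.univ.filter fun a => R a = true).Nonempty := ⟨r, by simpa using hr⟩
  obtain ⟨m, hm, hmle⟩ : ∃ m, R m = true ∧ ∀ a, R a = true → m ≤ a :=
    ⟨_, Finset.inf'_mem {a | R a = true} (fun a ha b hb => hinf a b ha hb) _ hne id (by simp),
      fun a ha => Finset.inf'_le id (by simpa using ha)⟩
  obtain ⟨M, hM, hMle⟩ : ∃ M, R M = true ∧ ∀ a, R a = true → a ≤ M :=
    ⟨_, Finset.sup'_mem {a | R a = true} (fun a ha b hb => hsup a b ha hb) _ hne id (by simp),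
      fun a ha => Finset.le_sup' id (by simpa using ha)⟩
  have hbd : ∀ a, R a = true → ∀ q, (m q = true → a q = true) ∧ (a q = true → M q = true) :=
    fun a ha q => ⟨Bool.le_iff_imp.1 (hmle a ha q), Bool.le_iff_imp.1 (hMle a ha q)⟩
  by_cases hcl : ∀ a, R a = true → R (fun q => m q || (M q && !a q)) = true
  · refine absurd ?_ (hR.2 m hm)
    intro a b ha hb
    constructor
    · convert hinf a b ha hb using 3 with q
      have h2 := (hbd a ha q).1
      have h3 := (hbd b hb q).1
      simp only [Pi.inf_apply]
      revert h2 h3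
      cases m q <;> cases a q <;> cases b q <;> simp
    · convert hsup _ _ (hinf a _ ha (hcl b hb)) (hinf b _ hb (hcl a ha)) using 3 with q
      have h2 := hbd a ha q
      have h3 := hbd b hb q
      simp only [Pi.inf_apply, Pi.sup_apply]
      revert h2 h3
      cases m q <;> cases a q <;> cases b q <;> cases M q <;> simp
  · push Not at hcl
    obtain ⟨a, ha, hna⟩ := hcl
    -- On the pair `x`, `y`, the values 11, 00, 01 give `M`, `m`, `a`, and 10 gives the missing
    -- relative complement of `a`.
    let A : Fin k → (Mode.single true).Var (Fin 2) := fun q =>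
      if m q = true then .inl true else if M q = false then .inl false else
        if a q = true then .inr (1, ()) else .inr (0, ())
    have hE := (completable_of_constants h1 h0 r hr hr' (.single true) rfl).expr [A]
    have hE₂ : Expr₂ R (.single true) fun x y =>
        R (fun q => if m q = true then true else if M q = false then false else
          if a q = true then y else x) = true :=
      hE.congr fun c => by
        simp only [Sat, List.forall_mem_singleton, A, apply_ite ((Mode.single true).val c)]
        simp [Mode.val]
    refine ⟨_, _, consistent_single_of_constants h1 h0 r hr hr', encodes_imp_of hE₂ ?_ ?_ ?_⟩
    · convert hM using 3 with q
      have h2 := hbd M hM q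
      revert h2
      cases m q <;> cases M q <;> simp
    · convert hm using 3 with q
      cases m q <;> simp
    · intro hiff
      refine hna ?_
      have h01 : R (fun q => if m q = true then true else if M q = false then false else
          if a q = true then true else false) = true := by
        convert ha using 3 with q
        have h2 := hbd a ha q
        revert h2
        cases m q <;> cases M q <;> cases a q <;> simp
      convert hiff.1 h01 using 3 with q
      cases m q <;> cases M q <;> cases a q <;> simp

end

/-- The dual is used twice: when only the all-false constant tuple is a member, and when closure
under joins fails, which becomes failure under meets. -/
theorem encodesGraphs_or_dual (hR : Unclosed R) : EncodesGraphs R ∨ EncodesGraphs (dual R) := by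
  by_cases h1 : R (fun _ => true) = true
  · left
    by_cases h0 : R (fun _ => false) = true
    · by_cases hc : ∀ a, R a = true → R (fun q => !a q) = true
      · exact encodesGraphs_of_valid_complementive hR h1 hc
      · push Not at hc
        obtain ⟨r, hr, hr'⟩ := hc
        exact encodesGraphs_of_valid_not_complementive h1 h0 r hr (by simpa using hr')
    · exact encodesGraphs_of_oneValid hR h1 (by simpa using h0)
  · by_cases h0 : R (fun _ => false) = true
    · exact .inr (encodesGraphs_of_oneValid hR.dual (by simpa [dual] using h0)
        (by simpa [dual] using h1))
    · simp only [Bool.not_eq_true] at h1 h0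
      by_cases hc : ∀ a, R a = true → R (fun q => !a q) = true
      · exact .inl (encodesGraphs_of_not_valid_complementive hR h1 h0 hc)
      · push Not at hc
        obtain ⟨r, hr, hr'⟩ := hc
        simp only [Bool.not_eq_true] at hr'
        by_cases hinf : ∀ a b, R a = true → R b = true → R (a ⊓ b) = true
        · by_cases hsup : ∀ a b, R a = true → R b = true → R (a ⊔ b) = true
          · exact .inl (encodesGraphs_of_lattice h1 h0 r hr hr' hR hinf hsup)
          · push Not at hsup
            obtain ⟨a, b, ha, hb, hab⟩ := hsup
            refine .inr (encodesGraphs_of_not_and (by simpa [dual] using h0)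
              (by simpa [dual] using h1) (fun q => !r q) (by simpa [dual] using hr)
              (by simpa [dual] using hr') hR.dual (fun q => !a q) (fun q => !b q)
              (by simpa [dual] using ha) (by simpa [dual] using hb) ?_)
            rw [ne_eq, Bool.not_eq_true] at hab
            rw [← hab]
            simp only [dual]
            congr 1
            funext q
            simp only [Pi.inf_apply, Pi.sup_apply]
            cases a q <;> cases b q <;> rfl
        · push Not at hinf
          obtain ⟨a, b, ha, hb, hab⟩ := hinf
          exact .inl (encodesGraphs_of_not_and h1 h0 r hr hr' hR a b ha hb (by simpa using hab))

end

end BoolIso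
namespace BoolIso

/-! ### Recovering a graph from the set of satisfying assignments -/

/-- The unknowns of the encoding of a graph, together with the constant true. -/
inductive Lab (n : ℕ) : Type
  | top
  | vert (i : Fin n)
  | pair (i j : Fin n)
  deriving DecidableEq

/-! ### Dependences among the intended values of the unknowns -/

section Ideal
variable {n : ℕ} (κ : Kind) (G : SimpleGraph (Fin n))

/-- The intended values of the unknowns. -/
structure Ideal (b : Lab n → Bool) : Prop where
  top : b .top = true
  adj : ∀ i j, G.Adj i j → κ.Law (b (.pair i j)) (b (.vert i)) (b (.vert j))
  nonadj : ∀ i j, ¬ G.Adj i j → b (.pair i j) = true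

/-- Unknowns that always have the same value. -/
def LTied (l l' : Lab n) : Prop := ∀ b, Ideal κ G b → b l = b l'

/-- Unknowns for which some pair of values is impossible. -/
def LDep (l l' : Lab n) : Prop := ∃ p q, ∀ b, Ideal κ G b → ¬ (b l = p ∧ b l' = q)

/-- A value for the unknown of an edge with the given values at the end points. -/
def Kind.edge : Kind → Bool → Bool → Bool
  | .or, _, _ => true
  | .imp, u, v => u || v
  | .xor, u, v => !(Bool.xor u v)
  | .and, u, v => u && v

variable {κ} in
theorem Kind.law_edge (u v : Bool) (h : κ = .or ∨ κ = .and → (u || v) = true) :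
    κ.Law (κ.edge u v) u v := by
  revert h; cases κ <;> cases u <;> cases v <;> decide

open Classical in
/-- Values of the unknowns with given values at vertices and edges. -/
noncomputable def assemble (x : Fin n → Bool) (e : Fin n → Fin n → Bool) : Lab n → Bool
  | .top => true
  | .vert i => x i
  | .pair i j => if G.Adj i j then e i j else true

variable {κ G}

theorem ideal_assemble {x : Fin n → Bool} {e : Fin n → Fin n → Bool}
    (h : ∀ i j, G.Adj i j → κ.Law (e i j) (x i) (x j)) : Ideal κ G (assemble G x e) where
  top := rfl
  adj i j hij := by simpa [assemble, hij] using h i j hij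
  nonadj i j hij := by simp [assemble, hij]

variable (κ G) in
/-- Values of the unknowns with given values at the vertices. -/
noncomputable def extend (x : Fin n → Bool) : Lab n → Bool :=
  assemble G x fun i j => κ.edge (x i) (x j)

/-- Only `or` and `and` restrict the values at the vertices; for these the hypothesis says that `x`
is a vertex cover. -/
theorem ideal_extend {x : Fin n → Bool}
    (h : κ = .or ∨ κ = .and → ∀ i j, G.Adj i j → (x i || x j) = true) :
    Ideal κ G (extend κ G x) :=
  ideal_assemble fun i j hij => κ.law_edge _ _ fun hκ => h hκ i j hij

@[simp] theorem extend_vert (x : Fin n → Bool) (i : Fin n) : extend κ G x (.vert i) = x i := rfl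

@[simp] theorem extend_top (x : Fin n → Bool) : extend κ G x .top = true := rfl

theorem extend_pair (x : Fin n → Bool) {i j : Fin n} (h : G.Adj i j) :
    extend κ G x (.pair i j) = κ.edge (x i) (x j) := by simp [extend, assemble, h]

theorem ideal_true : Ideal κ G (extend κ G fun _ => true) := ideal_extend (by simp)

/-- All vertices but one form a vertex cover, because there are no loops. These are the main test
assignments for telling unknowns apart. -/
theorem ideal_ne (m : Fin n) : Ideal κ G (extend κ G fun i => i ≠ m) :=
  ideal_extend fun _ i j hij => by
    have := hij.ne
    by_cases h : i = m <;> simp [h]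
    rintro rfl; exact this h

theorem not_lTied_vert_top (i : Fin n) : ¬ LTied κ G (.vert i) .top := fun h => by
  simpa using h _ (ideal_ne i)

theorem not_lTied_vert_vert {i j : Fin n} (hij : i ≠ j) : ¬ LTied κ G (.vert i) (.vert j) :=
  fun h => by simpa [hij.symm] using h _ (ideal_ne i)

theorem extend_true_apply (l : Lab n) : extend κ G (fun _ => true) l = true := by
  cases l with
  | top => rfl
  | vert i => rfl
  | pair i j => cases κ <;> simp [extend, assemble, Kind.edge]

theorem lTied_pair_top_of_not_adj {i j : Fin n} (h : ¬ G.Adj i j) :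
    LTied κ G (.pair i j) .top := fun b hb => by rw [hb.nonadj i j h, hb.top]

theorem lTied_pair_top_of_or (i j : Fin n) : LTied .or G (.pair i j) .top := fun b hb => by
  by_cases h : G.Adj i j
  · rw [hb.top]; exact (hb.adj i j h).1
  · rw [hb.nonadj i j h, hb.top]

theorem Kind.edge_eq_false {κ : Kind} (h : κ = .xor ∨ κ = .and) (u v : Bool) (huv : u ≠ v) :
    κ.edge u v = false := by
  revert h huv; cases κ <;> cases u <;> cases v <;> decide

theorem Kind.xor_or_and {κ : Kind} (h : κ ≠ .or) (h' : κ ≠ .imp) : κ = .xor ∨ κ = .and := by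
  cases κ <;> simp_all

/-- A single false vertex makes an edge false precisely when it is an end point, so these
assignments reveal the end points of an edge. -/
theorem extend_ne_pair (hκ : κ = .xor ∨ κ = .and) {i j : Fin n} (hij : G.Adj i j) (m : Fin n) :
    extend κ G (fun i => i ≠ m) (.pair i j) = false ↔ m = i ∨ m = j := by
  rw [extend_pair _ hij]
  have := hij.ne
  constructor
  · intro h
    by_contra hcon
    push Not at hcon
    rcases hκ with rfl | rfl <;> simp [Kind.edge, hcon.1.symm, hcon.2.symm] at h
  · intro h
    apply Kind.edge_eq_false hκ
    rcases h with rfl | rfl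
    · simp [this.symm]
    · simp [this]

theorem not_lTied_pair_top (hκ : κ ≠ .or) {i j : Fin n} (hij : G.Adj i j) :
    ¬ LTied κ G (.pair i j) .top := fun h => by
  by_cases hi : κ = .imp
  · subst hi
    have := h _ (ideal_extend (x := fun _ => false) (by simp))
    simp [extend_pair _ hij, Kind.edge] at this
  · have := h _ (ideal_ne i)
    rw [(extend_ne_pair (Kind.xor_or_and hκ hi) hij i).2 (.inl rfl)] at this
    simp at this

/-- For `imp`, when only `k` is false every edge still has a true end point and is true. For `xor`
and `and`, an end point other than `k` is made false. -/
theorem not_lTied_pair_vert (hκ : κ ≠ .or) {i j : Fin n} (hij : G.Adj i j) (k : Fin n) :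
    ¬ LTied κ G (.pair i j) (.vert k) := fun h => by
  have hne := hij.ne
  by_cases hi : κ = .imp
  · subst hi
    have := h _ (ideal_ne k)
    simp [extend_pair _ hij, Kind.edge] at this
    exact hne (this.1.trans this.2.symm)
  · have hκ' := Kind.xor_or_and hκ hi
    obtain ⟨m, hm, hmk⟩ : ∃ m, (m = i ∨ m = j) ∧ m ≠ k := by
      by_cases hk : i = k
      · exact ⟨j, .inr rfl, fun h => hne (hk.trans h.symm)⟩
      · exact ⟨i, .inl rfl, hk⟩
    have := h _ (ideal_ne m)
    rw [(extend_ne_pair hκ' hij m).2 hm] at this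
    simp at this
    exact hmk this.symm

/-- For `imp`, the edge unknowns are free when all vertices are false, so even the two orientations
are independent. For `xor` and `and`, the end points can be recovered, but the orientation cannot.
-/
theorem eq_of_lTied_pair_pair (hκ : κ ≠ .or) {i j k l : Fin n} (hij : G.Adj i j)
    (h : LTied κ G (.pair i j) (.pair k l)) : (k = i ∧ l = j) ∨ (k = j ∧ l = i) := by
  have hkl : G.Adj k l := by
    by_contra hkl
    exact not_lTied_pair_top hκ hij fun b hb => (h b hb).trans (lTied_pair_top_of_not_adj hkl b hb)
  by_cases hi : κ = .imp
  · subst hi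
    have := h _ (ideal_assemble (x := fun _ => false)
      (e := fun i' j' => !(decide (i' = i) && decide (j' = j))) (by simp [Kind.Law]))
    simp [assemble, hij, hkl] at this
    exact .inl this
  · have hκ' := Kind.xor_or_and hκ hi
    have key : ∀ m, (m = i ∨ m = j) ↔ (m = k ∨ m = l) := fun m => by
      rw [← extend_ne_pair hκ' hij, ← extend_ne_pair hκ' hkl, h _ (ideal_ne m)]
    have h1 := (key k).2 (.inl rfl)
    have h2 := (key l).2 (.inr rfl)
    have := hkl.ne
    rcases h1 with rfl | rfl <;> rcases h2 with rfl | rfl <;> simp_all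

/-- An edge forbids that both ends are false. Without an edge, any values at `i` and `j` together
with true elsewhere form a vertex cover. -/
theorem lDep_vert_vert (hκ : κ = .or ∨ κ = .and) {i j : Fin n} (hij : i ≠ j) :
    LDep κ G (.vert i) (.vert j) ↔ G.Adj i j := by
  constructor
  · rintro ⟨p, q, h⟩
    by_contra hadj
    have : Ideal κ G (extend κ G fun m => (decide (m ≠ i) || p) && (decide (m ≠ j) || q)) := by
      refine ideal_extend fun _ k l hkl => ?_
      have hne := hkl.ne
      have hkl' := hkl.symm
      by_cases hki : k = i
      · have h1 : l ≠ i := fun h => hne (hki.trans h.symm)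
        have h2 : l ≠ j := by rintro rfl; exact hadj (hki ▸ hkl)
        simp [h1, h2]
      · by_cases hkj : k = j
        · have h1 : l ≠ j := fun h => hne (hkj.trans h.symm)
          have h2 : l ≠ i := by rintro rfl; exact hadj (hkj ▸ hkl')
          simp [h1, h2]
        · simp [hki, hkj]
    refine h _ this ?_
    simp [hij, hij.symm]
  · intro h
    refine ⟨false, false, fun b hb hcon => ?_⟩
    have := hb.adj i j h
    rcases hκ with rfl | rfl <;> simp [Kind.Law, hcon.1, hcon.2] at this

/-- A true end point rules out a false edge. If `i` is not an end point, its value and that of the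
edge are free once all other vertices are false and all other edges true. -/
theorem lDep_vert_pair {i k l : Fin n} (hkl : G.Adj k l) :
    LDep .imp G (.vert i) (.pair k l) ↔ i = k ∨ i = l := by
  constructor
  · rintro ⟨p, q, h⟩
    by_contra hcon
    push Not at hcon
    refine h _ (ideal_assemble (x := fun m => decide (m = i) && p)
      (e := fun i' j' => !(decide (i' = k) && decide (j' = l)) || q) fun i' j' _ => ?_) ?_
    · constructor
      · intro h
        have : i' = i := by simp at h; exact h.1
        subst this
        simp [hcon.1]
      · intro h
        have : j' = i := by simp at h; exact h.1
        subst this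
        simp [hcon.2]
    · simp [assemble, hkl]
  · rintro (rfl | rfl)
    · exact ⟨true, false, fun b hb hcon => by
        have := (hb.adj _ _ hkl).1 hcon.1
        simp [hcon.2] at this⟩
    · exact ⟨true, false, fun b hb hcon => by
        have := (hb.adj _ _ hkl).2 hcon.1
        simp [hcon.2] at this⟩

/-- The all-true assignment gives `c = true`. Making only `i`, or only `j`, false then forces the
unknown `l` to be false both times, and among unknowns that are not constantly true only those of an
edge between `i` and `j` behave like this. -/
theorem exists_sum_const {i j : Fin n} (hij : i ≠ j) :
    (∃ l c, ¬ LTied .xor G l .top ∧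
      ∀ b, Ideal .xor G b → xor (xor (b (.vert i)) (b (.vert j))) (b l) = c) ↔ G.Adj i j := by
  constructor
  · rintro ⟨l, c, hl, h⟩
    have h0 := h _ ideal_true
    simp only [extend_true_apply] at h0
    simp only [bne_self_eq_false, Bool.false_bne] at h0
    subst h0
    have hi := h _ (ideal_ne i)
    have hj := h _ (ideal_ne j)
    simp [hij, hij.symm] at hi hj
    cases l with
    | top => simp at hi
    | vert k => simp at hi hj; exact absurd (hi.symm.trans hj) hij
    | pair k l =>
      by_cases hkl : G.Adj k l
      · have e := extend_ne_pair (κ := .xor) (.inl rfl) hkl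
        simp only [ne_eq, decide_not] at e
        rw [e] at hi hj
        rcases hi with rfl | rfl <;> rcases hj with rfl | rfl
        · exact absurd rfl hij
        · exact hkl
        · exact hkl.symm
        · exact absurd rfl hij
      · exact absurd (lTied_pair_top_of_not_adj hkl) hl
  · intro h
    refine ⟨.pair i j, true, not_lTied_pair_top (by decide) h, fun b hb => ?_⟩
    have := hb.adj i j h
    simp only [Kind.Law] at this
    rw [this]
    cases b (.vert i) <;> cases b (.vert j) <;> rfl

end Ideal

/-! ### Reconstruction invariant under permutations of the variables -/

section Recovery
variable {X : Type} [Fintype X] (M : (X → Bool) → Prop)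

/-- Variables that are equal in all members, or opposite in all members. -/
def Tied (x y : X) : Prop := ∃ c, ∀ a, M a → xor (a x) (a y) = c

/-- Variables for which, relative to `t`, some pair of values is impossible. -/
def Dep (t x y : X) : Prop := ∃ p q, ∀ a, M a → ¬ (xor (a x) (a t) = p ∧ xor (a y) (a t) = q)

open Classical in
/-- Variables tied to the majority of the variables. -/
def IsTop (x : X) : Prop := Fintype.card X < 2 * (Finset.univ.filter fun y => Tied M x y).card

open Classical in
/-- Variables that represent vertices. -/
def IsVert (K : ℕ) (x : X) : Prop :=
  ¬ IsTop M x ∧ K ≤ (Finset.univ.filter fun y => Tied M x y).card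

/-- Adjacency in terms of the satisfying assignments. -/
def Conn (K : ℕ) : Kind → X → X → Prop
  | .or, x, y => ∃ t, IsTop M t ∧ Dep M t x y
  | .and, x, y => ∃ t, IsTop M t ∧ Dep M t x y
  | .imp, x, y => ∃ t e, IsTop M t ∧ ¬ IsTop M e ∧ ¬ IsVert M K e ∧ Dep M t x e ∧ Dep M t y e
  | .xor, x, y => ∃ t e c, IsTop M t ∧ ¬ IsTop M e ∧
      ∀ a, M a → xor (xor (a x) (a y)) (xor (a e) (a t)) = c

open Classical in
/-- The members of `M` are, up to complementation, the assignments which come from intended values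
of the unknowns. -/
structure Represents (κ : Kind) (K : ℕ) {n : ℕ} (G : SimpleGraph (Fin n)) (lab : X → Lab n)
    (sgn : X → Bool) : Prop where
  sub : ∀ a, M a → ∃ b c, Ideal κ G b ∧ ∀ x, a x = xor (xor (b (lab x)) (sgn x)) c
  sup : ∀ b, Ideal κ G b → ∃ c, M fun x => xor (xor (b (lab x)) (sgn x)) c
  pos : 0 < K
  top_card : Fintype.card X < 2 * (Finset.univ.filter fun x => lab x = .top).card
  vert_card : ∀ i, K ≤ (Finset.univ.filter fun x => lab x = .vert i).card
  pair_card : κ ≠ .or → ∀ i j,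
    (Finset.univ.filter fun x => lab x = .pair i j ∨ lab x = .pair j i).card < K

namespace Represents
variable {M} {κ : Kind} {K n : ℕ} {G : SimpleGraph (Fin n)} {lab : X → Lab n} {sgn : X → Bool}
  (h : Represents M κ K G lab sgn)
include h

/-- The global complement cancels in the sum of two variables, and the all-true assignment shows
that the constant must be the sum of the signs. -/
theorem tied_iff (x y : X) : Tied M x y ↔ LTied κ G (lab x) (lab y) := by
  constructor
  · rintro ⟨c, hc⟩ b hb
    obtain ⟨c₁, h₁⟩ := h.sup _ ideal_true
    obtain ⟨c₂, h₂⟩ := h.sup b hb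
    have e₁ := hc _ h₁
    have e₂ := hc _ h₂
    simp only [extend_true_apply] at e₁
    rw [← e₁] at e₂
    revert e₂
    cases b (lab x) <;> cases b (lab y) <;> cases sgn x <;> cases sgn y <;> cases c₁ <;>
      cases c₂ <;> simp
  · intro hl
    refine ⟨xor (sgn x) (sgn y), fun a ha => ?_⟩
    obtain ⟨b, c, hb, hx⟩ := h.sub a ha
    rw [hx, hx, hl b hb]
    cases b (lab y) <;> cases sgn x <;> cases sgn y <;> cases c <;> rfl

/-- Two sets that each contain more than half of the variables intersect, so a class above one half
has to be the class of the constant unknown. -/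
theorem isTop_iff (x : X) : IsTop M x ↔ LTied κ G (lab x) .top := by
  classical
  constructor
  · intro hx
    have hx' : Fintype.card X < 2 * (Finset.univ.filter fun y => Tied M x y).card := by
      unfold IsTop at hx
      convert hx
    have ht := h.top_card
    obtain ⟨y, hy⟩ : ((Finset.univ.filter fun y => Tied M x y) ∩
        (Finset.univ.filter fun x => lab x = .top)).Nonempty := by
      rw [← Finset.card_pos]
      have h1 := Finset.card_union_add_card_inter (Finset.univ.filter fun y => Tied M x y)
        (Finset.univ.filter fun x => lab x = .top)
      have h2 := Finset.card_le_univ ((Finset.univ.filter fun y => Tied M x y) ∪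
        (Finset.univ.filter fun x => lab x = .top))
      omega
    simp only [Finset.mem_inter, Finset.mem_filter, Finset.mem_univ, true_and] at hy
    rw [← hy.2, ← h.tied_iff]
    exact hy.1
  · intro hl
    refine h.top_card.trans_le (Nat.mul_le_mul_left 2 (Finset.card_le_card fun y hy => ?_))
    simp only [Finset.mem_filter, Finset.mem_univ, true_and] at hy ⊢
    rwa [h.tied_iff, hy]

theorem exists_isTop : ∃ t, IsTop M t := by
  classical
  have ht := h.top_card
  obtain ⟨t, ht⟩ : (Finset.univ.filter fun x => lab x = .top).Nonempty := by
    rw [← Finset.card_pos]; omega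
  simp only [Finset.mem_filter, Finset.mem_univ, true_and] at ht
  exact ⟨t, (h.isTop_iff t).2 fun b _ => by rw [ht]⟩

theorem exists_vert (i : Fin n) : ∃ x, lab x = .vert i := by
  classical
  have ht := h.vert_card i
  have := h.pos
  obtain ⟨t, ht⟩ : (Finset.univ.filter fun x => lab x = .vert i).Nonempty := by
    rw [← Finset.card_pos]; omega
  simp only [Finset.mem_filter, Finset.mem_univ, true_and] at ht
  exact ⟨t, ht⟩

/-- Outside the top class, the variables tied to the one of a pair belong to that pair or its
reversal, and these number fewer than `K`; the class of a vertex has at least `K` elements. -/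
theorem isVert_iff (x : X) : IsVert M K x ↔ ∃ i, lab x = .vert i := by
  classical
  rw [IsVert, h.isTop_iff]
  constructor
  · rintro ⟨h1, h2⟩
    cases hx : lab x with
    | top => exact absurd (fun b _ => by rw [hx]) h1
    | vert i => exact ⟨i, rfl⟩
    | pair i j =>
      exfalso
      rw [hx] at h1
      have hκ : κ ≠ .or := by rintro rfl; exact h1 (lTied_pair_top_of_or i j)
      have hij : G.Adj i j := by by_contra hij; exact h1 (lTied_pair_top_of_not_adj hij)
      refine absurd (h.pair_card hκ i j) (not_lt.2 (h2.trans (Finset.card_le_card fun y hy => ?_)))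
      simp only [Finset.mem_filter, Finset.mem_univ, true_and, h.tied_iff, hx] at hy ⊢
      cases hy' : lab y with
      | top => exact absurd (hy' ▸ hy) h1
      | vert k => exact absurd (hy' ▸ hy) (not_lTied_pair_vert hκ hij k)
      | pair k l =>
        rw [hy'] at hy
        rcases eq_of_lTied_pair_pair hκ hij hy with ⟨rfl, rfl⟩ | ⟨rfl, rfl⟩
        · exact .inl rfl
        · exact .inr rfl
  · rintro ⟨i, hi⟩
    refine ⟨hi ▸ not_lTied_vert_top i, (h.vert_card i).trans (Finset.card_le_card fun y hy => ?_)⟩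
    simp only [Finset.mem_filter, Finset.mem_univ, true_and] at hy ⊢
    rw [h.tied_iff, hi, hy]
    exact fun b _ => rfl

/-- Adding the value at `t` cancels the global complement. Since the unknown at `t` is true, it also
contributes the negation that appears in the translated values of `p` and `q`. -/
theorem dep_iff {t : X} (ht : IsTop M t) (x y : X) : Dep M t x y ↔ LDep κ G (lab x) (lab y) := by
  rw [h.isTop_iff] at ht
  constructor
  · rintro ⟨p, q, hpq⟩
    refine ⟨!xor (xor p (sgn x)) (sgn t), !xor (xor q (sgn y)) (sgn t), fun b hb hcon => ?_⟩
    obtain ⟨c, hc⟩ := h.sup b hb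
    apply hpq _ hc
    rw [ht b hb, hb.top, hcon.1, hcon.2]
    constructor
    · cases sgn x <;> cases sgn t <;> cases c <;> simp
    · cases sgn y <;> cases sgn t <;> cases c <;> simp
  · rintro ⟨p, q, hpq⟩
    refine ⟨!xor (xor p (sgn x)) (sgn t), !xor (xor q (sgn y)) (sgn t), fun a ha hcon => ?_⟩
    obtain ⟨b, c, hb, hx⟩ := h.sub a ha
    apply hpq b hb
    rw [hx, hx, hx, ht b hb, hb.top] at hcon
    refine ⟨?_, ?_⟩
    · have := hcon.1
      revert this
      cases b (lab x) <;> cases sgn x <;> cases sgn t <;> cases c <;> cases p <;> simp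
    · have := hcon.2
      revert this
      cases b (lab y) <;> cases sgn y <;> cases sgn t <;> cases c <;> cases q <;> simp

theorem conn_iff {x y : X} {i j : Fin n} (hx : lab x = .vert i) (hy : lab y = .vert j)
    (hij : i ≠ j) (hpair : ∀ i j, ∃ x, lab x = .pair i j) : Conn M K κ x y ↔ G.Adj i j := by
  have hdep : κ = .or ∨ κ = .and → ((∃ t, IsTop M t ∧ Dep M t x y) ↔ G.Adj i j) := fun hκ => by
    rw [← lDep_vert_vert hκ hij]
    constructor
    · rintro ⟨t, ht, hd⟩
      rwa [h.dep_iff ht, hx, hy] at hd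
    · intro hd
      obtain ⟨t, ht⟩ := h.exists_isTop
      exact ⟨t, ht, by rwa [h.dep_iff ht, hx, hy]⟩
  cases κ with
  | or => exact hdep (.inl rfl)
  | and => exact hdep (.inr rfl)
  | imp =>
    constructor
    · rintro ⟨t, e, ht, he, hv, h1, h2⟩
      rw [h.isTop_iff] at he
      rw [h.isVert_iff] at hv
      rw [h.dep_iff ht, hx] at h1
      rw [h.dep_iff ht, hy] at h2
      cases hl : lab e with
      | top => exact absurd (fun b _ => by rw [hl]) he
      | vert k => exact absurd ⟨k, hl⟩ hv
      | pair k l =>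
        rw [hl] at h1 h2 he
        have hkl : G.Adj k l := by
          by_contra hkl
          exact he (lTied_pair_top_of_not_adj hkl)
        rw [lDep_vert_pair hkl] at h1 h2
        rcases h1 with rfl | rfl <;> rcases h2 with rfl | rfl
        · exact absurd rfl hij
        · exact hkl
        · exact hkl.symm
        · exact absurd rfl hij
    · intro hadj
      obtain ⟨t, ht⟩ := h.exists_isTop
      obtain ⟨e, he⟩ := hpair i j
      refine ⟨t, e, ht, ?_, ?_, ?_, ?_⟩
      · rw [h.isTop_iff, he]
        exact not_lTied_pair_top (by decide) hadj
      · rw [h.isVert_iff, he]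
        simp
      · rw [h.dep_iff ht, hx, he]
        exact (lDep_vert_pair hadj).2 (.inl rfl)
      · rw [h.dep_iff ht, hy, he]
        exact (lDep_vert_pair hadj).2 (.inr rfl)
  | xor =>
    rw [← exists_sum_const hij]
    constructor
    · rintro ⟨t, e, c, ht, he, hc⟩
      rw [h.isTop_iff] at ht he
      refine ⟨lab e, xor (xor (xor (sgn x) (sgn y)) (xor (sgn e) (sgn t))) !c, he, fun b hb => ?_⟩
      obtain ⟨c', hc'⟩ := h.sup b hb
      rw [← hc _ hc', ht b hb, hb.top, hx, hy]
      cases b (.vert i) <;> cases b (.vert j) <;> cases b (lab e) <;> cases sgn x <;>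
        cases sgn y <;> cases sgn e <;> cases sgn t <;> cases c' <;> rfl
    · rw [exists_sum_const hij]
      intro hadj
      obtain ⟨t, ht⟩ := h.exists_isTop
      obtain ⟨e, he⟩ := hpair i j
      refine ⟨t, e, xor (xor (sgn x) (sgn y)) (xor (sgn e) (sgn t)), ht, ?_, fun a ha => ?_⟩
      · rw [h.isTop_iff, he]
        exact not_lTied_pair_top (by decide) hadj
      · obtain ⟨b, c, hb, hx'⟩ := h.sub a ha
        rw [h.isTop_iff] at ht
        have hl := hb.adj i j hadj
        simp only [Kind.Law] at hl
        rw [hx', hx', hx', hx', ht b hb, hb.top, hx, hy, he, hl]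
        cases b (.vert i) <;> cases b (.vert j) <;> cases sgn x <;>
          cases sgn y <;> cases sgn e <;> cases sgn t <;> cases c <;> rfl

end Represents

/-- A set of assignments represents at most one graph. -/
theorem Represents.nonempty_iso {M : (X → Bool) → Prop} {κ : Kind} {K n : ℕ}
    {G H : SimpleGraph (Fin n)} {lab lab' : X → Lab n} {sgn sgn' : X → Bool}
    (hG : Represents M κ K G lab sgn) (hH : Represents M κ K H lab' sgn')
    (hpG : ∀ i j, ∃ x, lab x = .pair i j) (hpH : ∀ i j, ∃ x, lab' x = .pair i j) :
    Nonempty (G ≃g H) := by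
  choose x hx using hG.exists_vert
  -- Being a vertex variable is a property of `M` and `K` alone, so both representations agree on
  -- it.
  have : ∀ i, ∃ j, lab' (x i) = .vert j := fun i => by
    rw [← hH.isVert_iff, hG.isVert_iff]; exact ⟨i, hx i⟩
  choose f hf using this
  have hinj : Function.Injective f := fun i j hij => by
    by_contra hne
    have ht : ¬ Tied M (x i) (x j) := by
      rw [hG.tied_iff, hx, hx]; exact not_lTied_vert_vert hne
    rw [hH.tied_iff, hf, hf, hij] at ht
    exact ht fun b _ => rfl
  refine ⟨⟨Equiv.ofBijective f (Finite.injective_iff_bijective.1 hinj), fun {i j} => ?_⟩⟩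
  by_cases hij : i = j
  · simp [hij]
  · rw [← hG.conn_iff (hx i) (hx j) hij hpG]
    exact (hH.conn_iff (hf i) (hf j) (hinj.ne hij) hpH).symm

end Recovery

end BoolIso
namespace BoolIso

/-! ### Systems of constraint applications built from graphs -/

/-- The places for unknowns: one for each vertex and one for each pair of vertices. -/
abbrev Slot (n : ℕ) : Type := Fin n ⊕ (Fin n × Fin n)

/-- How a place is related to an entry of the adjacency matrix. -/
inductive Role : Type
  | row | col | cell
  deriving DecidableEq

/-- The place with a given role. -/
def Role.slot {n : ℕ} (i j : Fin n) : Role → Slot n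
  | .row => .inl i
  | .col => .inl j
  | .cell => .inr (i, j)

/-- Lists of applications for a vertex and for an entry of the adjacency matrix. There are `B`
unknowns at every place. -/
structure Template (k : ℕ) (μ : Mode) (B : ℕ) where
  /-- the applications for a vertex -/
  vert : List (Fin k → μ.Var (Fin B))
  /-- the applications for an entry of the adjacency matrix -/
  cell : Bool → List (Fin k → μ.Var (Role × Fin B))

section
variable {k : ℕ} {μ : Mode} {B n : ℕ}

/-- Renaming of unknowns. -/
def Mode.mapVar (μ : Mode) {ι κ : Type} (g : ι → κ) : μ.Var ι → μ.Var κ :=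
  Sum.map id (Prod.map g id)

theorem Mode.val_mapVar (μ : Mode) {ι κ : Type} (g : ι → κ) (b : κ → Bool) :
    μ.val b ∘ μ.mapVar g = μ.val (b ∘ g) := by
  funext y
  rcases y with (_ | _) | ⟨i, d⟩ <;> rfl

theorem Mode.mapVar_comp (μ : Mode) {ι κ ρ : Type} (h : κ → ρ) (g : ι → κ) :
    μ.mapVar h ∘ μ.mapVar g = μ.mapVar (h ∘ g) := by
  funext y
  rcases y with _ | ⟨i, d⟩ <;> rfl

/-- The applications for the row `i` and the column `j`. -/
def Template.cellAt (T : Template k μ B) (β : Bool) (i j : Fin n) :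
    List (Fin k → μ.Var (Slot n × Fin B)) :=
  (T.cell β).map fun A q => μ.mapVar (Prod.map (Role.slot i j) id) (A q)

/-- The applications for the vertex `i`. -/
def Template.vertAt (T : Template k μ B) (i : Fin n) : List (Fin k → μ.Var (Slot n × Fin B)) :=
  T.vert.map fun A q => μ.mapVar (fun c => (.inl i, c)) (A q)

open Classical in
/-- The system of applications built from a graph. -/
noncomputable def Template.system (T : Template k μ B) (G : SimpleGraph (Fin n)) :
    List (Fin k → μ.Var (Slot n × Fin B)) :=
  (List.finRange n).flatMap fun i =>
    ((List.finRange n).flatMap fun j => T.cellAt (decide (G.Adj i j)) i j) ++ T.vertAt i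

theorem sat_flatMap {R : (Fin k → Bool) → Bool} {Y I : Type} (a : Y → Bool) (l : List I)
    (f : I → List (Fin k → Y)) : Sat R a (l.flatMap f) ↔ ∀ i ∈ l, Sat R a (f i) := by
  simp only [Sat, List.mem_flatMap]
  exact ⟨fun h i hi A hA => h A ⟨i, hi, hA⟩, fun h A ⟨i, hi, hA⟩ => h i hi A hA⟩

open Classical in
theorem Template.sat_system (T : Template k μ B) (G : SimpleGraph (Fin n))
    (R : (Fin k → Bool) → Bool) (a : μ.Var (Slot n × Fin B) → Bool) :
    Sat R a (T.system G) ↔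
      (∀ i j, Sat R (a ∘ μ.mapVar (Prod.map (Role.slot i j) id)) (T.cell (decide (G.Adj i j)))) ∧
        ∀ i : Fin n, Sat R (a ∘ μ.mapVar fun c => (.inl i, c)) T.vert := by
  simp only [Template.system, sat_flatMap, sat_append, List.mem_finRange, forall_true_left,
    Template.cellAt, Template.vertAt, sat_map, forall_and]

/-- Isomorphic graphs yield isomorphic systems. -/
theorem Template.exists_perm_of_iso (T : Template k μ B) {G H : SimpleGraph (Fin n)} (φ : G ≃g H)
    (R : (Fin k → Bool) → Bool) : ∃ π : Equiv.Perm (μ.Var (Slot n × Fin B)),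
      ∀ a, Sat R (a ∘ π) (T.system G) ↔ Sat R a (T.system H) := by
  classical
  let s : Equiv.Perm (Slot n) := Equiv.sumCongr φ.toEquiv (Equiv.prodCongr φ.toEquiv φ.toEquiv)
  let π : Equiv.Perm (μ.Var (Slot n × Fin B)) :=
    Equiv.sumCongr (Equiv.refl _)
      (Equiv.prodCongr (Equiv.prodCongr s (Equiv.refl _)) (Equiv.refl _))
  have h1 : ∀ i j, π ∘ μ.mapVar (Prod.map (Role.slot i j) (id : Fin B → Fin B)) =
      μ.mapVar (Prod.map (Role.slot (φ i) (φ j)) id) := by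
    intro i j
    funext y
    rcases y with c | ⟨⟨r, c⟩, d⟩
    · rfl
    · cases r <;> rfl
  have h2 : ∀ i, π ∘ μ.mapVar (fun c : Fin B => ((.inl i : Slot n), c)) =
      μ.mapVar fun c => (.inl (φ i), c) := by
    intro i
    funext y
    rcases y with c | ⟨c, d⟩ <;> rfl
  refine ⟨π, fun a => ?_⟩
  rw [T.sat_system, T.sat_system]
  refine and_congr ?_ ?_
  · have : ∀ i j, Sat R ((a ∘ π) ∘ μ.mapVar (Prod.map (Role.slot i j) id))
        (T.cell (decide (G.Adj i j))) ↔ Sat R (a ∘ μ.mapVar (Prod.map (Role.slot (φ i) (φ j)) id))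
        (T.cell (decide (H.Adj (φ i) (φ j)))) := by
      intro i j
      rw [Function.comp_assoc, h1]
      simp only [φ.map_rel_iff]
    constructor
    · intro h i j
      have := (this (φ.symm i) (φ.symm j)).1 (h _ _)
      simpa using this
    · exact fun h i j => (this i j).2 (h _ _)
  · have : ∀ i, Sat R ((a ∘ π) ∘ μ.mapVar fun c => (.inl i, c)) T.vert ↔
        Sat R (a ∘ μ.mapVar fun c => (.inl (φ i), c)) T.vert := by
      intro i
      rw [Function.comp_assoc, h2]
    constructor
    · intro h i
      have := (this (φ.symm i)).1 (h _)
      simpa using this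
    · exact fun h i => (this i).2 (h _)

/-! ### The template for a relation that encodes graphs -/

/-- The number of unknowns that represent a vertex. -/
def Kind.mult (κ : Kind) : ℕ := if κ = .or then 1 else 3

theorem Kind.mult_pos (κ : Kind) : 0 < κ.mult := by unfold Kind.mult; split_ifs <;> decide

/-- The meaning of the unknowns at the places. -/
def slotLab (K : ℕ) : Slot n × Fin B → Lab n
  | (.inl i, c) => if c.1 < K then .vert i else .top
  | (.inr (i, j), c) => if c.1 = 0 then .pair i j else .top

/-- The meaning of the variables. -/
def varLab (K : ℕ) : μ.Var (Slot n × Fin B) → Lab n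
  | .inl _ => .top
  | .inr (x, _) => slotLab K x

/-- The signs of the variables. -/
def varSgn : μ.Var (Slot n × Fin B) → Bool
  | .inl true => false
  | .inl false => μ.τ
  | .inr (_, d) => !μ.s d

theorem val_comp_slotLab (K : ℕ) (b : Lab n → Bool) (hb : b .top = true)
    (y : μ.Var (Slot n × Fin B)) :
    μ.val (b ∘ slotLab K) y = xor (b (varLab K y)) (varSgn y) := by
  rcases y with (_ | _) | ⟨i, d⟩
  · simp [Mode.val, varLab, varSgn, hb]
  · simp [Mode.val, varLab, varSgn, hb]
  · simp only [Mode.val, varLab, varSgn, Function.comp]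
    cases b (slotLab K i) <;> cases μ.s d <;> rfl

/-- The system built from a graph is satisfied, if the reference variable is true, exactly by the
assignments that come from intended values of the unknowns. -/
structure Template.Correct (T : Template k μ B) (R : (Fin k → Bool) → Bool) (κ : Kind) : Prop where
  good_vert : Good R T.vert
  good_cell : ∀ β, Good R (T.cell β)
  sat : ∀ (n : ℕ) (G : SimpleGraph (Fin n)) (a : μ.Var (Slot n × Fin B) → Bool), 0 < n →
    a (.inl true) = true →
      (Sat R a (T.system G) ↔ ∃ b, Ideal κ G b ∧ a = μ.val (b ∘ slotLab κ.mult))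

/-- At a vertex place the first `κ.mult` unknowns are equated with unknown `z` and the rest forced
true. At a pair place unknown `z` obeys the law if there is an edge, and all others are forced true.
Consistency is imposed on every unknown. -/
theorem exists_template {R : (Fin k → Bool) → Bool} {κ : Kind} (hc : Consistent R μ)
    (hE : Encodes R μ κ) : ∃ T : Template k μ (2 * κ.mult), T.Correct R κ := by
  classical
  obtain ⟨Φc, hcg, hc⟩ := hc
  obtain ⟨Φl, hl, hlg⟩ := hE.law
  obtain ⟨Φt, ht, htg⟩ := hE.top
  -- For `or` equality need not be expressible, but then a vertex has just one unknown and nothing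
  -- is to be equated.
  obtain ⟨Φe, he, heg⟩ : ∃ Φ : List (Fin k → μ.Var (Fin 2)),
      (∀ b, Sat R (μ.val b) Φ ↔ (κ ≠ .or → b 0 = b 1)) ∧ Good R Φ := by
    by_cases hκ : κ = .or
    · exact ⟨[], by simp [Sat, hκ], fun a _ _ => by simp [Sat]⟩
    · obtain ⟨Φ, h1, h2⟩ := hE.eq hκ
      exact ⟨Φ, fun b => by rw [h1]; simp [hκ], h2⟩
  have hB : 0 < 2 * κ.mult := by have := κ.mult_pos; omega
  let z : Fin (2 * κ.mult) := ⟨0, hB⟩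
  let at' : {ι κ' : Type} → (ι → κ') → List (Fin k → μ.Var ι) → List (Fin k → μ.Var κ') :=
    fun g Φ => Φ.map fun A q => μ.mapVar g (A q)
  have hat : ∀ {ι κ' : Type} (g : ι → κ') (Φ : List (Fin k → μ.Var ι)), Good R Φ →
      Good R (at' g Φ) := fun g Φ h => h.subst _ rfl
  have hgood : ∀ {ι I : Type} (l : List I) (f : I → List (Fin k → μ.Var ι)),
      (∀ i, Good R (f i)) → Good R (l.flatMap f) := by
    intro ι I l f hf a ha hs
    rw [sat_flatMap] at hs ⊢
    exact fun i hi => hf i a ha (hs i hi)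
  let T : Template k μ (2 * κ.mult) :=
    { vert := (List.finRange _).flatMap fun c => at' (fun _ => c) Φc ++
        if c.1 < κ.mult then at' ![c, z] Φe else at' (fun _ => c) Φt
      cell := fun β => (List.finRange _).flatMap fun c => at' (fun _ => (.cell, c)) Φc ++
        if c.1 = 0 ∧ β = true then at' ![(.cell, c), (.row, z), (.col, z)] Φl
        else at' (fun _ => (.cell, c)) Φt }
  refine ⟨T, ⟨?_, ?_, ?_⟩⟩
  · refine hgood _ _ fun c => (hat _ _ hcg).append ?_
    split_ifs
    exacts [hat _ _ heg, hat _ _ htg]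
  · refine fun β => hgood _ _ fun c => (hat _ _ hcg).append ?_
    split_ifs
    exacts [hat _ _ hlg, hat _ _ htg]
  intro n G a hn ha
  rw [T.sat_system]
  have hcons : ∀ (p : Slot n × Fin (2 * κ.mult)),
      Sat R (a ∘ μ.mapVar fun _ : Unit => p) Φc ↔
        a (.inl false) = (!μ.τ) ∧ ∃ v, ∀ d, a (.inr (p, d)) = (v == μ.s d) := by
    intro p
    rw [hc _ ha]
    constructor
    · rintro ⟨b, hb⟩
      exact ⟨congrFun hb (.inl false), b (), fun d => congrFun hb (.inr ((), d))⟩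
    · rintro ⟨h1, v, h2⟩
      refine ⟨fun _ => v, ?_⟩
      funext y
      rcases y with (_ | _) | ⟨i, d⟩
      exacts [h1, ha, h2 d]
  have hvert : ∀ (b : Slot n × Fin (2 * κ.mult) → Bool) (i : Fin n),
      Sat R (μ.val b ∘ μ.mapVar fun c => (.inl i, c)) T.vert ↔
        ∀ c, if c.1 < κ.mult then (κ ≠ .or → b (.inl i, c) = b (.inl i, z)) else
          b (.inl i, c) = true := by
    intro b i
    rw [sat_flatMap]
    simp only [List.mem_finRange, forall_true_left, sat_append, at']
    refine forall_congr' fun c => ?_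
    have h1 : Sat R (μ.val (b ∘ (fun c => (Sum.inl i, c)) ∘ fun _ : Unit => c)) Φc :=
      (hc _ rfl).2 ⟨_, rfl⟩
    split_ifs
    · simp only [sat_map, μ.val_mapVar, Function.comp_assoc, h1, he, true_and]
      rfl
    · simp only [sat_map, μ.val_mapVar, Function.comp_assoc, h1, ht, true_and]
      rfl
  have hcell : ∀ (b : Slot n × Fin (2 * κ.mult) → Bool) (i j : Fin n) (β : Bool),
      Sat R (μ.val b ∘ μ.mapVar (Prod.map (Role.slot i j) id)) (T.cell β) ↔
        ∀ c, if c.1 = 0 ∧ β = true then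
          κ.Law (b (.inr (i, j), c)) (b (.inl i, z)) (b (.inl j, z)) else
          b (.inr (i, j), c) = true := by
    intro b i j β
    rw [sat_flatMap]
    simp only [List.mem_finRange, forall_true_left, sat_append, at']
    refine forall_congr' fun c => ?_
    have h1 : Sat R (μ.val (b ∘ Prod.map (Role.slot i j) id ∘ fun _ : Unit => (Role.cell, c))) Φc :=
      (hc _ rfl).2 ⟨_, rfl⟩
    split_ifs
    · simp only [sat_map, μ.val_mapVar, Function.comp_assoc, h1, hl, true_and]
      rfl
    · simp only [sat_map, μ.val_mapVar, Function.comp_assoc, h1, ht, true_and]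
      rfl
  constructor
  · rintro ⟨h1, h2⟩
    have hcv : ∀ i c, Sat R (a ∘ μ.mapVar fun _ : Unit => (.inl i, c)) Φc := by
      intro i c
      have := (sat_append _ _ _).1 ((sat_flatMap _ _ _).1 (h2 i) c (List.mem_finRange c))
      have h3 := this.1
      simp only [at', sat_map, Function.comp_assoc, μ.mapVar_comp] at h3
      exact h3
    have hcc : ∀ i j c, Sat R (a ∘ μ.mapVar fun _ : Unit => (.inr (i, j), c)) Φc := by
      intro i j c
      have := (sat_append _ _ _).1 ((sat_flatMap _ _ _).1 (h1 i j) c (List.mem_finRange c))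
      have h3 := this.1
      simp only [at', sat_map, Function.comp_assoc, μ.mapVar_comp] at h3
      exact h3
    have hall : ∀ p, ∃ v, ∀ d, a (.inr (p, d)) = (v == μ.s d) := by
      rintro ⟨i | ⟨i, j⟩, c⟩
      exacts [((hcons _).1 (hcv i c)).2, ((hcons _).1 (hcc i j c)).2]
    choose b hb using hall
    have hab : a = μ.val b := by
      funext y
      rcases y with (_ | _) | ⟨p, d⟩
      -- The value of `inl false` is enforced only through the places, so at least one vertex is
      -- needed.
      exacts [((hcons _).1 (hcv ⟨0, hn⟩ z)).1, ha, hb p d]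
    subst hab
    have h1 := fun i j => (hcell _ _ _ _).1 (h1 i j)
    have h2 := fun i => (hvert _ _).1 (h2 i)
    refine ⟨fun l => match l with
      | .top => true
      | .vert i => b (.inl i, z)
      | .pair i j => b (.inr (i, j), z), ⟨rfl, fun i j hij => ?_, fun i j hij => ?_⟩, ?_⟩
    · have := h1 i j z
      rwa [if_pos ⟨rfl, by simpa using hij⟩] at this
    · have := h1 i j z
      rwa [if_neg (by simp [hij])] at this
    · congr 1
      funext p
      rcases p with ⟨i | ⟨i, j⟩, c⟩
      · have h3 := h2 i c
        simp only [Function.comp, slotLab]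
        split_ifs at h3 ⊢ with hcm
        · by_cases hκ : κ = .or
          · have : c = z := by
              ext; simp only [Kind.mult, hκ, if_true] at hcm; simp only [z]; omega
            rw [this]
          · exact h3 hκ
        · exact h3
      · have h3 := h1 i j c
        simp only [Function.comp, slotLab]
        by_cases hcz : c.1 = 0
        · have : c = z := Fin.ext hcz
          rw [if_pos hcz, this]
        · rw [if_neg (by simp [hcz])] at h3
          rw [if_neg hcz, h3]
  · rintro ⟨b, hb, rfl⟩
    have hz : (z : Fin (2 * κ.mult)).1 < κ.mult := κ.mult_pos
    refine ⟨fun i j => (hcell _ _ _ _).2 fun c => ?_, fun i => (hvert _ _).2 fun c => ?_⟩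
    · split_ifs with h
      · simp only [Function.comp, slotLab, if_pos h.1, if_pos hz]
        exact hb.adj i j (by simpa using h.2)
      · simp only [Function.comp, slotLab]
        split_ifs with h0
        · exact hb.nonadj i j (by simpa [h0] using h)
        · exact hb.top
    · split_ifs with h
      · intro _
        simp only [Function.comp, slotLab, if_pos h, if_pos hz]
      · simp only [Function.comp, slotLab, if_neg h]
        exact hb.top

theorem Template.Correct.good {R : (Fin k → Bool) → Bool} {κ : Kind} {T : Template k μ B}
    (hT : T.Correct R κ) (G : SimpleGraph (Fin n)) : Good R (T.system G) := by
  intro a ha hs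
  rw [T.sat_system] at hs ⊢
  exact ⟨fun i j => hT.good_cell _ _ ha (hs.1 i j), fun i => hT.good_vert _ ha (hs.2 i)⟩

end

/-! ### The number of variables with a given meaning -/

section
variable {μ : Mode} {n K : ℕ}

/-- Of the `2 * K` unknowns at a place, `K` at a vertex and one at a pair are not padding, which is
at most half. The two reference variables make the inequality strict. -/
theorem card_top (hK : 0 < K) : Fintype.card (μ.Var (Slot n × Fin (2 * K))) <
    2 * (Finset.univ.filter fun x : μ.Var (Slot n × Fin (2 * K)) => varLab K x = .top).card := by
  classical
  let f : (Fin n × Fin K ⊕ Fin n × Fin n) × μ.D → μ.Var (Slot n × Fin (2 * K)) := fun x =>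
    match x with
    | (.inl (i, c), d) => .inr ((.inl i, ⟨c.1, by omega⟩), d)
    | (.inr ij, d) => .inr ((.inr ij, ⟨0, by omega⟩), d)
  have h1 : (Finset.univ.filter fun x : μ.Var (Slot n × Fin (2 * K)) => ¬ varLab K x = .top) ⊆
      Finset.univ.image f := by
    intro x hx
    simp only [Finset.mem_filter, Finset.mem_univ, true_and] at hx
    simp only [Finset.mem_image, Finset.mem_univ, true_and]
    rcases x with _ | ⟨⟨i | ⟨i, j⟩, c⟩, d⟩
    · exact absurd rfl hx
    · simp only [varLab, slotLab] at hx
      split_ifs at hx with hc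
      · exact ⟨(.inl (i, ⟨c.1, hc⟩), d), rfl⟩
      · exact absurd rfl hx
    · simp only [varLab, slotLab] at hx
      split_ifs at hx with hc
      · refine ⟨(.inr (i, j), d), ?_⟩
        rw [show c = ⟨0, by omega⟩ from Fin.ext hc]
      · exact absurd rfl hx
  have h2 := (Finset.card_le_card h1).trans Finset.card_image_le
  have h3 := Finset.card_filter_add_card_filter_not (s := Finset.univ)
    fun x : μ.Var (Slot n × Fin (2 * K)) => varLab K x = .top
  simp only [Finset.card_univ, Fintype.card_prod, Fintype.card_sum, Fintype.card_fin,
    Fintype.card_bool] at h2 h3 ⊢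
  have h4 : 2 * ((n * K + n * n) * Fintype.card μ.D) ≤
      (n + n * n) * (2 * K) * Fintype.card μ.D := by
    rw [← mul_assoc]
    refine Nat.mul_le_mul_right _ ?_
    nlinarith [Nat.zero_le (n * n), Nat.mul_le_mul_left (n * n) hK]
  omega

theorem card_vert (i : Fin n) : K * Fintype.card μ.D ≤
    (Finset.univ.filter fun x : μ.Var (Slot n × Fin (2 * K)) => varLab K x = .vert i).card := by
  classical
  let f : Fin K × μ.D → μ.Var (Slot n × Fin (2 * K)) := fun x =>
    .inr ((.inl i, ⟨x.1.1, by omega⟩), x.2)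
  have hf : Function.Injective f := by
    rintro ⟨c, d⟩ ⟨c', d'⟩ h
    simp only [f, Sum.inr.injEq, Prod.mk.injEq, Fin.mk.injEq, true_and] at h
    exact Prod.ext (Fin.ext h.1) h.2
  have : (Finset.univ.image f).card = K * Fintype.card μ.D := by
    rw [Finset.card_image_of_injective _ hf, Finset.card_univ, Fintype.card_prod, Fintype.card_fin]
  rw [← this]
  refine Finset.card_le_card fun x hx => ?_
  obtain ⟨y, -, rfl⟩ := Finset.mem_image.1 hx
  exact Finset.mem_filter.2 ⟨Finset.mem_univ _, by simp only [f, varLab, slotLab, if_pos y.1.2]⟩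

/-- Each orientation contributes one unknown; this is why vertices need multiplicity three. -/
theorem card_pair (hK : 2 < K) (i j : Fin n) : (Finset.univ.filter fun
    x : μ.Var (Slot n × Fin (2 * K)) => varLab K x = .pair i j ∨ varLab K x = .pair j i).card <
      K * Fintype.card μ.D := by
  classical
  let f : Bool × μ.D → μ.Var (Slot n × Fin (2 * K)) := fun x =>
    .inr ((.inr (if x.1 then (i, j) else (j, i)), ⟨0, by omega⟩), x.2)
  have h1 : (Finset.univ.filter fun x : μ.Var (Slot n × Fin (2 * K)) =>
      varLab K x = .pair i j ∨ varLab K x = .pair j i) ⊆ Finset.univ.image f := by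
    intro x hx
    simp only [Finset.mem_filter, Finset.mem_univ, true_and] at hx
    simp only [Finset.mem_image, Finset.mem_univ, true_and]
    rcases x with _ | ⟨⟨i' | ⟨i', j'⟩, c⟩, d⟩
    · simp [varLab] at hx
    · simp only [varLab, slotLab] at hx
      split_ifs at hx <;> simp at hx
    · simp only [varLab, slotLab] at hx
      split_ifs at hx with hc
      · have hc' : c = ⟨0, by omega⟩ := Fin.ext hc
        simp only [Lab.pair.injEq] at hx
        rcases hx with ⟨rfl, rfl⟩ | ⟨rfl, rfl⟩
        · exact ⟨(true, d), by simp [f, hc']⟩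
        · exact ⟨(false, d), by simp [f, hc']⟩
      · simp at hx
  have h2 := (Finset.card_le_card h1).trans Finset.card_image_le
  simp only [Finset.card_univ, Fintype.card_prod, Fintype.card_bool] at h2
  have : 0 < Fintype.card μ.D := Fintype.card_pos_iff.2 ⟨μ.pos⟩
  refine h2.trans_lt ?_
  exact Nat.mul_lt_mul_of_pos_right hK this

theorem exists_varLab_pair (hK : 0 < K) (i j : Fin n) :
    ∃ x : μ.Var (Slot n × Fin (2 * K)), varLab K x = .pair i j :=
  ⟨.inr ((.inr (i, j), ⟨0, by omega⟩), μ.pos), by simp [varLab, slotLab]⟩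

end

/-! ### Correctness of the reduction -/

section
variable {k : ℕ} {μ : Mode} {κ : Kind} {R R' : (Fin k → Bool) → Bool}
  {T : Template k μ (2 * κ.mult)} {n : ℕ}

/-- If the reference variable is false, goodness allows complementing, which only changes the
constant `c`. The shift `ε` between `R` and `R'` is absorbed in the same way. -/
theorem Template.Correct.represents (hT : T.Correct R' κ) (ε : Bool)
    (hR : ∀ a, R' a = R fun q => xor (a q) ε) (hn : 0 < n) (G : SimpleGraph (Fin n)) :
    Represents (fun a => Sat R a (T.system G)) κ (κ.mult * Fintype.card μ.D) G (varLab κ.mult)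
      varSgn := by
  have hsat : ∀ a, Sat R a (T.system G) ↔ Sat R' (fun y => xor (a y) ε) (T.system G) := by
    intro a
    simp [Sat, hR]
  refine ⟨fun a ha => ?_, fun b hb => ⟨ε, ?_⟩, Nat.mul_pos κ.mult_pos
    (Fintype.card_pos_iff.2 ⟨μ.pos⟩), ?_, fun i => ?_, fun hκ i j => ?_⟩
  · rw [hsat] at ha
    by_cases ht : xor (a (.inl true)) ε = true
    · obtain ⟨b, hb, hab⟩ := (hT.sat n G _ hn ht).1 ha
      refine ⟨b, ε, hb, fun x => ?_⟩
      have := congrFun hab x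
      rw [val_comp_slotLab _ _ hb.top] at this
      rw [← this]; simp
    · have hg := hT.good G _ (by simpa using ht) ha
      obtain ⟨b, hb, hab⟩ := (hT.sat n G _ hn (by simpa using ht)).1 hg
      refine ⟨b, !ε, hb, fun x => ?_⟩
      have := congrFun hab x
      rw [val_comp_slotLab _ _ hb.top] at this
      rw [← this]; cases a x <;> cases ε <;> rfl
  · rw [hsat]
    simp only [Bool.xor_assoc, Bool.xor_self, Bool.xor_false]
    refine (hT.sat n G _ hn ?_).2 ⟨b, hb, ?_⟩
    · simp [varLab, varSgn, hb.top]
    · funext x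
      rw [val_comp_slotLab _ _ hb.top]
  · convert card_top (μ := μ) (n := n) κ.mult_pos
  · convert card_vert (μ := μ) (n := n) (K := κ.mult) i
  · convert card_pair (μ := μ) (n := n) (K := κ.mult) (by simp [Kind.mult, hκ]) i j

theorem Template.Correct.nonempty_iso_iff (hT : T.Correct R' κ) (ε : Bool)
    (hR : ∀ a, R' a = R fun q => xor (a q) ε) (G H : SimpleGraph (Fin n)) :
    Nonempty (G ≃g H) ↔ ∃ π : Equiv.Perm (μ.Var (Slot n × Fin (2 * κ.mult))),
      ∀ a, Sat R (a ∘ π) (T.system G) ↔ Sat R a (T.system H) := by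
  constructor
  · rintro ⟨φ⟩
    exact T.exists_perm_of_iso φ R
  · rintro ⟨π, hπ⟩
    rcases Nat.eq_zero_or_pos n with rfl | hn
    · exact ⟨⟨Equiv.refl _, fun {i} => i.elim0⟩⟩
    have hG := hT.represents ε hR hn G
    have hH := hT.represents ε hR hn H
    -- Relabelling through `π` makes the solutions for `G` represent `H` too, so uniqueness of the
    -- represented graph applies.
    have hH' : Represents (fun a => Sat R a (T.system G)) κ (κ.mult * Fintype.card μ.D) H
        (varLab κ.mult ∘ π) (varSgn ∘ π) := by
      refine ⟨fun a ha => ?_, fun b hb => ?_, hH.pos, ?_, fun i => ?_, fun hκ i j => ?_⟩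
      · have : Sat R (a ∘ π.symm) (T.system H) := by
          rw [← hπ, Function.comp_assoc]
          simpa using ha
        obtain ⟨b, c, hb, h⟩ := hH.sub _ this
        exact ⟨b, c, hb, fun x => by simpa using h (π x)⟩
      · obtain ⟨c, h⟩ := hH.sup b hb
        exact ⟨c, (hπ _).2 h⟩
      · refine hH.top_card.trans_le (Nat.mul_le_mul_left 2 ?_)
        refine Finset.card_le_card_of_injOn π.symm (fun x hx => ?_) π.symm.injective.injOn
        simpa using hx
      · refine (hH.vert_card i).trans ?_
        refine Finset.card_le_card_of_injOn π.symm (fun x hx => ?_) π.symm.injective.injOn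
        simpa using hx
      · refine lt_of_le_of_lt ?_ (hH.pair_card hκ i j)
        refine Finset.card_le_card_of_injOn π (fun x hx => ?_) π.injective.injOn
        simpa using hx
    refine hG.nonempty_iso hH' (exists_varLab_pair κ.mult_pos) fun i j => ?_
    obtain ⟨x, hx⟩ := exists_varLab_pair (μ := μ) κ.mult_pos i j
    exact ⟨π.symm x, by simpa using hx⟩

end

end BoolIso
namespace BoolIso

/-! ### A while language for machines with stacks -/

open Turing

/-- Programs that manipulate stacks `k` with alphabets `Γ k` and a register with values in `σ`. -/
inductive Cmd {K : Type} (Γ : K → Type) (σ : Type) : Type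
  | load (f : σ → σ)
  | push (k : K) (f : σ → Γ k)
  | pop (k : K) (f : σ → Option (Γ k) → σ)
  | seq (c d : Cmd Γ σ)
  | ite (p : σ → Bool) (c d : Cmd Γ σ)
  | loop (p : σ → Bool) (c : Cmd Γ σ)

namespace Cmd
variable {K : Type} {Γ : K → Type} {σ : Type}

/-- The labels of the machine for a program. -/
def Label : Cmd Γ σ → Type
  | load _ => Unit
  | push _ _ => Unit
  | pop _ _ => Unit
  | seq c d => Label c ⊕ Label d
  | ite _ c d => Option (Label c ⊕ Label d)
  | loop _ c => Option (Label c)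

theorem finite_label : ∀ c : Cmd Γ σ, Finite (Label c)
  | load _ => inferInstanceAs (Finite Unit)
  | push _ _ => inferInstanceAs (Finite Unit)
  | pop _ _ => inferInstanceAs (Finite Unit)
  | seq c d => by
    have := finite_label c
    have := finite_label d
    exact inferInstanceAs (Finite (Label c ⊕ Label d))
  | ite _ c d => by
    have := finite_label c
    have := finite_label d
    exact inferInstanceAs (Finite (Option (Label c ⊕ Label d)))
  | loop _ c => by
    have := finite_label c
    exact inferInstanceAs (Finite (Option (Label c)))

/-- The label where a program starts. -/
def entry : ∀ c : Cmd Γ σ, Label c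
  | load _ => ()
  | push _ _ => ()
  | pop _ _ => ()
  | seq c _ => Sum.inl (entry c)
  | ite _ _ _ => (none : Option _)
  | loop _ _ => (none : Option _)

/-- The machine code of a program, whose labels are embedded into those of a larger machine, and
which continues at `exit`. -/
def code {Λ : Type} : ∀ c : Cmd Γ σ, (Label c → Λ) → Λ → Label c → TM2.Stmt Γ Λ σ
  | load f, _, exit, _ => .load f (.goto fun _ => exit)
  | push k f, _, exit, _ => .push k f (.goto fun _ => exit)
  | pop k f, _, exit, _ => .pop k f (.goto fun _ => exit)
  | seq c d, emb, exit, l => match (l : Label c ⊕ Label d) with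
    | .inl l => code c (fun l => emb (Sum.inl l)) (emb (Sum.inr (entry d))) l
    | .inr l => code d (fun l => emb (Sum.inr l)) exit l
  | ite p c d, emb, exit, l => match (l : Option (Label c ⊕ Label d)) with
    | none => .branch p (.goto fun _ => emb (some (Sum.inl (entry c))))
        (.goto fun _ => emb (some (Sum.inr (entry d))))
    | some (.inl l) => code c (fun l => emb (some (Sum.inl l))) exit l
    | some (.inr l) => code d (fun l => emb (some (Sum.inr l))) exit l
  | loop p c, emb, exit, l => match (l : Option (Label c)) with
    | none => .branch p (.goto fun _ => emb (some (entry c))) (.goto fun _ => exit)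
    | some l => code c (fun l => emb (some l)) (emb (none : Option _)) l

variable [DecidableEq K]

/-- `Run c s t n`: started in the state `s`, the program `c` ends in the state `t` after at most
`n` steps. -/
inductive Run : Cmd Γ σ → σ × (∀ k, List (Γ k)) → σ × (∀ k, List (Γ k)) → ℕ → Prop
  | load (f v S) : Run (load f) (v, S) (f v, S) 1
  | push (k f v S) : Run (push k f) (v, S) (v, Function.update S k (f v :: S k)) 1
  | pop (k f v S) : Run (pop k f) (v, S) (f v (S k).head?, Function.update S k (S k).tail) 1
  | seq {c d s t u m n} : Run c s t m → Run d t u n → Run (seq c d) s u (m + n)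
  | ite_true {p c d s t n} : p s.1 = true → Run c s t n → Run (ite p c d) s t (n + 1)
  | ite_false {p c d s t n} : p s.1 = false → Run d s t n → Run (ite p c d) s t (n + 1)
  | loop_false {p c s} : p s.1 = false → Run (loop p c) s s 1
  | loop_true {p c s t u m n} : p s.1 = true → Run c s t m → Run (loop p c) t u n →
      Run (loop p c) s u (m + n + 1)
  | mono {c s t m n} : Run c s t m → m ≤ n → Run c s t n

/-- Many steps of a machine. -/
def Steps {Λ : Type} (M : Λ → TM2.Stmt Γ Λ σ) (n : ℕ) (a b : TM2.Cfg Γ Λ σ) : Prop :=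
  (flip bind (TM2.step M))^[n] (some a) = some b

theorem Steps.trans {Λ : Type} {M : Λ → TM2.Stmt Γ Λ σ} {m n : ℕ} {a b c : TM2.Cfg Γ Λ σ}
    (h : Steps M m a b) (h' : Steps M n b c) : Steps M (m + n) a c := by
  unfold Steps at *
  rw [add_comm, Function.iterate_add_apply, h, h']

theorem Steps.one {Λ : Type} {M : Λ → TM2.Stmt Γ Λ σ} {l : Λ} {v : σ} {S : ∀ k, List (Γ k)}
    {b : TM2.Cfg Γ Λ σ} (h : TM2.stepAux (M l) v S = b) : Steps M 1 ⟨some l, v, S⟩ b := by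
  subst h; rfl

/-- The induction works for an arbitrary machine that contains the code, so that subprograms run in
place with their own exits; a loop body exits to the test of its loop. -/
theorem Run.steps {c : Cmd Γ σ} {s t : σ × (∀ k, List (Γ k))} {n : ℕ} (h : Run c s t n) :
    ∀ {Λ : Type} (M : Λ → TM2.Stmt Γ Λ σ) (emb : Label c → Λ) (exit : Λ),
      (∀ l, M (emb l) = code c emb exit l) →
        ∃ m ≤ n, Steps M m ⟨some (emb (entry c)), s.1, s.2⟩ ⟨some exit, t.1, t.2⟩ := by
  induction h with
  | load f v S => exact fun M emb exit hM => ⟨1, le_rfl, Steps.one (by rw [hM]; rfl)⟩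
  | push k f v S => exact fun M emb exit hM => ⟨1, le_rfl, Steps.one (by rw [hM]; rfl)⟩
  | pop k f v S => exact fun M emb exit hM => ⟨1, le_rfl, Steps.one (by rw [hM]; rfl)⟩
  | seq _ _ ih₁ ih₂ =>
    intro Λ M emb exit hM
    obtain ⟨m₁, hm₁, h₁⟩ := ih₁ M (fun l => emb (Sum.inl l)) _ fun l => hM (Sum.inl l)
    obtain ⟨m₂, hm₂, h₂⟩ := ih₂ M (fun l => emb (Sum.inr l)) exit fun l => hM (Sum.inr l)
    exact ⟨m₁ + m₂, add_le_add hm₁ hm₂, h₁.trans h₂⟩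
  | @ite_true p c d s t n hp _ ih =>
    intro Λ M emb exit hM
    obtain ⟨m, hm, h⟩ := ih M (fun l => emb (some (Sum.inl l))) exit fun l => hM (some (Sum.inl l))
    refine ⟨1 + m, by omega, Steps.trans (Steps.one ?_) h⟩
    rw [hM]
    simp only [entry, code, TM2.stepAux, hp, cond_true]
  | @ite_false p c d s t n hp _ ih =>
    intro Λ M emb exit hM
    obtain ⟨m, hm, h⟩ := ih M (fun l => emb (some (Sum.inr l))) exit fun l => hM (some (Sum.inr l))
    refine ⟨1 + m, by omega, Steps.trans (Steps.one ?_) h⟩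
    rw [hM]
    simp only [entry, code, TM2.stepAux, hp, cond_false]
  | loop_false hp =>
    intro Λ M emb exit hM
    refine ⟨1, le_rfl, Steps.one ?_⟩
    rw [hM]
    simp only [entry, code, TM2.stepAux, hp, cond_false]
  | loop_true hp _ _ ih₁ ih₂ =>
    intro Λ M emb exit hM
    obtain ⟨m₁, hm₁, h₁⟩ := ih₁ M (fun l => emb (some l)) _ fun l => hM (some l)
    obtain ⟨m₂, hm₂, h₂⟩ := ih₂ M emb exit hM
    refine ⟨1 + m₁ + m₂, by omega, Steps.trans (Steps.trans (Steps.one ?_) h₁) h₂⟩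
    rw [hM]
    simp only [entry, code, TM2.stepAux, hp, cond_true]
  | mono _ hle ih =>
    intro Λ M emb exit hM
    obtain ⟨m, hm, h⟩ := ih M emb exit hM
    exact ⟨m, hm.trans hle, h⟩

/-- Stacks grow by at most one symbol in a step. -/
theorem Run.length_le {c : Cmd Γ σ} {s t : σ × (∀ k, List (Γ k))} {n : ℕ} (h : Run c s t n)
    (k : K) : (t.2 k).length ≤ (s.2 k).length + n := by
  induction h with
  | load => simp
  | push k' f v S =>
    by_cases hk : k = k'
    · subst hk; simp
    · simp [hk]
  | pop k' f v S =>
    by_cases hk : k = k'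
    · subst hk; simp; omega
    · simp [hk]
  | seq | loop_true => omega
  | ite_true | ite_false | mono => omega
  | loop_false => simp

/-- Repeat `body` as long as `pop` leads to a register value that satisfies `p`. -/
def each (pop : Cmd Γ σ) (p : σ → Bool) (body : Cmd Γ σ) : Cmd Γ σ :=
  seq pop (loop p (seq body pop))

/-- Each item costs its body, the next pop and a test, hence `t + 2`; the final summand pays for the
first pop and the failing last test. -/
theorem Run.each {α β : Type} {pop body : Cmd Γ σ} {p : σ → Bool}
    {St : List α → β → σ × (∀ k, List (Γ k))} {Mid : α → List α → β → σ × (∀ k, List (Γ k))}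
    {fin : β → σ × (∀ k, List (Γ k))} {g : β → α → β} {t : ℕ} (P : List α → β → Prop)
    (hP : ∀ x l b, P (x :: l) b → P l (g b x))
    (hpop : ∀ x l b, P (x :: l) b → Run pop (St (x :: l) b) (Mid x l b) 1)
    (hp : ∀ x l b, P (x :: l) b → p (Mid x l b).1 = true)
    (hbody : ∀ x l b, P (x :: l) b → Run body (Mid x l b) (St l (g b x)) t)
    (hfin : ∀ b, P [] b → Run pop (St [] b) (fin b) 1)
    (hpf : ∀ b, P [] b → p (fin b).1 = false)
    (L : List α) (b : β) (hL : P L b) :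
    Run (each pop p body) (St L b) (fin (L.foldl g b)) ((t + 2) * L.length + 2) := by
  have key : ∀ (L : List α) (b : β), P L b → ∃ s, Run pop (St L b) s 1 ∧
      Run (loop p (Cmd.seq body pop)) s (fin (L.foldl g b)) ((t + 2) * L.length + 1) := by
    intro L
    induction L with
    | nil => exact fun b hL => ⟨_, hfin b hL, (Run.loop_false (hpf b hL)).mono (by simp)⟩
    | cons x l ih =>
      intro b hL
      obtain ⟨s, h1, h2⟩ := ih (g b x) (hP x l b hL)
      refine ⟨_, hpop x l b hL,
        (Run.loop_true (hp x l b hL) (.seq (hbody x l b hL) h1) h2).mono ?_⟩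
      simp only [List.length_cons]
      ring_nf; omega
  obtain ⟨s, h1, h2⟩ := key L b hL
  exact (h1.seq h2).mono (by omega)

/-- Do nothing. -/
def skip : Cmd Γ σ := load id

theorem Run.skip (s : σ × (∀ k, List (Γ k))) : Run Cmd.skip s s 1 := Run.load id s.1 s.2

/-- Perform commands one after the other. -/
def seqs : List (Cmd Γ σ) → Cmd Γ σ
  | [] => skip
  | c :: l => seq c (seqs l)

end Cmd

/-! ### From programs to polynomial-time computability -/

section
variable {K : Type} [DecidableEq K] {Γ : K → Type} {σ : Type}

/-- The contents of the stacks when all but one are empty. -/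
def singleStack (k : K) (w : List (Γ k)) : ∀ k, List (Γ k) := Function.update (fun _ => []) k w

theorem singleStack_self (k : K) (w : List (Γ k)) : singleStack k w k = w :=
  Function.update_self ..

theorem singleStack_of_ne {k k' : K} (w : List (Γ k)) (h : k' ≠ k) : singleStack k w k' = [] :=
  Function.update_of_ne h ..

/-- The machine for a program. -/
noncomputable def Cmd.machine [Fintype K] [Finite σ] (k₀ k₁ : K) [Finite (Γ k₀)] (init : σ)
    (c : Cmd Γ σ) : FinTM2 :=
  have := c.finite_label
  { K := K
    k₀ := k₀
    k₁ := k₁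
    Γ := Γ
    Λ := Option c.Label
    main := some c.entry
    ΛFin := Fintype.ofFinite _
    σ := σ
    initialState := init
    σFin := Fintype.ofFinite _
    Γk₀Fin := Fintype.ofFinite _
    m := fun
      | none => .halt
      | some l => c.code some none l }

theorem Cmd.tm2ComputableInPolyTime [Fintype K] [Finite σ] (k₀ k₁ : K) [Finite (Γ k₀)] (init : σ)
    (c : Cmd Γ σ) {α β : Type} (ea : α → List (Γ k₀)) (eb : β → List (Γ k₁)) (f : α → β)
    (time : Polynomial ℕ)
    (h : ∀ a, Run c (init, singleStack k₀ (ea a)) (init, singleStack k₁ (eb (f a)))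
      (time.eval (ea a).length)) :
    Nonempty (TM2ComputableInPolyTime ea eb f) := by
  -- The additional unit of time is the halting step at the exit label `none`.
  refine ⟨⟨⟨c.machine k₀ k₁ init, Equiv.refl _, Equiv.refl _⟩, time + 1, fun a => ?_⟩⟩
  have h1 := (h a).steps (c.machine k₀ k₁ init).m some none fun l => rfl
  have hex : ∃ m, m ≤ time.eval (ea a).length ∧ Steps (c.machine k₀ k₁ init).m m
    ⟨some (some c.entry), init, singleStack k₀ (ea a)⟩
    ⟨some none, init, singleStack k₁ (eb (f a))⟩ := h1
  refine ⟨⟨hex.choose + 1, ?_⟩, ?_⟩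
  · have h2 : Steps (c.machine k₀ k₁ init).m 1 ⟨some none, init, singleStack k₁ (eb (f a))⟩
      ⟨none, init, singleStack k₁ (eb (f a))⟩ := Steps.one rfl
    have h3 := hex.choose_spec.2.trans h2
    have hinit : initList (c.machine k₀ k₁ init) ((ea a).map (Equiv.refl _).invFun) =
        ⟨some (some c.entry), init, singleStack k₀ (ea a)⟩ := by
      simp only [initList, Cmd.machine]
      congr 1
      funext k
      by_cases hk : k = k₀
      · subst hk; exact (dif_pos rfl).trans ((List.map_id _).trans (singleStack_self _ _).symm)
      · exact (dif_neg hk).trans (singleStack_of_ne _ hk).symm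
    have hhalt : haltList (c.machine k₀ k₁ init) ((eb (f a)).map (Equiv.refl _).invFun) =
        ⟨none, init, singleStack k₁ (eb (f a))⟩ := by
      simp only [haltList, Cmd.machine]
      congr 1
      funext k
      by_cases hk : k = k₁
      · subst hk; exact (dif_pos rfl).trans ((List.map_id _).trans (singleStack_self _ _).symm)
      · exact (dif_neg hk).trans (singleStack_of_ne _ hk).symm
    refine (congrArg (fun x => (flip bind _)^[_] (some x)) hinit).trans (Eq.trans h3 ?_)
    exact (congrArg some hhalt).symm
  · have := hex.choose_spec.1
    simpa using this

end

end BoolIso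
namespace BoolIso

/-! ### Subroutines of the reduction program -/

instance : Fintype Role := ⟨{.row, .col, .cell}, by rintro (_ | _ | _) <;> simp⟩

/-- The counters of the program. -/
inductive Ctr : Type
  | pos (ρ : Role) | fst | snd | tot | tmp
  deriving DecidableEq, Fintype

/-- The stacks of the program: the input, a copy of it, the reversed output, the output, and
counters. -/
inductive Stack : Type
  | inp | aux | rev | out | ctr (x : Ctr)
  deriving DecidableEq, Fintype

/-- The alphabets of the stacks. -/
abbrev StackSymb (O : Type) : Stack → Type
  | .inp => GraphSymb
  | .aux => GraphSymb
  | .rev => O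
  | .out => O
  | .ctr _ => Unit

/-- The register of the program. -/
structure Reg (O : Type) where
  /-- the last symbol taken from the input -/
  g : Option GraphSymb
  /-- the last symbol taken from the reversed output -/
  o : Option O
  /-- has the last counter been positive? -/
  u : Bool
  /-- a flag -/
  fl : Bool

/-- The register with given flag. -/
def Reg.ofFlag {O : Type} (fl : Bool) : Reg O := ⟨none, none, false, fl⟩

theorem finite_reg (O : Type) [Finite O] : Finite (Reg O) := by
  have := finite_graphSymb
  refine Finite.of_injective (fun v : Reg O => (v.g, v.o, v.u, v.fl)) ?_
  rintro ⟨g, o, u, fl⟩ ⟨g', o', u', fl'⟩ h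
  simp_all

/-- Programs for the reduction. -/
abbrev Prog (O : Type) : Type := Cmd (StackSymb O) (Reg O)

/-- The contents of all stacks. -/
def mem {O : Type} (i a : List GraphSymb) (r o : List O) (c : Ctr → ℕ) :
    ∀ k, List (StackSymb O k)
  | .inp => i
  | .aux => a
  | .rev => r
  | .out => o
  | .ctr x => List.replicate (c x) ()

section
variable {O : Type} {i a : List GraphSymb} {r o : List O} {c : Ctr → ℕ}

theorem update_mem_inp (l : List GraphSymb) :
    Function.update (mem i a r o c) .inp l = mem l a r o c := by
  funext k; cases k <;> rfl

theorem update_mem_aux (l : List GraphSymb) :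
    Function.update (mem i a r o c) .aux l = mem i l r o c := by
  funext k; cases k <;> rfl

theorem update_mem_rev (l : List O) : Function.update (mem i a r o c) .rev l = mem i a l o c := by
  funext k; cases k <;> rfl

theorem update_mem_out (l : List O) : Function.update (mem i a r o c) .out l = mem i a r l c := by
  funext k; cases k <;> rfl

theorem update_mem_ctr (x : Ctr) (m : ℕ) :
    Function.update (mem i a r o c) (.ctr x) (List.replicate m ()) =
      mem i a r o (Function.update c x m) := by
  funext k
  cases k with
  | ctr y =>
    by_cases h : y = x
    · subst h; simp [mem]
    · have : Stack.ctr y ≠ Stack.ctr x := by simpa using h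
      rw [Function.update_of_ne this]
      simp [mem, Function.update_of_ne h]
  | _ => rfl

/-- Increase a counter. -/
def inc (x : Ctr) : Prog O := .push (.ctr x) fun _ => ()

/-- Decrease a counter and record whether it was positive. -/
def dec (x : Ctr) : Prog O := .pop (.ctr x) fun v s => { v with u := s.isSome }

/-- Forget the recorded sign of a counter. -/
def resetCtr : Prog O := .load fun v => { v with u := false }

/-- Forget the symbol taken from the input. -/
def resetSym : Prog O := .load fun v => { v with g := none }

/-- Take a symbol from the input. -/
def popInp : Prog O := .pop .inp fun v s => { v with g := s }

open Cmd

theorem run_inc (x : Ctr) (v : Reg O) : Run (inc x) (v, mem i a r o c)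
    (v, mem i a r o (Function.update c x (c x + 1))) 1 := by
  have := Run.push (Γ := StackSymb O) (.ctr x) (fun _ => ()) v (mem i a r o c)
  rwa [show (() :: mem i a r o c (.ctr x)) = List.replicate (c x + 1) () from rfl,
    update_mem_ctr] at this

theorem run_dec (x : Ctr) (v : Reg O) : Run (dec x) (v, mem i a r o c)
    ({ v with u := decide (c x ≠ 0) }, mem i a r o (Function.update c x (c x - 1))) 1 := by
  have h : Run (dec x) (v, mem i a r o c) ({ v with u := (List.replicate (c x) ()).head?.isSome },
      Function.update (mem i a r o c) (.ctr x) (List.replicate (c x) ()).tail) 1 :=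
    Run.pop (Γ := StackSymb O) (.ctr x) _ v (mem i a r o c)
  have h' : (List.replicate (c x) ()).head?.isSome = decide (c x ≠ 0) := by
    cases c x <;> simp [List.replicate_succ]
  rwa [h', List.tail_replicate, update_mem_ctr] at h

theorem run_resetCtr (v : Reg O) (S : ∀ k, List (StackSymb O k)) :
    Run resetCtr (v, S) ({ v with u := false }, S) 1 := Run.load _ v S

theorem run_resetSym (v : Reg O) (S : ∀ k, List (StackSymb O k)) :
    Run resetSym (v, S) ({ v with g := none }, S) 1 := Run.load _ v S

theorem run_popInp (v : Reg O) : Run popInp (v, mem i a r o c)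
    ({ v with g := i.head? }, mem i.tail a r o c) 1 := by
  have := Run.pop (Γ := StackSymb O) .inp (fun (v : Reg O) s => { v with g := s }) v (mem i a r o c)
  rwa [update_mem_inp] at this

/-- Repeat a command as often as a counter says. -/
def eachCtr (x : Ctr) (body : Prog O) : Prog O :=
  each (dec x) (fun v => v.u) (seq body resetCtr)

/-- Loops governed by a counter `x`; the other data are given by `β`. -/
theorem Run.eachCtr {β : Type} {x : Ctr} {body : Prog O} {V : β → Reg O}
    {I A : β → List GraphSymb} {U W : β → List O} {C : β → Ctr → ℕ} {g : β → β} {t : ℕ}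
    (P : β → Prop) (hP : ∀ b, P b → P (g b)) (hV : ∀ b, P b → (V b).u = false)
    (hbody : ∀ m b, P b → ∃ u, Run body
      ({ V b with u := true }, mem (I b) (A b) (U b) (W b) (Function.update (C b) x m))
      ({ V (g b) with u := u }, mem (I (g b)) (A (g b)) (U (g b)) (W (g b))
        (Function.update (C (g b)) x m)) t)
    (m : ℕ) (b : β) (hb : P b) : Run (eachCtr x body)
      (V b, mem (I b) (A b) (U b) (W b) (Function.update (C b) x m))
      (V (g^[m] b), mem (I (g^[m] b)) (A (g^[m] b)) (U (g^[m] b)) (W (g^[m] b))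
        (Function.update (C (g^[m] b)) x 0)) ((t + 3) * m + 2) := by
  have hV' : ∀ b, P b → { V b with u := false } = V b := fun b hb => by
    have := hV b hb
    cases h : V b; simp_all
  have := Run.each (K := Stack) (Γ := StackSymb O) (α := Unit) (β := β) (pop := dec x)
    (body := seq body resetCtr) (p := fun v : Reg O => v.u)
    (St := fun l b => (V b, mem (I b) (A b) (U b) (W b) (Function.update (C b) x l.length)))
    (Mid := fun _ l b => ({ V b with u := true },
      mem (I b) (A b) (U b) (W b) (Function.update (C b) x l.length)))
    (fin := fun b => (V b, mem (I b) (A b) (U b) (W b) (Function.update (C b) x 0)))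
    (g := fun b _ => g b) (t := t + 1) (fun _ b => P b) (fun _ _ b hb => hP b hb)
    (fun y l b hb => ?_) (fun _ _ _ _ => rfl) (fun y l b hb => ?_) (fun b hb => ?_)
    (fun b hb => hV b hb) (List.replicate m ()) b hb
  · have h : (List.replicate m ()).foldl (fun b _ => g b) b = g^[m] b := by
      clear this hb
      induction m generalizing b with
      | zero => rfl
      | succ m ih => rw [List.replicate_succ, List.foldl_cons, ih, Function.iterate_succ_apply]
    rw [h, List.length_replicate] at this
    exact this.mono (by simp)
  · have := run_dec (i := I b) (a := A b) (r := U b) (o := W b)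
      (c := Function.update (C b) x (y :: l).length) x (V b)
    simpa using this
  · obtain ⟨u, hu⟩ := hbody l.length b hb
    have := hu.seq (run_resetCtr _ _)
    simp only [hV' _ (hP b hb)] at this
    exact this
  · have := run_dec (i := I b) (a := A b) (r := U b) (o := W b)
      (c := Function.update (C b) x 0) x (V b)
    simpa [hV' b hb] using this

/-- Write a word, reversed, to the reversed output. -/
def emits : List O → Prog O
  | [] => skip
  | s :: l => seq (.push .rev fun _ => s) (emits l)

theorem run_emits (l : List O) (v : Reg O) (r : List O) : Run (emits l) (v, mem i a r o c)
    (v, mem i a (l.reverse ++ r) o c) (l.length + 1) := by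
  induction l generalizing r with
  | nil => exact Run.skip _
  | cons s l ih =>
    have h1 := Run.push (Γ := StackSymb O) .rev (fun _ => s) v (mem i a r o c)
    rw [update_mem_rev] at h1
    have h2 := h1.seq (ih (s :: r))
    simp only [List.reverse_cons, List.append_assoc, List.singleton_append]
    exact h2.mono (by simp; omega)

/-- Set a counter to zero. -/
def clearCtr (x : Ctr) : Prog O := eachCtr x skip

theorem run_clearCtr (x : Ctr) (v : Reg O) (hv : v.u = false) : Run (clearCtr x)
    (v, mem i a r o c) (v, mem i a r o (Function.update c x 0)) (4 * c x + 2) := by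
  have := Run.eachCtr (O := O) (β := Unit) (x := x) (body := skip) (V := fun _ => v)
    (I := fun _ => i)
    (A := fun _ => a) (U := fun _ => r) (W := fun _ => o) (C := fun _ => c) (g := id) (t := 1)
    (fun _ => True) (by simp) (fun _ _ => hv) (fun m b _ => ⟨true, Run.skip _⟩) (c x) () trivial
  rw [Function.update_eq_self] at this
  exact this.mono (by omega)

/-- Add a counter to another one. -/
def moveCtr (x y : Ctr) : Prog O := eachCtr x (inc y)

theorem run_moveCtr {x y : Ctr} (hxy : x ≠ y) (v : Reg O) (hv : v.u = false) : Run (moveCtr x y)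
    (v, mem i a r o c)
    (v, mem i a r o (Function.update (Function.update c y (c y + c x)) x 0)) (4 * c x + 2) := by
  have := Run.eachCtr (O := O) (β := ℕ) (x := x) (body := inc y) (V := fun _ => v) (I := fun _ => i)
    (A := fun _ => a) (U := fun _ => r) (W := fun _ => o) (C := fun m => Function.update c y m)
    (g := Nat.succ) (t := 1) (fun _ => True) (by simp) (fun _ _ => hv)
    (fun m b _ => ⟨true, by
      have := run_inc (O := O) (i := i) (a := a) (r := r) (o := o)
        (c := Function.update (Function.update c y b) x m) y { v with u := true }
      rw [Function.update_of_ne hxy.symm, Function.update_self,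
        Function.update_comm hxy _ _ (Function.update c y b), Function.update_idem] at this
      exact this⟩) (c x) (c y) trivial
  rw [Function.update_eq_self, Function.update_eq_self, Nat.succ_iterate] at this
  exact this.mono (by omega)

end

end BoolIso
namespace BoolIso

/-! ### Programs that write constraint applications -/

open Cmd

/-- The program writes a word that depends on the counters, and does not change anything else. Its
running time is linear in the counters. -/
def Emits {O : Type} (p : Prog O) (word : (Ctr → ℕ) → List O) : Prop :=
  ∃ κ, ∀ i a r o c bd (v : Reg O), v.u = false → c .tmp = 0 → (∀ ρ, c (.pos ρ) ≤ bd) →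
    Run p (v, mem i a r o c) (v, mem i a ((word c).reverse ++ r) o c) (κ * (bd + 1))

section
variable {O : Type}

theorem emits_emits (l : List O) : Emits (emits l) fun _ => l :=
  ⟨l.length + 1, fun _ _ _ _ _ _ v _ _ _ =>
    (run_emits l v _).mono (Nat.le_mul_of_pos_right _ (Nat.succ_pos _))⟩

theorem Emits.seq {p q : Prog O} {f g : (Ctr → ℕ) → List O} (hp : Emits p f) (hq : Emits q g) :
    Emits (seq p q) fun c => f c ++ g c := by
  obtain ⟨κ, hp⟩ := hp
  obtain ⟨l, hq⟩ := hq
  refine ⟨κ + l, fun i a r o c bd v hv hc hb => ?_⟩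
  have := (hp i a r o c bd v hv hc hb).seq (hq i a _ o c bd v hv hc hb)
  rw [List.reverse_append, List.append_assoc, add_mul]
  exact this

theorem Emits.seqs {ι : Type} {p : ι → Prog O} {f : ι → (Ctr → ℕ) → List O}
    (h : ∀ x, Emits (p x) (f x)) (L : List ι) :
    Emits (seqs (L.map p)) fun c => L.flatMap fun x => f x c := by
  induction L with
  | nil => exact ⟨1, fun i a r o c bd v _ _ _ => (Run.skip _).mono (by omega)⟩
  | cons x L ih => exact (h x).seq ih

/-- Write a word as often as the counter of a place says. -/
def emitSlot (l : List O) (ρ : Role) : Prog O :=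
  .seq (eachCtr (.pos ρ) (.seq (emits l) (inc .tmp))) (moveCtr .tmp (.pos ρ))

/-- The loop destroys its counter while `tmp` records it, and moving `tmp` back restores it. This is
why `Emits` assumes that `tmp` is zero. -/
theorem emits_emitSlot (s : O) (w : ℕ) (ρ : Role) :
    Emits (emitSlot (List.replicate w s) ρ) fun c => List.replicate (c (.pos ρ) * w) s := by
  refine ⟨w + 20, fun i a r o c bd v hv hc hb => ?_⟩
  have h1 := Run.eachCtr (O := O) (β := ℕ) (x := .pos ρ)
    (body := .seq (emits (List.replicate w s)) (inc .tmp)) (V := fun _ => v)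
    (I := fun _ => i) (A := fun _ => a) (U := fun m => List.replicate (m * w) s ++ r)
    (W := fun _ => o) (C := fun m => Function.update c .tmp m) (g := Nat.succ) (t := w + 2)
    (fun _ => True) (by simp) (fun _ _ => hv) (fun m b _ => ⟨true, by
      have h1 := run_emits (i := i) (a := a) (o := o)
        (c := Function.update (Function.update c .tmp b) (.pos ρ) m) (List.replicate w s)
        { v with u := true } (List.replicate (b * w) s ++ r)
      have h2 := run_inc (O := O) (i := i) (a := a)
        (r := (List.replicate w s).reverse ++ (List.replicate (b * w) s ++ r)) (o := o)
        (c := Function.update (Function.update c .tmp b) (.pos ρ) m) .tmp { v with u := true }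
      have h3 := h1.seq h2
      have hne : Ctr.tmp ≠ Ctr.pos ρ := by simp
      rw [Function.update_of_ne hne, Function.update_self,
        Function.update_comm hne.symm _ _ (Function.update c _ b), Function.update_idem,
        List.reverse_replicate, ← List.append_assoc, List.replicate_append_replicate,
        show w + b * w = b.succ * w by rw [Nat.succ_mul]; omega] at h3
      simpa using h3⟩) (c (.pos ρ)) 0 trivial
  have hne : Ctr.tmp ≠ Ctr.pos ρ := by simp
  have hc' : Function.update c .tmp 0 = c := by rw [← hc, Function.update_eq_self]
  rw [Nat.succ_iterate, zero_add, hc', Function.update_eq_self] at h1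
  have h2 := run_moveCtr (i := i) (a := a) (r := List.replicate (c (.pos ρ) * w) s ++ r) (o := o)
    (c := Function.update (Function.update c .tmp (c (.pos ρ))) (.pos ρ) 0) hne v hv
  rw [Function.update_self, Function.update_of_ne hne, Function.update_self, zero_add,
    Function.update_idem, Function.update_comm hne.symm _ _ (Function.update c _ _),
    Function.update_idem, hc', Function.update_eq_self] at h2
  have h3 := h1.seq h2
  simp only [Nat.zero_mul, List.replicate_zero, List.nil_append] at h3
  rw [List.reverse_replicate]
  refine h3.mono ?_
  have := hb ρ
  nlinarith [Nat.zero_le w]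

end

/-- Where a variable is found: the variable itself, or its distance from the first variable at a
place with given role. -/
abbrev Addr : Type := ℕ × Option Role

/-- The number of a variable, if there are `w` variables at each place. -/
def Addr.val (w : ℕ) (c : Ctr → ℕ) (A : Addr) : ℕ := A.1 + A.2.elim 0 fun ρ => c (.pos ρ) * w

section
variable {𝒞 : Finset Constraint}

/-- Write the number of a variable. -/
def emitNum (w : ℕ) : Addr → Prog (IsoSymb 𝒞)
  | (b, none) => emits (encodeNum 𝒞 b)
  | (b, some ρ) => .seq (emits (List.replicate b .tick))
    (.seq (emitSlot (List.replicate w .tick) ρ) (emits [.endNum]))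

theorem emits_emitNum (w : ℕ) (A : Addr) :
    Emits (emitNum w A) fun c => encodeNum 𝒞 (A.val w c) := by
  obtain ⟨b, _ | ρ⟩ := A
  · exact emits_emits _
  · have := (emits_emits (List.replicate b (IsoSymb.tick (𝒞 := 𝒞)))).seq
      ((emits_emitSlot .tick w ρ).seq (emits_emits [.endNum]))
    simp only [← List.append_assoc, List.replicate_append_replicate] at this
    exact this

/-- Write a constraint application. -/
def emitApp (w : ℕ) (C : {C : Constraint // C ∈ 𝒞}) (A : Fin C.1.arity → Addr) :
    Prog (IsoSymb 𝒞) :=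
  .seq (emits [.con C]) (seqs ((List.finRange C.1.arity).map fun q => emitNum w (A q)))

/-- Constraint applications, given by the addresses of their variables. -/
def appsWord (w : ℕ) (C : {C : Constraint // C ∈ 𝒞}) (L : List (Fin C.1.arity → Addr))
    (c : Ctr → ℕ) : List (IsoSymb 𝒞) :=
  L.flatMap fun A => .con C :: (List.finRange C.1.arity).flatMap fun q =>
    encodeNum 𝒞 ((A q).val w c)

/-- Write constraint applications. -/
def emitApps (w : ℕ) (C : {C : Constraint // C ∈ 𝒞}) (L : List (Fin C.1.arity → Addr)) :
    Prog (IsoSymb 𝒞) := seqs (L.map (emitApp w C))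

theorem emits_emitApp (w : ℕ) (C : {C : Constraint // C ∈ 𝒞}) (A : Fin C.1.arity → Addr) :
    Emits (emitApp w C A) fun c => .con C :: (List.finRange C.1.arity).flatMap fun q =>
      encodeNum 𝒞 ((A q).val w c) :=
  (emits_emits [IsoSymb.con C]).seq (Emits.seqs (fun q => emits_emitNum w (A q)) _)

theorem emits_emitApps (w : ℕ) (C : {C : Constraint // C ∈ 𝒞}) (L : List (Fin C.1.arity → Addr)) :
    Emits (emitApps w C L) (appsWord w C L) := Emits.seqs (emits_emitApp w C) L

end

end BoolIso
namespace BoolIso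

/-! ### Reading the graphs -/

open Cmd

/-- The counters: the position in the adjacency matrix, the two numbers of vertices, the common
number of vertices and an auxiliary counter. -/
def cnt (i j p f s t m : ℕ) : Ctr → ℕ
  | .pos .row => i
  | .pos .col => j
  | .pos .cell => p
  | .fst => f
  | .snd => s
  | .tot => t
  | .tmp => m

section
variable (i j p f s t m x : ℕ)

theorem update_cnt_row :
    Function.update (cnt i j p f s t m) (.pos .row) x = cnt x j p f s t m := by
  funext y; rcases y with (_ | _ | _) | _ | _ | _ | _ <;> simp [cnt, Function.update]

theorem update_cnt_col :
    Function.update (cnt i j p f s t m) (.pos .col) x = cnt i x p f s t m := by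
  funext y; rcases y with (_ | _ | _) | _ | _ | _ | _ <;> simp [cnt, Function.update]

theorem update_cnt_cell :
    Function.update (cnt i j p f s t m) (.pos .cell) x = cnt i j x f s t m := by
  funext y; rcases y with (_ | _ | _) | _ | _ | _ | _ <;> simp [cnt, Function.update]

theorem update_cnt_fst : Function.update (cnt i j p f s t m) .fst x = cnt i j p x s t m := by
  funext y; rcases y with (_ | _ | _) | _ | _ | _ | _ <;> simp [cnt, Function.update]

theorem update_cnt_snd : Function.update (cnt i j p f s t m) .snd x = cnt i j p f x t m := by
  funext y; rcases y with (_ | _ | _) | _ | _ | _ | _ <;> simp [cnt, Function.update]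

theorem update_cnt_tot : Function.update (cnt i j p f s t m) .tot x = cnt i j p f s x m := by
  funext y; rcases y with (_ | _ | _) | _ | _ | _ | _ <;> simp [cnt, Function.update]

theorem update_cnt_tmp : Function.update (cnt i j p f s t m) .tmp x = cnt i j p f s t x := by
  funext y; rcases y with (_ | _ | _) | _ | _ | _ | _ <;> simp [cnt, Function.update]

end

section
variable {O : Type}

/-- Does the register hold a bit? -/
def Reg.isBit (v : Reg O) : Bool :=
  match v.g with
  | some (.bit _) => true
  | _ => false

/-- Does the register hold the bit 1? -/
def Reg.isOne (v : Reg O) : Bool :=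
  match v.g with
  | some (.bit b) => b
  | _ => false

/-- Does the register hold the end of a row? -/
def Reg.isRow (v : Reg O) : Bool :=
  match v.g with
  | some .endRow => true
  | _ => false

/-- Raise the flag. -/
def setFlag : Prog O := .load fun v => { v with fl := true }

theorem run_setFlag (v : Reg O) (S : ∀ k, List (StackSymb O k)) :
    Run setFlag (v, S) ({ v with fl := true }, S) 1 := Run.load _ v S

/-- What is known about a part of the input: this part, reversed, the number of bits and rows of
the first graph, the numbers of rows of both graphs, and whether the first graph has ended. -/
abbrev Scan : Type := List GraphSymb × ℕ × ℕ × ℕ × Bool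

/-- Read one more symbol. -/
def Scan.step : Scan → GraphSymb → Scan
  | (a, k, f, s, false), .bit b => (.bit b :: a, k + 1, f, s, false)
  | (a, k, f, s, true), .bit b => (.bit b :: a, k, f, s, true)
  | (a, k, f, s, false), .endRow => (.endRow :: a, k + 1, f + 1, s, false)
  | (a, k, f, s, true), .endRow => (.endRow :: a, k, f, s + 1, true)
  | (a, k, f, s, _), .endGraph => (.endGraph :: a, k, f, s, true)

theorem Scan.foldl_row (k f s : ℕ) (a : List GraphSymb) (fl : Bool) (r : List Bool) :
    (r.map GraphSymb.bit ++ [GraphSymb.endRow]).foldl Scan.step (a, k, f, s, fl) =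
      ((r.map GraphSymb.bit ++ [GraphSymb.endRow]).reverse ++ a, if fl then k else k + r.length + 1,
        if fl then f else f + 1, if fl then s + 1 else s, fl) := by
  induction r generalizing a k with
  | nil => cases fl <;> rfl
  | cons b r ih =>
    cases fl
    · rw [List.map_cons, List.cons_append, List.foldl_cons]
      simp only [Scan.step, ih]
      simp
      omega
    · rw [List.map_cons, List.cons_append, List.foldl_cons]
      simp only [Scan.step, ih]
      simp

theorem Scan.foldl_rows (k f s q : ℕ) (a : List GraphSymb) (fl : Bool) (M : List (List Bool))
    (hM : ∀ r ∈ M, r.length = q) :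
    (M.flatMap fun r => r.map GraphSymb.bit ++ [GraphSymb.endRow]).foldl Scan.step
        (a, k, f, s, fl) =
      ((M.flatMap fun r => r.map GraphSymb.bit ++ [GraphSymb.endRow]).reverse ++ a,
        if fl then k else k + M.length * (q + 1),
        if fl then f else f + M.length, if fl then s + M.length else s, fl) := by
  induction M generalizing a k f s with
  | nil => cases fl <;> simp
  | cons r M ih =>
    rw [List.flatMap_cons, List.foldl_append, Scan.foldl_row,
      ih _ _ _ _ fun r hr => hM r (List.mem_cons_of_mem _ hr), hM r List.mem_cons_self]
    cases fl
    · simp [add_mul]; omega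
    · simp; omega

theorem Scan.foldl_encodeGraph (k f s : ℕ) (a : List GraphSymb) (fl : Bool) {n : ℕ}
    (G : SimpleGraph (Fin n)) : (encodeGraph G).foldl Scan.step (a, k, f, s, fl) =
      ((encodeGraph G).reverse ++ a, if fl then k else k + n * (n + 1), if fl then f else f + n,
        if fl then s + n else s, true) := by
  rw [encodeGraph_eq, List.foldl_append, Scan.foldl_rows (q := n) (hM := by simp)]
  simp [Scan.step]

/-- The count of bits and row ends of the first graph, `n * (n + 1)`, equals the number of places,
so writing a fixed number of ticks per symbol produces the number of variables in unary. -/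
theorem Scan.foldl_encode (P : GraphPair) :
    P.encode.foldl Scan.step ([], 0, 0, 0, false) =
      (P.encode.reverse, P.n * (P.n + 1), P.n, P.m, true) := by
  rw [GraphPair.encode, List.foldl_append, Scan.foldl_encodeGraph, Scan.foldl_encodeGraph]
  simp

/-- Write `w` symbols `s` for each bit and each row of the first graph, copy the input, count the
rows. -/
def scanBody (l : List O) : Prog O :=
  .seq (.push .aux fun v => v.g.getD .endGraph)
    (.ite Reg.isBit (.seq (.ite Reg.fl skip (emits l)) resetSym)
      (.ite Reg.isRow (.seq (.ite Reg.fl (inc .snd) (.seq (inc .fst) (emits l))) resetSym)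
        (.seq setFlag resetSym)))

theorem run_ticks (w k : ℕ) (s : O) (v : Reg O) (i a : List GraphSymb) (o : List O) (c : Ctr → ℕ) :
    Run (emits (List.replicate w s)) (v, mem i a (List.replicate (2 + k * w) s) o c)
      (v, mem i a (List.replicate (2 + (k + 1) * w) s) o c) (w + 1) := by
  have := run_emits (i := i) (a := a) (o := o) (c := c) (List.replicate w s) v
    (List.replicate (2 + k * w) s)
  rw [List.reverse_replicate, List.replicate_append_replicate, List.length_replicate,
    show w + (2 + k * w) = 2 + (k + 1) * w by ring] at this
  exact this

/-- The first pass over the input. -/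
def scan (l : List O) : Prog O := each popInp (fun v => v.g.isSome) (scanBody l)

theorem run_scan (w : ℕ) (s : O) (L : List GraphSymb) (b : Scan) :
    Run (scan (List.replicate w s))
      (⟨none, none, false, b.2.2.2.2⟩, mem L b.1 (List.replicate (2 + b.2.1 * w) s) []
        (cnt 0 0 0 b.2.2.1 b.2.2.2.1 0 0))
      (⟨none, none, false, (L.foldl Scan.step b).2.2.2.2⟩, mem [] (L.foldl Scan.step b).1
        (List.replicate (2 + (L.foldl Scan.step b).2.1 * w) s) []
        (cnt 0 0 0 (L.foldl Scan.step b).2.2.1 (L.foldl Scan.step b).2.2.2.1 0 0))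
      ((w + 10) * L.length + 2) := by
  refine Run.each (K := Stack) (Γ := StackSymb O) (σ := Reg O) (pop := popInp) (body := scanBody _)
    (p := fun v => v.g.isSome)
    (St := fun L b => (⟨none, none, false, b.2.2.2.2⟩,
      mem L b.1 (List.replicate (2 + b.2.1 * w) s) [] (cnt 0 0 0 b.2.2.1 b.2.2.2.1 0 0)))
    (Mid := fun x L b => (⟨some x, none, false, b.2.2.2.2⟩,
      mem L b.1 (List.replicate (2 + b.2.1 * w) s) [] (cnt 0 0 0 b.2.2.1 b.2.2.2.1 0 0)))
    (fin := fun b => (⟨none, none, false, b.2.2.2.2⟩,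
      mem [] b.1 (List.replicate (2 + b.2.1 * w) s) [] (cnt 0 0 0 b.2.2.1 b.2.2.2.1 0 0)))
    (g := Scan.step) (t := w + 8) (fun _ _ => True) (fun _ _ _ _ => trivial)
    (fun x l b _ => run_popInp _) (fun _ _ _ _ => rfl) ?_ (fun b _ => run_popInp _)
    (fun _ _ => rfl) L b trivial
  rintro x L ⟨a, k, f, n, fl⟩ -
  have h0 := Run.push (Γ := StackSymb O) .aux (fun v : Reg O => v.g.getD .endGraph)
    ⟨some x, none, false, fl⟩
    (mem L a (List.replicate (2 + k * w) s) [] (cnt 0 0 0 f n 0 0))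
  rw [update_mem_aux] at h0
  have hf := run_inc (i := L) (a := x :: a) (r := List.replicate (2 + k * w) s) (o := [])
    (c := cnt 0 0 0 f n 0 0) .fst ⟨some x, none, false, fl⟩
  rw [update_cnt_fst] at hf
  have hs := run_inc (i := L) (a := x :: a) (r := List.replicate (2 + k * w) s) (o := [])
    (c := cnt 0 0 0 f n 0 0) .snd ⟨some x, none, false, fl⟩
  rw [update_cnt_snd] at hs
  rcases x with β | _ | _
  · cases fl
    · exact (h0.seq (Run.ite_true rfl
        ((Run.ite_false rfl (run_ticks ..)).seq (run_resetSym _ _)))).mono (by omega)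
    · exact (h0.seq (Run.ite_true rfl
        ((Run.ite_true rfl (Run.skip _)).seq (run_resetSym _ _)))).mono (by omega)
  · cases fl
    · exact (h0.seq (Run.ite_false rfl (Run.ite_true rfl
        ((Run.ite_false rfl (hf.seq (run_ticks ..))).seq (run_resetSym _ _))))).mono (by omega)
    · exact (h0.seq (Run.ite_false rfl (Run.ite_true rfl
        ((Run.ite_true rfl hs).seq (run_resetSym _ _))))).mono (by omega)
  · cases fl <;> exact (h0.seq (Run.ite_false rfl (Run.ite_false rfl
        ((run_setFlag _ _).seq (run_resetSym _ _))))).mono (by omega)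

/-- Take a symbol from the copy of the input. -/
def popAux : Prog O := .pop .aux fun v s => { v with g := s }

theorem run_popAux (v : Reg O) (i a : List GraphSymb) (r o : List O) (c : Ctr → ℕ) :
    Run popAux (v, mem i a r o c) ({ v with g := a.head? }, mem i a.tail r o c) 1 := by
  have := Run.pop (Γ := StackSymb O) .aux (fun (v : Reg O) s => { v with g := s }) v (mem i a r o c)
  rwa [update_mem_aux] at this

/-- Take a symbol from the reversed output. -/
def popRev : Prog O := .pop .rev fun v s => { v with o := s }

theorem run_popRev (v : Reg O) (i a : List GraphSymb) (r o : List O) (c : Ctr → ℕ) :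
    Run popRev (v, mem i a r o c) ({ v with o := r.head? }, mem i a r.tail o c) 1 := by
  have := Run.pop (Γ := StackSymb O) .rev (fun (v : Reg O) s => { v with o := s }) v (mem i a r o c)
  rwa [update_mem_rev] at this

/-- Forget the symbol taken from the reversed output. -/
def resetOut : Prog O := .load fun v => { v with o := none }

theorem run_resetOut (v : Reg O) (S : ∀ k, List (StackSymb O k)) :
    Run resetOut (v, S) ({ v with o := none }, S) 1 := Run.load _ v S

/-- Put the copy of the input back. -/
def restore : Prog O := each popAux (fun v => v.g.isSome)
  (.seq (.push .inp fun v => v.g.getD .endGraph) resetSym)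

theorem run_restore (fl : Bool) (L : List GraphSymb) (r : List O) (c : Ctr → ℕ) :
    Run restore (⟨none, none, false, fl⟩, mem [] L r [] c)
      (⟨none, none, false, fl⟩, mem L.reverse [] r [] c) (4 * L.length + 2) := by
  have := Run.each (K := Stack) (Γ := StackSymb O) (σ := Reg O) (pop := popAux)
    (body := .seq (.push .inp fun v => v.g.getD .endGraph) resetSym) (p := fun v => v.g.isSome)
    (St := fun L b => (⟨none, none, false, fl⟩, mem b L r [] c))
    (Mid := fun x L b => (⟨some x, none, false, fl⟩, mem b L r [] c))
    (fin := fun b => (⟨none, none, false, fl⟩, mem b [] r [] c))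
    (g := fun b x => x :: b) (t := 2) (fun _ _ => True) (fun _ _ _ _ => trivial)
    (fun x l b _ => run_popAux ..) (fun _ _ _ _ => rfl) (fun x l b _ => ?_)
    (fun b _ => run_popAux ..)
    (fun _ _ => rfl) L [] trivial
  · rw [List.foldl_flip_cons_eq_append'] at this
    simp only [List.append_nil] at this
    exact this
  · have := Run.push (Γ := StackSymb O) .inp (fun v : Reg O => v.g.getD .endGraph)
      ⟨some x, none, false, fl⟩ (mem b l r [] c)
    rw [update_mem_inp] at this
    exact this.seq (run_resetSym _ _)

/-- Write the output. -/
def output (s : O) : Prog O := each popRev (fun v => v.o.isSome)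
  (.seq (.push .out fun v => v.o.getD s) resetOut)

theorem run_output (s : O) (fl : Bool) (L : List O) (c : Ctr → ℕ) :
    Run (output s) (⟨none, none, false, fl⟩, mem [] [] L [] c)
      (⟨none, none, false, fl⟩, mem [] [] [] L.reverse c) (4 * L.length + 2) := by
  have := Run.each (K := Stack) (Γ := StackSymb O) (σ := Reg O) (pop := popRev)
    (body := .seq (.push .out fun v => v.o.getD s) resetOut)
    (p := fun v => v.o.isSome)
    (St := fun L b => (⟨none, none, false, fl⟩, mem [] [] L b c))
    (Mid := fun x L b => (⟨none, some x, false, fl⟩, mem [] [] L b c))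
    (fin := fun b => (⟨none, none, false, fl⟩, mem [] [] [] b c))
    (g := fun b x => x :: b) (t := 2) (fun _ _ => True) (fun _ _ _ _ => trivial)
    (fun x l b _ => run_popRev ..) (fun _ _ _ _ => rfl) (fun x l b _ => ?_)
    (fun b _ => run_popRev ..)
    (fun _ _ => rfl) L [] trivial
  · rw [List.foldl_flip_cons_eq_append'] at this
    simp only [List.append_nil] at this
    exact this
  · have := Run.push (Γ := StackSymb O) .out (fun v : Reg O => v.o.getD s)
      ⟨none, some x, false, fl⟩ (mem [] [] l b c)
    rw [update_mem_out] at this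
    exact this.seq (run_resetOut _ _)

/-- Erase the input. -/
def eraseInp : Prog O := each popInp (fun v => v.g.isSome) resetSym

theorem run_eraseInp (fl : Bool) (L : List GraphSymb) (r : List O) (c : Ctr → ℕ) :
    Run eraseInp (⟨none, none, false, fl⟩, mem L [] r [] c)
      (⟨none, none, false, fl⟩, mem [] [] r [] c) (3 * L.length + 2) :=
  Run.each (K := Stack) (Γ := StackSymb O) (σ := Reg O) (β := Unit) (p := fun v => v.g.isSome)
    (St := fun L _ => (⟨none, none, false, fl⟩, mem L [] r [] c))
    (Mid := fun x L _ => (⟨some x, none, false, fl⟩, mem L [] r [] c))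
    (fin := fun _ => (⟨none, none, false, fl⟩, mem [] [] r [] c))
    (g := fun b _ => b) (t := 1) (fun _ _ => True) (fun _ _ _ _ => trivial)
    (fun _ _ _ _ => run_popInp _) (fun _ _ _ _ => rfl) (fun _ _ _ _ => run_resetSym _ _)
    (fun _ _ => run_popInp _) (fun _ _ => rfl) L () trivial

/-- Erase what has been written. -/
def eraseRev : Prog O := each popRev (fun v => v.o.isSome)
  resetOut

theorem run_eraseRev (fl : Bool) (L : List O) (c : Ctr → ℕ) :
    Run eraseRev (⟨none, none, false, fl⟩, mem [] [] L [] c)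
      (⟨none, none, false, fl⟩, mem [] [] [] [] c) (3 * L.length + 2) := by
  refine Run.each (K := Stack) (Γ := StackSymb O) (σ := Reg O) (β := Unit)
    (p := fun v => v.o.isSome)
    (St := fun L _ => (⟨none, none, false, fl⟩, mem [] [] L [] c))
    (Mid := fun x L _ => (⟨none, some x, false, fl⟩, mem [] [] L [] c))
    (fin := fun _ => (⟨none, none, false, fl⟩, mem [] [] [] [] c))
    (g := fun b _ => b) (t := 1) (fun _ _ => True) (fun _ _ _ _ => trivial)
    (fun x l _ _ => run_popRev ..) (fun _ _ _ _ => rfl) (fun _ _ _ _ => run_resetOut _ _)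
    (fun _ _ => run_popRev ..) (fun _ _ => rfl) L () trivial

/-- Raise the flag if the numbers of vertices differ. -/
def compare : Prog O :=
  .seq (eachCtr .fst (.seq (dec .snd) (.seq (.ite Reg.u skip setFlag) (inc .tot))))
    (eachCtr .snd setFlag)

/-- The two counters are lowered together. The flag is raised if the second runs out early or has
something left over, and `tot` retains the first number. -/
theorem run_compare (n m : ℕ) (i a : List GraphSymb) (r o : List O) :
    Run compare (⟨none, none, false, false⟩, mem i a r o (cnt 0 0 0 n m 0 0))
      (⟨none, none, false, decide (n ≠ m)⟩, mem i a r o (cnt 0 0 0 0 0 n 0))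
      (10 * n + 4 * m + 4) := by
  have h1 := Run.eachCtr (O := O) (β := ℕ × ℕ × Bool) (x := .fst)
    (body := .seq (dec .snd) (.seq (.ite Reg.u skip setFlag) (inc .tot)))
    (V := fun b => ⟨none, none, false, b.2.2⟩) (I := fun _ => i)
    (A := fun _ => a) (U := fun _ => r) (W := fun _ => o) (C := fun b => cnt 0 0 0 0 b.1 b.2.1 0)
    (g := fun b => (b.1 - 1, b.2.1 + 1, b.2.2 || b.1 == 0)) (t := 5)
    (fun _ => True) (by simp) (fun _ _ => rfl) ?_ n (m, 0, false) trivial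
  · have hg : ∀ n, (fun b : ℕ × ℕ × Bool => (b.1 - 1, b.2.1 + 1, b.2.2 || b.1 == 0))^[n]
        (m, 0, false) = (m - n, n, decide (m < n)) := by
      intro n
      induction n with
      | zero => simp
      | succ n ih =>
        rw [Function.iterate_succ_apply', ih]
        ext1
        · simp; omega
        · ext1
          · rfl
          · rw [Bool.eq_iff_iff]; simp; omega
    rw [hg] at h1
    have h2 := Run.eachCtr (O := O) (β := Bool) (x := .snd)
      (body := setFlag)
      (V := fun b => ⟨none, none, false, b⟩) (I := fun _ => i)
      (A := fun _ => a) (U := fun _ => r) (W := fun _ => o) (C := fun _ => cnt 0 0 0 0 0 n 0)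
      (g := fun _ => true) (t := 1)
      (fun _ => True) (by simp) (fun _ _ => rfl) (fun m b _ => ⟨true, run_setFlag _ _⟩) (m - n)
      (decide (m < n)) trivial
    have hf : (fun _ : Bool => true)^[m - n] (decide (m < n)) = decide (n ≠ m) := by
      cases h : m - n with
      | zero => rw [Function.iterate_zero_apply, decide_eq_decide]; omega
      | succ k => rw [Function.iterate_succ_apply']; simp; omega
    simp only [hf, update_cnt_fst, update_cnt_snd] at h1 h2
    exact (h1.seq h2).mono (by omega)
  · rintro k ⟨s, t, fl⟩ -
    have h1 := run_dec (i := i) (a := a) (r := r) (o := o) (c := cnt 0 0 0 k s t 0) .snd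
      ⟨none, none, true, fl⟩
    rw [update_cnt_snd] at h1
    have h2 : Run (.ite Reg.u skip setFlag) ((⟨none, none, decide (s ≠ 0), fl⟩ : Reg O),
        mem i a r o (cnt 0 0 0 k (s - 1) t 0)) (⟨none, none, decide (s ≠ 0), fl || s == 0⟩,
        mem i a r o (cnt 0 0 0 k (s - 1) t 0)) 2 := by
      cases s with
      | zero =>
        rw [show (fl || (0 : ℕ) == 0) = true by simp]
        exact Run.ite_false rfl (run_setFlag _ _)
      | succ s =>
        rw [show (fl || (s + 1) == 0) = fl by simp]
        exact Run.ite_true rfl (Run.skip _)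
    have h3 := run_inc (i := i) (a := a) (r := r) (o := o) (c := cnt 0 0 0 k (s - 1) t 0) .tot
      ⟨none, none, decide (s ≠ 0), fl || s == 0⟩
    rw [update_cnt_tot] at h3
    refine ⟨decide (s ≠ 0), ?_⟩
    simp only [update_cnt_fst]
    exact (h1.seq (h2.seq h3)).mono (by omega)

end

end BoolIso
namespace BoolIso

/-! ### Writing the constraint applications for a graph -/

open Cmd

theorem foldl_flatMap_finRange {α O S : Type} (step : S → α → S) {n : ℕ} (st : ℕ → List O → S)
    (F : Fin n → List α) (W : Fin n → List O)
    (h : ∀ (i : Fin n) u, (F i).foldl step (st i u) = st (i + 1) (u ++ W i)) (u : List O) :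
    ((List.finRange n).flatMap F).foldl step (st 0 u) =
      st n (u ++ (List.finRange n).flatMap W) := by
  induction n generalizing st u with
  | zero => simp
  | succ n ih =>
    have h0 := h 0 u
    rw [List.finRange_succ, List.flatMap_cons, List.flatMap_cons, List.foldl_append,
      ← List.append_assoc]
    rw [Fin.val_zero] at h0
    rw [h0, List.flatMap_map, List.flatMap_map]
    exact ih (fun m => st (m + 1)) (fun i => F i.succ) (fun i => W i.succ)
      (fun i u => h i.succ u) _

section
variable {O : Type} (row : (Ctr → ℕ) → List O) (cell : Bool → (Ctr → ℕ) → List O)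

/-- The word for a graph with `n` vertices. -/
noncomputable def graphWord {n : ℕ} (G : SimpleGraph (Fin n)) : List O :=
  open Classical in
  (List.finRange n).flatMap fun i =>
    ((List.finRange n).flatMap fun j =>
      cell (decide (G.Adj i j)) (cnt i j (n + i * n + j) 0 0 n 0)) ++
      row (cnt i n (n + (i + 1) * n) 0 0 n 0)

/-- The position in the adjacency matrix and the word written so far. -/
abbrev Pen (O : Type) : Type := ℕ × ℕ × ℕ × List O

/-- Read the end of a row (`none`) or a bit. -/
def Pen.step (t : ℕ) : Pen O → Option Bool → Pen O
  | (i, j, p, u), none => (i + 1, 0, p, u ++ row (cnt i j p 0 0 t 0))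
  | (i, j, p, u), some β => (i, j + 1, p + 1, u ++ cell β (cnt i j p 0 0 t 0))

/-- The entries of the adjacency matrix and the ends of the rows. -/
noncomputable def matrixWord {n : ℕ} (G : SimpleGraph (Fin n)) : List (Option Bool) :=
  open Classical in
  (List.finRange n).flatMap fun i =>
    ((List.finRange n).flatMap fun j => [some (decide (G.Adj i j))]) ++ [none]

/-- The cell counter starts at `n` because the places of pairs are numbered, row by row, after those
of the vertices. -/
theorem Pen.foldl_matrixWord {n : ℕ} (G : SimpleGraph (Fin n)) :
    (matrixWord G).foldl (Pen.step row cell n) (0, 0, n, []) =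
      (n, 0, n + n * n, graphWord row cell G) := by
  classical
  have := foldl_flatMap_finRange (Pen.step row cell n)
    (fun i u => ((i, 0, n + i * n, u) : Pen O))
    (fun i : Fin n => ((List.finRange n).flatMap fun j => [some (decide (G.Adj i j))]) ++ [none])
    (fun i => ((List.finRange n).flatMap fun j =>
      cell (decide (G.Adj i j)) (cnt i j (n + i * n + j) 0 0 n 0)) ++
      row (cnt i n (n + (i + 1) * n) 0 0 n 0)) (fun i u => ?_) []
  · rw [zero_mul, add_zero, List.nil_append] at this
    unfold matrixWord graphWord
    convert this
  · have := foldl_flatMap_finRange (Pen.step row cell n)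
      (fun j u => (((i : ℕ), j, n + i * n + j, u) : Pen O))
      (fun j : Fin n => [some (decide (G.Adj i j))])
      (fun j => cell (decide (G.Adj i j)) (cnt i j (n + i * n + j) 0 0 n 0)) (fun j u => rfl) u
    rw [add_zero] at this
    rw [List.foldl_append, this]
    simp only [List.foldl_cons, List.foldl_nil, Pen.step, ← List.append_assoc]
    rw [show n + (i : ℕ) * n + n = n + (i + 1) * n by ring]

/-- The symbol for an entry of the adjacency matrix or the end of a row. -/
def matrixSymb : Option Bool → GraphSymb
  | none => .endRow
  | some β => .bit β

theorem encodeGraph_eq_matrixWord {n : ℕ} (G : SimpleGraph (Fin n)) :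
    encodeGraph G = (matrixWord G).map matrixSymb ++ [.endGraph] := by
  unfold encodeGraph matrixWord
  rw [List.map_flatMap]
  congr 2
  funext i
  rw [List.map_append, List.map_flatMap, ← List.flatMap_pure_eq_map]
  rfl

theorem length_matrixWord {n : ℕ} (G : SimpleGraph (Fin n)) :
    (matrixWord G).length = n * (n + 1) := by
  simp [matrixWord, List.length_flatMap]

theorem length_encodeGraph {n : ℕ} (G : SimpleGraph (Fin n)) :
    (encodeGraph G).length = n * (n + 1) + 1 := by
  rw [encodeGraph_eq_matrixWord, List.length_append, List.length_map, length_matrixWord]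
  rfl

/-- Does the register hold an entry or the end of a row? -/
def Reg.inMatrix (v : Reg O) : Bool := v.isBit || v.isRow

/-- Write the applications for an entry or the end of a row. -/
def penBody (er e₀ e₁ : Prog O) : Prog O :=
  .ite Reg.isRow (.seq er (.seq (inc (.pos .row)) (.seq (clearCtr (.pos .col)) resetSym)))
    (.seq (.ite Reg.isOne e₁ e₀) (.seq (inc (.pos .col)) (.seq (inc (.pos .cell)) resetSym)))

variable {row cell} {er e₀ e₁ : Prog O}

theorem run_penBody (hr : Emits er row) (h₀ : Emits e₀ (cell false)) (h₁ : Emits e₁ (cell true)) :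
    ∃ κ, ∀ i a (r o : List O) t bd fl x (b : Pen O), b.1 ≤ bd → b.2.1 ≤ bd → b.2.2.1 ≤ bd →
      Run (penBody er e₀ e₁)
        (⟨some (matrixSymb x), none, false, fl⟩,
          mem i a (b.2.2.2.reverse ++ r) o (cnt b.1 b.2.1 b.2.2.1 0 0 t 0))
        (⟨none, none, false, fl⟩,
          mem i a ((Pen.step row cell t b x).2.2.2.reverse ++ r) o
            (cnt (Pen.step row cell t b x).1 (Pen.step row cell t b x).2.1
              (Pen.step row cell t b x).2.2.1 0 0 t 0)) (κ * (bd + 1)) := by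
  obtain ⟨κr, hr⟩ := hr
  obtain ⟨κ₀, h₀⟩ := h₀
  obtain ⟨κ₁, h₁⟩ := h₁
  refine ⟨κr + κ₀ + κ₁ + 20, ?_⟩
  rintro i a r o t bd fl x ⟨ci, cj, cp, u⟩ hi hj hp
  have hb : ∀ ρ, cnt ci cj cp 0 0 t 0 (.pos ρ) ≤ bd := by rintro (_ | _ | _) <;> assumption
  rcases x with _ | β
  · have s1 := hr i a (u.reverse ++ r) o _ bd ⟨some .endRow, none, false, fl⟩ rfl rfl hb
    rw [← List.append_assoc, ← List.reverse_append] at s1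
    have s2 := run_inc (i := i) (a := a) (r := (u ++ row (cnt ci cj cp 0 0 t 0)).reverse ++ r)
      (o := o) (c := cnt ci cj cp 0 0 t 0) (.pos .row) ⟨some .endRow, none, false, fl⟩
    rw [update_cnt_row] at s2
    have s3 := run_clearCtr (i := i) (a := a) (r := (u ++ row (cnt ci cj cp 0 0 t 0)).reverse ++ r)
      (o := o) (c := cnt (ci + 1) cj cp 0 0 t 0) (.pos .col) ⟨some .endRow, none, false, fl⟩ rfl
    rw [update_cnt_col] at s3
    refine (Run.ite_true rfl (s1.seq (s2.seq (s3.seq (run_resetSym _ _))))).mono ?_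
    simp only [cnt]
    nlinarith [Nat.zero_le κ₀, Nat.zero_le κ₁]
  · have s1 : Run (.ite Reg.isOne e₁ e₀) ((⟨some (.bit β), none, false, fl⟩ : Reg O),
        mem i a (u.reverse ++ r) o (cnt ci cj cp 0 0 t 0)) (⟨some (.bit β), none, false, fl⟩,
        mem i a ((u ++ cell β (cnt ci cj cp 0 0 t 0)).reverse ++ r) o (cnt ci cj cp 0 0 t 0))
        ((κ₀ + κ₁) * (bd + 1) + 1) := by
      rw [List.reverse_append, List.append_assoc]
      cases β
      · refine (Run.ite_false rfl (h₀ i a (u.reverse ++ r) o _ bd _ rfl rfl hb)).mono ?_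
        nlinarith [Nat.zero_le κ₁]
      · refine (Run.ite_true rfl (h₁ i a (u.reverse ++ r) o _ bd _ rfl rfl hb)).mono ?_
        nlinarith [Nat.zero_le κ₀]
    have s2 := run_inc (i := i) (a := a) (r := (u ++ cell β (cnt ci cj cp 0 0 t 0)).reverse ++ r)
      (o := o) (c := cnt ci cj cp 0 0 t 0) (.pos .col) ⟨some (.bit β), none, false, fl⟩
    rw [update_cnt_col] at s2
    have s3 := run_inc (i := i) (a := a) (r := (u ++ cell β (cnt ci cj cp 0 0 t 0)).reverse ++ r)
      (o := o) (c := cnt ci (cj + 1) cp 0 0 t 0) (.pos .cell) ⟨some (.bit β), none, false, fl⟩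
    rw [update_cnt_cell] at s3
    refine (Run.ite_false rfl (s1.seq (s2.seq (s3.seq (run_resetSym _ _))))).mono ?_
    nlinarith [Nat.zero_le κr]

/-- Write the applications for all entries and ends of rows. -/
def penLoop (er e₀ e₁ : Prog O) : Prog O := each popInp Reg.inMatrix (penBody er e₀ e₁)

theorem run_penLoop (hr : Emits er row) (h₀ : Emits e₀ (cell false)) (h₁ : Emits e₁ (cell true)) :
    ∃ κ, ∀ i a (r o : List O) t bd fl (L : List (Option Bool)) (b : Pen O), b.1 + L.length ≤ bd →
      b.2.1 + L.length ≤ bd → b.2.2.1 + L.length ≤ bd →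
      Run (penLoop er e₀ e₁)
        (⟨none, none, false, fl⟩, mem (L.map matrixSymb ++ .endGraph :: i) a
          (b.2.2.2.reverse ++ r) o (cnt b.1 b.2.1 b.2.2.1 0 0 t 0))
        (⟨some .endGraph, none, false, fl⟩,
          mem i a ((L.foldl (Pen.step row cell t) b).2.2.2.reverse ++ r) o
            (cnt (L.foldl (Pen.step row cell t) b).1 (L.foldl (Pen.step row cell t) b).2.1
              (L.foldl (Pen.step row cell t) b).2.2.1 0 0 t 0))
        (κ * (bd + 1) * (L.length + 1)) := by
  obtain ⟨κ, h⟩ := run_penBody hr h₀ h₁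
  refine ⟨κ + 2, fun i a r o t bd fl L b hi hj hp => ?_⟩
  have := Run.each (K := Stack) (Γ := StackSymb O) (σ := Reg O) (pop := popInp)
    (body := penBody er e₀ e₁) (p := Reg.inMatrix)
    (St := fun L b => (⟨none, none, false, fl⟩, mem (List.map matrixSymb L ++ .endGraph :: i) a
      (b.2.2.2.reverse ++ r) o (cnt b.1 b.2.1 b.2.2.1 0 0 t 0)))
    (Mid := fun x L b => (⟨some (matrixSymb x), none, false, fl⟩,
      mem (List.map matrixSymb L ++ .endGraph :: i) a
      (b.2.2.2.reverse ++ r) o (cnt b.1 b.2.1 b.2.2.1 0 0 t 0)))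
    (fin := fun b => (⟨some .endGraph, none, false, fl⟩, mem i a
      (b.2.2.2.reverse ++ r) o (cnt b.1 b.2.1 b.2.2.1 0 0 t 0)))
    (g := Pen.step row cell t) (t := κ * (bd + 1))
    -- No position counter grows by more than one per symbol, so its value plus the remaining length
    -- never increases.
    (fun L b => b.1 + L.length ≤ bd ∧ b.2.1 + L.length ≤ bd ∧ b.2.2.1 + L.length ≤ bd)
    ?_ (fun x l b _ => run_popInp _) (fun x _ _ _ => by cases x <;> rfl)
    (fun x l b hb => h _ a r o t bd fl x b (by omega) (by omega) (by omega))
    (fun b _ => run_popInp _) (fun _ _ => rfl) L b ⟨hi, hj, hp⟩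
  · refine this.mono ?_
    nlinarith [Nat.zero_le (bd * L.length), Nat.zero_le bd, Nat.zero_le (κ * bd), Nat.zero_le κ]
  · rintro (_ | β) l ⟨ci, cj, cp, u⟩ ⟨h1, h2, h3⟩ <;>
      simp only [List.length_cons] at h1 h2 h3 <;> refine ⟨?_, ?_, ?_⟩ <;>
      simp only [Pen.step] <;> omega

/-- Copy the number of vertices to the counter for the entries. -/
def copyTot : Prog O :=
  .seq (eachCtr .tot (.seq (inc (.pos .cell)) (inc .tmp))) (moveCtr .tmp .tot)

theorem run_copyTot (n : ℕ) (fl : Bool) (i a : List GraphSymb) (r o : List O) :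
    Run copyTot (⟨none, none, false, fl⟩, mem i a r o (cnt 0 0 0 0 0 n 0))
      (⟨none, none, false, fl⟩, mem i a r o (cnt 0 0 n 0 0 n 0)) (9 * n + 4) := by
  have h1 := Run.eachCtr (O := O) (β := ℕ) (x := .tot)
    (body := .seq (inc (.pos .cell)) (inc .tmp)) (V := fun _ => ⟨none, none, false, fl⟩)
    (I := fun _ => i) (A := fun _ => a) (U := fun _ => r) (W := fun _ => o)
    (C := fun b => cnt 0 0 b 0 0 n b) (g := Nat.succ) (t := 2)
    (fun _ => True) (by simp) (fun _ _ => rfl) (fun m b _ => ⟨true, by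
      have h1 := run_inc (i := i) (a := a) (r := r) (o := o) (c := cnt 0 0 b 0 0 m b) (.pos .cell)
        ⟨none, none, true, fl⟩
      have h2 := run_inc (i := i) (a := a) (r := r) (o := o) (c := cnt 0 0 (b + 1) 0 0 m b) .tmp
        ⟨none, none, true, fl⟩
      rw [update_cnt_cell] at h1
      rw [update_cnt_tmp] at h2
      simp only [update_cnt_tot]
      exact h1.seq h2⟩) n 0 trivial
  have h2 := run_moveCtr (i := i) (a := a) (r := r) (o := o) (c := cnt 0 0 n 0 0 0 n)
    (x := .tmp) (y := .tot) (by simp) ⟨none, none, false, fl⟩ rfl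
  rw [Nat.succ_iterate, zero_add, update_cnt_tot, update_cnt_tot] at h1
  rw [update_cnt_tot, update_cnt_tmp, show cnt 0 0 n 0 0 0 n .tot + cnt 0 0 n 0 0 0 n .tmp = n from
    zero_add n] at h2
  refine (h1.seq h2).mono ?_
  simp only [cnt]
  omega

/-- Write a set of applications for the next graph in the input. -/
def penGraph (er e₀ e₁ : Prog O) (s : O) : Prog O :=
  .seq copyTot (.seq (penLoop er e₀ e₁) (.seq (emits [s])
    (.seq (clearCtr (.pos .row)) (.seq (clearCtr (.pos .cell)) resetSym))))

theorem run_penGraph (hr : Emits er row) (h₀ : Emits e₀ (cell false)) (h₁ : Emits e₁ (cell true))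
    (s : O) : ∃ κ, ∀ i a (r o : List O) fl n (G : SimpleGraph (Fin n)),
      Run (penGraph er e₀ e₁ s)
        (⟨none, none, false, fl⟩, mem (encodeGraph G ++ i) a r o (cnt 0 0 0 0 0 n 0))
        (⟨none, none, false, fl⟩, mem i a ((graphWord row cell G ++ [s]).reverse ++ r) o
          (cnt 0 0 0 0 0 n 0)) (κ * ((encodeGraph G).length + 1) ^ 2) := by
  obtain ⟨κ, h⟩ := run_penLoop hr h₀ h₁
  refine ⟨2 * κ + 30, fun i a r o fl n G => ?_⟩
  have s1 := run_copyTot n fl (encodeGraph G ++ i) a r o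
  have s2 := h i a r o n (n + n * (n + 1)) fl (matrixWord G) (0, 0, n, [])
    (by simp [length_matrixWord]) (by simp [length_matrixWord]) (by simp [length_matrixWord])
  rw [Pen.foldl_matrixWord] at s2
  have s3 := run_emits (i := i) (a := a) (o := o) (c := cnt n 0 (n + n * n) 0 0 n 0) [s]
    ⟨some .endGraph, none, false, fl⟩ ((graphWord row cell G).reverse ++ r)
  have s4 := run_clearCtr (i := i) (a := a)
    (r := [s].reverse ++ ((graphWord row cell G).reverse ++ r)) (o := o)
    (c := cnt n 0 (n + n * n) 0 0 n 0) (.pos .row) ⟨some .endGraph, none, false, fl⟩ rfl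
  have s5 := run_clearCtr (i := i) (a := a)
    (r := [s].reverse ++ ((graphWord row cell G).reverse ++ r)) (o := o)
    (c := cnt 0 0 (n + n * n) 0 0 n 0) (.pos .cell) ⟨some .endGraph, none, false, fl⟩ rfl
  rw [update_cnt_row] at s4
  rw [update_cnt_cell] at s5
  rw [encodeGraph_eq_matrixWord, List.append_assoc, List.singleton_append] at s1 ⊢
  rw [List.reverse_append, List.append_assoc]
  refine (s1.seq (s2.seq (s3.seq (s4.seq (s5.seq (run_resetSym _ _)))))).mono ?_
  rw [List.length_append, List.length_map, length_matrixWord]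
  simp only [cnt, List.length_singleton]
  have h1 : n ≤ n * (n + 1) := Nat.le_mul_of_pos_right _ (Nat.succ_pos _)
  have h2 : n + n * n = n * (n + 1) := by ring
  rw [h2]
  generalize n * (n + 1) = x at *
  have h3 : κ * (n + x + 1) * (x + 1) ≤ 2 * κ * (x + 1 + 1) ^ 2 := by
    calc κ * (n + x + 1) * (x + 1) ≤ κ * (2 * (x + 2)) * (x + 2) := by gcongr <;> omega
      _ = 2 * κ * (x + 1 + 1) ^ 2 := by ring
  nlinarith

end

end BoolIso
namespace BoolIso

/-! ### The program of the reduction -/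

open Cmd

theorem singleStack_inp {O : Type} (l : List GraphSymb) :
    singleStack (Γ := StackSymb O) .inp l = mem l [] [] [] (cnt 0 0 0 0 0 0 0) := by
  funext k
  rcases k with _ | _ | _ | _ | (_ | _ | _) | _ | _ | _ | _ <;> rfl

theorem singleStack_out {O : Type} (l : List O) :
    singleStack (Γ := StackSymb O) .out l = mem [] [] [] l (cnt 0 0 0 0 0 0 0) := by
  funext k
  rcases k with _ | _ | _ | _ | (_ | _ | _) | _ | _ | _ | _ <;> rfl

section
variable {O : Type} {row : (Ctr → ℕ) → List O} {cell : Bool → (Ctr → ℕ) → List O}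
  {er e₀ e₁ : Prog O}

/-- Lower the flag. -/
def clearFlag : Prog O := .load fun v => { v with fl := false }

theorem run_clearFlag (v : Reg O) (S : ∀ k, List (StackSymb O k)) :
    Run clearFlag (v, S) ({ v with fl := false }, S) 1 := Run.load _ v S

/-- Write the number of variables, and compare the numbers of vertices. -/
def front (w : ℕ) (s e : O) : Prog O :=
  .seq (emits [s, s]) (.seq (scan (List.replicate w s))
    (.seq clearFlag (.seq (emits [e]) (.seq restore compare))))

theorem run_front (w : ℕ) (s e : O) (P : GraphPair) :
    Run (front w s e)
      (⟨none, none, false, false⟩, mem P.encode [] [] [] (cnt 0 0 0 0 0 0 0))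
      (⟨none, none, false, decide (P.n ≠ P.m)⟩, mem P.encode []
        (List.replicate (2 + P.n * (P.n + 1) * w) s ++ [e]).reverse []
        (cnt 0 0 0 0 0 P.n 0)) ((w + 30) * (P.encode.length + 1)) := by
  have s1 := run_emits (i := P.encode) (a := []) (o := []) (c := cnt 0 0 0 0 0 0 0) [s, s]
    ⟨none, none, false, false⟩ []
  have s2 := run_scan w s P.encode ([], 0, 0, 0, false)
  rw [Scan.foldl_encode] at s2
  have s3 := run_emits (i := []) (a := P.encode.reverse) (o := []) (c := cnt 0 0 0 P.n P.m 0 0) [e]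
    ⟨none, none, false, false⟩ (List.replicate (2 + P.n * (P.n + 1) * w) s)
  have s4 := run_restore false P.encode.reverse
    ([e].reverse ++ List.replicate (2 + P.n * (P.n + 1) * w) s) (cnt 0 0 0 P.n P.m 0 0)
  rw [List.reverse_reverse] at s4
  have s5 := run_compare P.n P.m P.encode []
    ([e].reverse ++ List.replicate (2 + P.n * (P.n + 1) * w) s) []
  rw [List.reverse_append, List.reverse_replicate]
  simp only [Nat.zero_mul, Nat.add_zero] at s2
  refine (s1.seq (s2.seq ((run_clearFlag _ _).seq (s3.seq (s4.seq s5))))).mono ?_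
  have hn : P.n ≤ P.encode.length := by
    rw [GraphPair.encode, List.length_append, length_encodeGraph]
    nlinarith
  have hm : P.m ≤ P.encode.length := by
    rw [GraphPair.encode, List.length_append, length_encodeGraph, length_encodeGraph]
    nlinarith
  simp only [List.length_reverse, List.length_cons, List.length_nil]
  nlinarith

/-- The program of the reduction. -/
def reduction (er e₀ e₁ : Prog O) (w : ℕ) (s e z : O) (no : List O) : Prog O :=
  .seq (.seq (front w s e)
      (.ite Reg.fl (.seq eraseInp (.seq eraseRev (emits no)))
        (.seq (penGraph er e₀ e₁ z) (penGraph er e₀ e₁ z))))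
    (.seq (output s) (.seq (clearCtr .tot) clearFlag))

open Classical in
theorem run_reduction (hr : Emits er row) (h₀ : Emits e₀ (cell false)) (h₁ : Emits e₁ (cell true))
    (w : ℕ) (s e z : O) (no : List O) : ∃ κ, ∀ P : GraphPair,
      Run (reduction er e₀ e₁ w s e z no) (Reg.ofFlag false, singleStack .inp P.encode)
        (Reg.ofFlag false, singleStack .out (if P.n = P.m then
          (List.replicate (2 + P.n * (P.n + 1) * w) s ++ [e]) ++
            ((graphWord row cell P.G ++ [z]) ++ (graphWord row cell P.H ++ [z]))
          else no)) (κ * (P.encode.length + 1) ^ 2) := by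
  obtain ⟨κ, h⟩ := run_penGraph hr h₀ h₁ z
  set A := 4 * (w + 30) + 2 * κ + no.length + 30 with hA
  have key : ∀ P : GraphPair, ∃ fl, Run (.seq (front w s e)
      (.ite Reg.fl (.seq eraseInp (.seq eraseRev (emits no)))
        (.seq (penGraph er e₀ e₁ z) (penGraph er e₀ e₁ z))))
      (⟨none, none, false, false⟩, mem P.encode [] [] [] (cnt 0 0 0 0 0 0 0))
      (⟨none, none, false, fl⟩, mem [] [] (if P.n = P.m then
          (List.replicate (2 + P.n * (P.n + 1) * w) s ++ [e]) ++
            ((graphWord row cell P.G ++ [z]) ++ (graphWord row cell P.H ++ [z]))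
          else no).reverse [] (cnt 0 0 0 0 0 P.n 0)) (A * (P.encode.length + 1) ^ 2) := by
    intro P
    have s1 := run_front w s e P
    -- The cost of erasing the written word is bounded by the time spent writing it, since a step
    -- adds at most one symbol to a stack.
    have hlen := s1.length_le .rev
    replace hlen : (List.replicate (2 + P.n * (P.n + 1) * w) s ++ [e]).reverse.length ≤
      0 + (w + 30) * (P.encode.length + 1) := hlen
    generalize hR : (List.replicate (2 + P.n * (P.n + 1) * w) s ++ [e]) = R at *
    by_cases hnm : P.n = P.m
    · obtain ⟨n, m, G, H⟩ := P
      dsimp only at hnm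
      subst hnm
      refine ⟨false, ?_⟩
      rw [if_pos rfl, List.reverse_append, List.reverse_append, List.append_assoc]
      have s2 := h (encodeGraph H) [] R.reverse [] false n G
      have s3 := h [] [] ((graphWord row cell G ++ [z]).reverse ++ R.reverse) [] false n H
      rw [List.append_nil] at s3
      simp only [ne_eq, not_true_eq_false, decide_false] at s1
      refine (s1.seq (Run.ite_false rfl (s2.seq s3))).mono ?_
      have h1 : (encodeGraph G).length ≤ (GraphPair.encode ⟨n, n, G, H⟩).length := by
        simp [GraphPair.encode]
      have h2 : (encodeGraph H).length ≤ (GraphPair.encode ⟨n, n, G, H⟩).length := by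
        simp [GraphPair.encode]
      generalize (GraphPair.encode ⟨n, n, G, H⟩).length = X at *
      have h3 : κ * ((encodeGraph G).length + 1) ^ 2 ≤ κ * (X + 1) ^ 2 := by gcongr
      have h4 : κ * ((encodeGraph H).length + 1) ^ 2 ≤ κ * (X + 1) ^ 2 := by gcongr
      have h5 : (w + 30) * (X + 1) ≤ (w + 30) * (X + 1) ^ 2 := by gcongr; nlinarith
      have h6 : 1 ≤ (X + 1) ^ 2 := Nat.one_le_pow _ _ (Nat.succ_pos _)
      rw [hA]
      nlinarith
    · refine ⟨true, ?_⟩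
      rw [if_neg hnm]
      have s2 := run_eraseInp true P.encode R.reverse (cnt 0 0 0 0 0 P.n 0)
      have s3 := run_eraseRev true R.reverse (cnt 0 0 0 0 0 P.n 0)
      have s4 := run_emits (i := []) (a := []) (o := []) (c := cnt 0 0 0 0 0 P.n 0) no
        ⟨none, none, false, true⟩ []
      rw [List.append_nil] at s4
      rw [show decide (P.n ≠ P.m) = true by simpa using hnm] at s1
      refine (s1.seq (Run.ite_true rfl (s2.seq (s3.seq s4)))).mono ?_
      generalize P.encode.length = X at *
      have h5 : (w + 30) * (X + 1) ≤ (w + 30) * (X + 1) ^ 2 := by gcongr; nlinarith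
      have h6 : 1 ≤ (X + 1) ^ 2 := Nat.one_le_pow _ _ (Nat.succ_pos _)
      have h7 : X ≤ (X + 1) ^ 2 := by nlinarith
      have h8 : no.length ≤ no.length * (X + 1) ^ 2 := Nat.le_mul_of_pos_right _ (by omega)
      have h9 : 0 ≤ κ * (X + 1) ^ 2 := Nat.zero_le _
      rw [hA]
      nlinarith
  refine ⟨5 * A + 20, fun P => ?_⟩
  obtain ⟨fl, s1⟩ := key P
  -- The running time so far also bounds the length of the word still to be reversed onto the output
  -- stack.
  have hlen := s1.length_le .rev
  generalize (if P.n = P.m then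
    (List.replicate (2 + P.n * (P.n + 1) * w) s ++ [e]) ++
      ((graphWord row cell P.G ++ [z]) ++ (graphWord row cell P.H ++ [z])) else no) = R at *
  replace hlen : R.reverse.length ≤ 0 + A * (P.encode.length + 1) ^ 2 := hlen
  have s2 := run_output s fl R.reverse (cnt 0 0 0 0 0 P.n 0)
  rw [List.reverse_reverse] at s2
  have s3 := run_clearCtr (i := []) (a := []) (r := []) (o := R) (c := cnt 0 0 0 0 0 P.n 0) .tot
    ⟨none, none, false, fl⟩ rfl
  rw [update_cnt_tot] at s3
  rw [singleStack_inp, singleStack_out]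
  refine (s1.seq (s2.seq (s3.seq (run_clearFlag _ _)))).mono ?_
  have hn : P.n ≤ P.encode.length := by
    rw [GraphPair.encode, List.length_append, length_encodeGraph]
    nlinarith
  simp only [cnt]
  generalize P.encode.length = X at *
  have h6 : 1 ≤ (X + 1) ^ 2 := Nat.one_le_pow _ _ (Nat.succ_pos _)
  have h7 : X ≤ (X + 1) ^ 2 := by nlinarith
  nlinarith

end

end BoolIso
namespace BoolIso

/-! ### The reduction -/

section
variable {μ : Mode} {B : ℕ}

/-- The number of variables at each place. -/
abbrev Mode.width (μ : Mode) (B : ℕ) : ℕ := Fintype.card (Fin B × μ.D)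

/-- The address of a variable. -/
noncomputable def addr : μ.Var (Role × Fin B) → Addr
  | .inl b => ((finTwoEquiv.symm b : ℕ), none)
  | .inr ((ρ, β), d) => (2 + Fintype.equivFin (Fin B × μ.D) (β, d), some ρ)

/-- The numbering of the variables. -/
noncomputable def number (μ : Mode) (B n : ℕ) :
    μ.Var (Slot n × Fin B) ≃ Fin (2 + (n + n * n) * μ.width B) :=
  (Equiv.sumCongr finTwoEquiv.symm <| (Equiv.prodAssoc _ _ _).trans <|
    (Equiv.prodCongr ((Equiv.sumCongr (Equiv.refl _) finProdFinEquiv).trans finSumFinEquiv)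
      (Fintype.equivFin (Fin B × μ.D))).trans finProdFinEquiv).trans finSumFinEquiv

/-- The reference variables have numbers 0 and 1; every other number is 2 plus the place times the
width plus an offset. The place is exactly what the counter of the role holds. -/
theorem number_mapVar {n : ℕ} (i j : Fin n) (j' f s t m : ℕ) (y : μ.Var (Role × Fin B))
    (h : j' = j) :
    (number μ B n (μ.mapVar (Prod.map (Role.slot i j) id) y) : ℕ) =
      (addr y).val (μ.width B) (cnt i j' (n + i * n + j) f s t m) := by
  subst h
  rcases y with b | ⟨⟨_ | _ | _, β⟩, d⟩ <;>
    simp [number, addr, Addr.val, Mode.mapVar, Role.slot, cnt] <;> ring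

theorem number_vertex {n : ℕ} (i : Fin n) (j p f s t m : ℕ) (y : μ.Var (Fin B)) :
    (number μ B n (μ.mapVar (fun c => (.inl i, c)) y) : ℕ) =
      (addr (μ.mapVar (fun c => (Role.row, c)) y)).val (μ.width B) (cnt i j p f s t m) := by
  rcases y with b | ⟨β, d⟩
  · simp [number, addr, Addr.val, Mode.mapVar]
  · simp [number, addr, Addr.val, Mode.mapVar, cnt]
    ring

variable {𝒞 : Finset Constraint} (C : {C : Constraint // C ∈ 𝒞})

/-- The set of constraint applications for a graph. -/
noncomputable def applications (T : Template C.1.arity μ B) {n : ℕ} (G : SimpleGraph (Fin n)) :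
    List (Application 𝒞 (Fin (2 + (n + n * n) * μ.width B))) :=
  (T.system G).map fun A => ⟨C, fun q => number μ B n (A q)⟩

/-- The words for the ends of rows. -/
noncomputable def rowWord (T : Template C.1.arity μ B) : (Ctr → ℕ) → List (IsoSymb 𝒞) :=
  appsWord (μ.width B) C (T.vert.map fun A q => addr (μ.mapVar (fun c => (Role.row, c)) (A q)))

/-- The words for the entries of the adjacency matrix. -/
noncomputable def cellWord (T : Template C.1.arity μ B) (β : Bool) :
    (Ctr → ℕ) → List (IsoSymb 𝒞) :=
  appsWord (μ.width B) C ((T.cell β).map fun A q => addr (A q))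

theorem encodeSet_applications (T : Template C.1.arity μ B) {n : ℕ} (G : SimpleGraph (Fin n)) :
    encodeSet (applications C T G) =
      graphWord (rowWord C T) (cellWord C T) G ++ [.endSet] := by
  classical
  unfold encodeSet applications graphWord Template.system
  rw [List.flatMap_map, List.flatMap_assoc]
  congr 2
  funext i
  rw [List.flatMap_append, List.flatMap_assoc]
  congr 1
  · congr 1
    funext j
    unfold Template.cellAt cellWord appsWord encodeApplication
    rw [List.flatMap_map, List.flatMap_map]
    simp only [number_mapVar i j j 0 0 n 0 _ rfl]
  · unfold Template.vertAt rowWord appsWord encodeApplication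
    rw [List.flatMap_map, List.flatMap_map]
    simp only [number_vertex i n (n + (i + 1) * n) 0 0 n 0]

theorem satisfies_applications (T : Template C.1.arity μ B) {n : ℕ} (G : SimpleGraph (Fin n))
    (a : Fin (2 + (n + n * n) * μ.width B) → Bool) :
    Satisfies a (applications C T G) ↔ Sat C.1.eval (a ∘ number μ B n) (T.system G) := by
  simp [Satisfies, applications, Sat, Application.eval]

theorem satisfies_rename {X : Type} (a : X → Bool) (π : Equiv.Perm X)
    (S : List (Application 𝒞 X)) :
    Satisfies a (S.map (Application.rename π)) ↔ Satisfies (a ∘ π) S := by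
  simp [Satisfies, Application.eval, Application.rename]

theorem isomorphic_applications (T : Template C.1.arity μ B) {n : ℕ} (G H : SimpleGraph (Fin n)) :
    Isomorphic (applications C T G) (applications C T H) ↔
      ∃ π : Equiv.Perm (μ.Var (Slot n × Fin B)),
        ∀ a, Sat C.1.eval (a ∘ π) (T.system G) ↔ Sat C.1.eval a (T.system H) := by
  simp only [Isomorphic, Equivalent, satisfies_rename, satisfies_applications]
  let e := number μ B n
  constructor
  · rintro ⟨π, h⟩
    refine ⟨(e.trans π).trans e.symm, fun a => ?_⟩
    have := h (a ∘ e.symm)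
    simpa [Function.comp_def, e] using this
  · rintro ⟨π, h⟩
    refine ⟨(e.symm.trans π).trans e, fun a => ?_⟩
    have := h (a ∘ e)
    simpa [Function.comp_def, e] using this

/-- An instance without isomorphism. -/
def noInstance : IsoInstance 𝒞 := ⟨C.1.arity, [⟨C, id⟩], []⟩

/-- The empty set is satisfied by all assignments, so an isomorphism would make the constraint
identically true and hence closed at each of its members. -/
theorem not_isomorphic_noInstance (h : Unclosed C.1.eval) :
    ¬ Isomorphic (noInstance C).S (noInstance C).U := by
  rintro ⟨(π : Equiv.Perm (Fin C.1.arity)), hπ⟩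
  obtain ⟨⟨p, hp⟩, h⟩ := h
  refine h p hp ?_
  have hall : ∀ a, C.1.eval a = true := fun a => by
    have : C.1.eval (fun i => a (π.symm (π i))) = true :=
      (satisfies_rename _ _ _).1 ((hπ (a ∘ π.symm)).2 fun _ h => absurd h List.not_mem_nil)
      ⟨C, id⟩ List.mem_cons_self
    simpa only [Equiv.symm_apply_apply] using this
  exact fun _ _ _ _ => ⟨hall _, hall _⟩

open Classical in
/-- The instance for a pair of graphs. -/
noncomputable def isoInstance (T : Template C.1.arity μ B) (P : GraphPair) : IsoInstance 𝒞 :=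
  if h : P.n = P.m then
    ⟨2 + (P.n + P.n * P.n) * μ.width B, applications C T P.G, applications C T (h ▸ P.H)⟩
  else noInstance C

open Classical in
theorem encode_isoInstance (T : Template C.1.arity μ B) (P : GraphPair) :
    (isoInstance C T P).encode =
      if P.n = P.m then
        (List.replicate (2 + (P.n + P.n * P.n) * μ.width B) .tick ++ [.endNum]) ++
          ((graphWord (rowWord C T) (cellWord C T) P.G ++ [.endSet]) ++
            (graphWord (rowWord C T) (cellWord C T) P.H ++ [.endSet]))
      else (noInstance C).encode := by
  obtain ⟨n, m, G, H⟩ := P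
  by_cases h : n = m
  · subst h
    rw [isoInstance, dif_pos rfl, if_pos rfl, IsoInstance.encode, encodeSet_applications,
      encodeSet_applications, encodeNum]
  · rw [isoInstance, dif_neg h, if_neg h]

theorem isoInstance_computable (T : Template C.1.arity μ B) :
    Nonempty (Turing.TM2ComputableInPolyTime GraphPair.encode IsoInstance.encode
      (isoInstance C T)) := by
  obtain ⟨p, κ, h⟩ : ∃ (p : Prog (IsoSymb 𝒞)) (κ : ℕ), ∀ P : GraphPair,
      Cmd.Run p (Reg.ofFlag false, singleStack .inp P.encode)
        (Reg.ofFlag false, singleStack .out (isoInstance C T P).encode)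
        (κ * (P.encode.length + 1) ^ 2) := by
    obtain ⟨κ, h⟩ := run_reduction (row := rowWord C T) (cell := cellWord C T)
      (emits_emitApps _ C _) (emits_emitApps _ C _) (emits_emitApps _ C _) (μ.width B)
      IsoSymb.tick .endNum .endSet (noInstance C).encode
    have hn : ∀ n : ℕ, n * (n + 1) = n + n * n := fun n => by ring
    simp only [hn, ← encode_isoInstance] at h
    exact ⟨_, κ, h⟩
  have := finite_isoSymb 𝒞
  have := finite_reg (IsoSymb 𝒞)
  have : Finite (StackSymb (IsoSymb 𝒞) .inp) := finite_graphSymb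
  refine Cmd.tm2ComputableInPolyTime (K := Stack) (Γ := StackSymb (IsoSymb 𝒞))
    (σ := Reg (IsoSymb 𝒞)) .inp .out (Reg.ofFlag false) p GraphPair.encode IsoInstance.encode
    (isoInstance C T) (Polynomial.C κ * (Polynomial.X + 1) ^ 2)
    fun P => (h P).mono (le_of_eq ?_)
  simp

theorem isoInstance_correct {κ : Kind} {T : Template C.1.arity μ (2 * κ.mult)}
    (hC : Unclosed C.1.eval) {R : (Fin C.1.arity → Bool) → Bool} (hT : T.Correct R κ) (ε : Bool)
    (hR : ∀ a, R a = C.1.eval fun q => xor (a q) ε) (P : GraphPair) :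
    Nonempty (P.G ≃g P.H) ↔ Isomorphic (isoInstance C T P).S (isoInstance C T P).U := by
  obtain ⟨n, m, G, H⟩ := P
  by_cases h : n = m
  · subst h
    rw [isoInstance, dif_pos rfl]
    exact (hT.nonempty_iso_iff ε hR G H).trans (isomorphic_applications C T G H).symm
  · rw [isoInstance, dif_neg h]
    refine iff_of_false ?_ (not_isomorphic_noInstance C hC)
    rintro ⟨φ⟩
    exact h (by simpa using Fintype.card_congr φ.toEquiv)

end

end BoolIso

theorem theoremG1 (𝒞 : Finset BoolIso.Constraint) (h𝒞 : ¬ BoolIso.IsTwoAffine 𝒞) :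
    BoolIso.PolyTimeManyOneReducible BoolIso.GI (BoolIso.ISO 𝒞) := by
  obtain ⟨C, hC, h⟩ : ∃ C ∈ 𝒞, ¬ C.IsTwoAffine := by
    simpa [BoolIso.IsTwoAffine] using h𝒞
  have hu := BoolIso.unclosed_of_not_isTwoAffine C h
  -- Here `ε = true` stands for the dual relation. The applications still use `C` itself: passing to
  -- the dual only complements the satisfying assignments.
  obtain ⟨R, ε, hR, μ, κ, hc, hE⟩ : ∃ R : (Fin C.arity → Bool) → Bool, ∃ ε : Bool,
      (∀ a, R a = C.eval fun q => xor (a q) ε) ∧ BoolIso.EncodesGraphs R := by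
    rcases BoolIso.encodesGraphs_or_dual hu with h | h
    · exact ⟨C.eval, false, by simp, h⟩
    · exact ⟨BoolIso.dual C.eval, true, by simp [BoolIso.dual], h⟩
  obtain ⟨T, hT⟩ := BoolIso.exists_template hc hE
  exact ⟨BoolIso.isoInstance ⟨C, hC⟩ T, BoolIso.isoInstance_computable ⟨C, hC⟩ T,
    BoolIso.isoInstance_correct ⟨C, hC⟩ hu hT ε hR⟩
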